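/- Let $1\le k\le m$, $n\ge 1$, and write $|\cdot|$ for the Hermitian norm on $\mathbb C^m$. Consider $k$ independent Gaussian random $SU(m+1)$-polynomials of degree $N$, in the affine chart $z_0=1$, $$s_j(z)=\sum_{|J|=N}\sqrt{N!/J!}\;c^{(j)}_J\,z^J ,\qquad j=1,\dots,k,$$ with i.i.d. standard complex Gaussian coefficients $c^{(j)}_J$. For distinct $z^1,\dots,z^n\in\mathbb C^m$ let $D_n(b,a;z)$ be the complex Gaussian joint density of the values $b^p_j=s_j(z^p)$ and derivatives $a^p_{jq}=\partial s_j/\partial z_q(z^p)$, i.e. $D_n(v;z)=e^{-\langle\Delta^{-1}v,v\rangle}/(\pi^{kn(1+m)}\det\Delta)$ for $v=(b,a)$, with $\Delta$ its covariance matrix. Let $$K^N_{nk}(z^1,\dots,z^n)=\int D_n(0,a;z)\prod_{p=1}^n\det\Big(\sum_{q,q'}a^p_{jq}\,\gamma_{q'q}(z^p)\,\overline{a^p_{j'q'}}\Big)_{j,j'}\,da$$ be the $n$-point correlation function of the common zeros, where $\gamma=(g_{qq'})^{-1}$ is the inverse of the Fubini–Study metric $g_{qq'}(z)=\big((1+|z|^2)\delta_{qq'}-\bar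 z_qz_{q'}\big)/(1+|z|^2)^2$. For distinct points the normalized scaling limit $$\widetilde K^\infty_{nkm}(z^1,\dots,z^n)=\lim_{N\to\infty}\Big(\tfrac{m!}{\pi^k(m-k)!}N^k\Big)^{-n}K^N_{nk}\Big(\tfrac{z^1}{\sqrt N},\dots,\tfrac{z^n}{\sqrt N}\Big)$$ exists. (By universality it is the scaling limit zero correlation function for powers of any positive line bundle on an $m$-dimensional compact complex manifold.) Define the connected correlation functions by $$\widetilde T^\infty_{nkm}(z^1,\dots,z^n)=\sum_{G}(-1)^{l+1}(l-1)!\prod_{j=1}^l\widetilde K^\infty_{n_jkm}(z^{i_1},\dots,z^{i_{n_j}}),$$ the sum being over all partitions $G=(G_1,\dots,G_l)$ of $\{1,\dots,n\}$, $G_j=\{i_1,\dots,i_{n_j}\}$. Let $$d(z^1,\dots,z^n)=\max_{\mathcal G}\prod_{l\in L}|z^{i(l)}-z^{f(l)}|^2e^{-|z^{i(l)}-z^{f(l)}|^2/2},$$ the maximum being over all finite oriented connected graphs $\mathcal G$ with vertices $z^1,\dots,z^n$ and edge set $L$ (parallel edges allowed; the edge $l$ goes from $z^{i(l)}$ to $z^{f(l)}$)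 such that every vertex is an endpoint of at least two edges. Then for every $c>0$ there are constants $C,R$, depending only on $n,k,m,c$, such that $$|\widetilde T^\infty_{nkm}(z^1,\dots,z^n)|\le C\,d(z^1,\dots,z^n)$$ for all $z^1,\dots,z^n\in\mathbb C^m$ with $|z^p-z^q|\ge c$ for all $p\ne q$ and $\max_{p,q}|z^p-z^q|\ge R$. That is, $\widetilde T^\infty_{nkm}=O(d)$ as $\max_{p,q}|z^p-z^q|\to\infty$, provided that $\min_{p\ne q}|z^p-z^q|\ge c>0$. -/

import Mathlib

open MeasureTheory Filter Topology
open scoped Matrix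

namespace RandomZeros

/-- The coordinate space `ℂ^m` with its Hermitian norm. -/
abbrev Cn (m : ℕ) : Type := EuclideanSpace ℂ (Fin m)

/-! ### The Gaussian ensemble of `SU(m+1)` polynomials -/

/-- Exponents `J = (j₀, …, j_m)` with `j₀ + ⋯ + j_m = N`. -/
abbrev Expo (m N : ℕ) : Type :=
  {J : Fin (m + 1) → Fin (N + 1) // ∑ i, (J i : ℕ) = N}

/-- The polynomial `∑_{|J| = N} √(N! / J!) c_J z^J` in the affine chart `z₀ = 1`. -/
noncomputable def suPoly (m N : ℕ) (c : Expo m N → ℂ) (z : Cn m) : ℂ :=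
  ∑ J : Expo m N,
    c J * (Real.sqrt (Nat.multinomial Finset.univ (fun i => (J.1 i : ℕ)) : ℝ) : ℂ) *
      ∏ q : Fin m, z q ^ (J.1 q.succ : ℕ)

/-- The partial derivative `∂f/∂z_q` at `z`. -/
noncomputable def dz {m : ℕ} (f : Cn m → ℂ) (q : Fin m) (z : Cn m) : ℂ :=
  fderiv ℂ f z (EuclideanSpace.single q 1)

/-- The standard complex Gaussian measure `π^{-d} e^{-|c|²} dc` on `ℂ^I`, `d = |I|`. -/
noncomputable def stdGaussian (I : Type) [Fintype I] : Measure (I → ℂ) :=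
  (volume : Measure (I → ℂ)).withDensity fun c =>
    ENNReal.ofReal ((Real.pi ^ Fintype.card I)⁻¹ * Real.exp (-∑ i, ‖c i‖ ^ 2))

/-- Labels of the variables `b^p_j` (left) and `a^p_{jq}` (right). -/
abbrev JetIdx (ι : Type) (k m : ℕ) : Type :=
  (ι × Fin k) ⊕ (ι × Fin k × Fin m)

/-- The 1-jets at the points `z^p` of the `k`-tuple of polynomials with coefficients `c`:
`b^p_j = s_j(z^p)` and `a^p_{jq} = ∂s_j/∂z_q (z^p)`. -/
noncomputable def jet {ι : Type} (k m N : ℕ) (z : ι → Cn m) (c : Fin k × Expo m N → ℂ) :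
    JetIdx ι k m → ℂ :=
  Sum.elim
    (fun u => suPoly m N (fun J => c (u.2, J)) (z u.1))
    (fun u => dz (suPoly m N (fun J => c (u.2.1, J))) u.2.2 (z u.1))

/-- The covariance matrix `E (v_u conj v_w)` of the vector of 1-jets. -/
noncomputable def jetCov {ι : Type} (k m N : ℕ) (z : ι → Cn m) :
    Matrix (JetIdx ι k m) (JetIdx ι k m) ℂ :=
  Matrix.of fun u w =>
    ∫ c, jet k m N z c u * star (jet k m N z c w) ∂(stdGaussian (Fin k × Expo m N))

/-- The density `exp(-⟨Δ⁻¹ v, v⟩) / (π^d det Δ)` of the complex Gaussian measure on `ℂ^I`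
with covariance matrix `Δ`. -/
noncomputable def gaussianDensity {I : Type} [Fintype I] [DecidableEq I]
    (Δ : Matrix I I ℂ) (v : I → ℂ) : ℝ :=
  Real.exp (-(star v ⬝ᵥ (Δ⁻¹ *ᵥ v)).re) / (Real.pi ^ Fintype.card I * Δ.det.re)

/-! ### Zero correlation functions and their scaling limits -/

/-- The coefficients `g_{qq'}` of the Fubini–Study metric in the affine chart. -/
noncomputable def fubiniStudy {m : ℕ} (z : Cn m) : Matrix (Fin m) (Fin m) ℂ :=
  Matrix.of fun q q' =>
    (((1 + ‖z‖ ^ 2 : ℝ) : ℂ) * (if q = q' then 1 else 0) - star (z q) * z q') /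
      ((1 + ‖z‖ ^ 2 : ℝ) : ℂ) ^ 2

/-- `det(ξ ξ*) = det (∑_{q,q'} a_{jq} γ_{q'q} conj a_{j'q'})_{j,j'}`, with `γ = g⁻¹` the inverse
of the Fubini–Study metric at `z`. -/
noncomputable def jacobian {k m : ℕ} (z : Cn m) (a : Matrix (Fin k) (Fin m) ℂ) : ℝ :=
  (a * ((fubiniStudy z)⁻¹)ᵀ * aᴴ).det.re

/-- The zero correlation function `K_n(z) = ∫ D_n(0, ξ; z) ∏_p det(ξ^p ξ^{p*}) dξ` of `k` independent
random `SU(m+1)` polynomials of degree `N`, at points labelled by `ι`; `D_n` is the joint density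
of values and first derivatives at the points. -/
noncomputable def zeroCorr {ι : Type} [Fintype ι] [DecidableEq ι] (k m N : ℕ) (z : ι → Cn m) : ℝ :=
  ∫ a : ι × Fin k × Fin m → ℂ,
    gaussianDensity (jetCov k m N z) (Sum.elim (0 : ι × Fin k → ℂ) a) *
      ∏ p : ι, jacobian (z p) (Matrix.of fun j q => a (p, j, q))

/-- `(c_{mk} N^k)^{-n} K^N_{nk}(z^1/√N, …, z^n/√N)`, with `c_{mk} = m! / (π^k (m-k)!)`. -/
noncomputable def scaledCorr {ι : Type} [Fintype ι] [DecidableEq ι]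
    (k m : ℕ) (z : ι → Cn m) (N : ℕ) : ℝ :=
  (((m.factorial : ℝ) / (Real.pi ^ k * ((m - k).factorial : ℝ)) * (N : ℝ) ^ k) ^
      Fintype.card ι)⁻¹ *
    zeroCorr k m N (fun p => (((Real.sqrt N)⁻¹ : ℝ) : ℂ) • z p)

/-- The normalized scaling limit zero correlation function `K̃^∞_{nkm}`. -/
noncomputable def limitCorr {ι : Type} [Fintype ι] [DecidableEq ι]
    (k m : ℕ) (z : ι → Cn m) : ℝ :=
  limUnder atTop (scaledCorr k m z)

/-- The connected correlation function
`T̃^∞_{nkm}(z) = ∑_G (-1)^{l+1} (l-1)! ∏_{j ≤ l} K̃^∞(z restricted to G_j)`,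
the sum being over all partitions `G = (G_1, …, G_l)` of the set of labels. -/
noncomputable def connectedCorr {n : ℕ} (k m : ℕ) (z : Fin n → Cn m) : ℝ :=
  ∑ G : Finpartition (Finset.univ : Finset (Fin n)),
    (-1 : ℝ) ^ (G.parts.card + 1) * ((G.parts.card - 1).factorial : ℝ) *
      ∏ B ∈ G.parts, limitCorr k m (fun p : {x // x ∈ B} => z p)

/-! ### The function `d` -/

/-- Oriented connected graphs on the vertices `1, …, n` (parallel edges are allowed) with
at least two edges at every vertex. -/
structure ConnGraph (n : ℕ) where
  /-- number of edges -/
  numEdges : ℕ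
  /-- initial vertex of an edge -/
  ini : Fin numEdges → Fin n
  /-- final vertex of an edge -/
  ter : Fin numEdges → Fin n
  connected : (SimpleGraph.fromRel fun v w => ∃ l, ini l = v ∧ ter l = w).Connected
  two_le : ∀ v, 2 ≤ (Finset.univ.filter fun l => ini l = v ∨ ter l = v).card

/-- `d(z^1, …, z^n) = max_G ∏_{l} |z^{i(l)} - z^{f(l)}|² exp(-|z^{i(l)} - z^{f(l)}|² / 2)`. -/
noncomputable def decay {n m : ℕ} (z : Fin n → Cn m) : ℝ :=
  ⨆ G : ConnGraph n, ∏ l : Fin G.numEdges,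
    ‖z (G.ini l) - z (G.ter l)‖ ^ 2 * Real.exp (-‖z (G.ini l) - z (G.ter l)‖ ^ 2 / 2)

end RandomZeros

namespace RandomZeros

/-! ### Moments of the standard complex Gaussian measure -/

/-! The correlation function is a rational function of the covariance matrix of the 1-jets, and its
connected version inherits a graph structure from two algebraic symmetries of that rational
function.

Conditioning a Gaussian jet on vanishing values leaves a Gaussian in the derivatives whose
covariance is the Schur complement of the value block `A`. Wick's formula turns the expected product
of Gram determinants into a polynomial in that Schur complement, so up to a power of π the
correlation is `corrForm`, namely `(det A)⁻¹` times this polynomial. Under the scaling `z/√N` the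
covariances tend to those of the Bargmann–Fock kernel `exp⟨z,w⟩`. These are positive definite at
distinct points (`limCov_posDef`), so the limit exists by continuity. `corrForm` does not change
when values and derivatives are multiplied by `exp(-|z|²/2)` and derivatives are made covariant
(`corrForm_gauge`). In this gauge an entry joining points at distance `r ≥ c` is at most a constant
times `r² exp(-r²/2)`, and an entry at a single point is at most 1 (`norm_normCov_le`,
`norm_normCov_le_one`).

The connected correlation is the cumulant of the set function `S ↦ K(S)`, hence of the form `P /
δ^M`, where `δ` is the product over all `S` of the determinants of the value blocks
(`exists_rational_cumulant`). Read a monomial of `P` as a directed multigraph on the points, one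
edge per matrix entry. Conjugation by a diagonal torus acting on the points fixes the cumulant, so
every vertex has equal in- and out-degree. If the matrix splits along `S` and its complement, `K` is
multiplicative and the cumulant vanishes, so every monomial has an edge across every cut. With the
loops removed, the graph is connected and has an edge into and an edge out of every vertex; it is
therefore one of the graphs in the definition of `decay`, and the monomial is `O(decay)`.

It remains to bound `δ` below uniformly over `c`-separated configurations. The kernel `exp⟨z,w⟩`
dominates `ε F(z) conj F(w)` for products `F` of affine functions (`exp_kernel_lower_bound`). Taking
for `F` an interpolation polynomial centred at one of the points gives a constant that depends only
on `c` and the number of points. -/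

theorem integral_norm_pow_mul_exp (a : ℕ) :
    ∫ z : ℂ, ‖z‖ ^ (2 * a) * Real.exp (-‖z‖ ^ 2) = Real.pi * a.factorial := by
  have h := Complex.integral_rpow_mul_exp_neg_rpow (p := 2) (q := ((2 * a : ℕ) : ℝ)) (by norm_num)
    (by have : (0 : ℝ) ≤ ((2 * a : ℕ) : ℝ) := by positivity
        linarith)
  have e : (((2 * a : ℕ) : ℝ) + 2) / 2 = (a : ℝ) + 1 := by push_cast; ring
  simp only [Real.rpow_natCast, e, Real.Gamma_nat_eq_factorial] at h
  have h2 : ∀ x : ℂ, ‖x‖ ^ (2 : ℝ) = ‖x‖ ^ 2 := fun x => by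
    rw [← Real.rpow_natCast]; norm_num
  simp only [h2] at h
  rw [h]; ring

theorem integrable_norm_pow_mul_exp (a : ℕ) :
    Integrable fun z : ℂ => ‖z‖ ^ (2 * a) * Real.exp (-‖z‖ ^ 2) := by
  apply Integrable.of_integral_ne_zero
  rw [integral_norm_pow_mul_exp]
  have := Real.pi_pos
  positivity

theorem integrable_pow_mul_star_pow (a b : ℕ) :
    Integrable fun z : ℂ => z ^ a * star z ^ b * (Real.exp (-‖z‖ ^ 2) : ℂ) := by
  have h := (integrable_norm_pow_mul_exp 0).add (integrable_norm_pow_mul_exp (a + b))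
  refine h.mono' (by fun_prop) (ae_of_all _ fun z => ?_)
  have e := Real.exp_pos (-‖z‖ ^ 2)
  have h1 : ‖z‖ ^ (a + b) ≤ 1 + ‖z‖ ^ (2 * (a + b)) := by
    rw [mul_comm 2, pow_mul]
    nlinarith [sq_nonneg (‖z‖ ^ (a + b) - 1), pow_nonneg (norm_nonneg z) (a + b)]
  simp only [norm_mul, norm_pow, norm_star, ← pow_add, Pi.add_apply, mul_zero, pow_zero]
  rw [Complex.norm_real, Real.norm_of_nonneg e.le, ← add_mul]
  gcongr

theorem integral_pow_mul_star_pow (a b : ℕ) :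
    ∫ z : ℂ, z ^ a * star z ^ b * (Real.exp (-‖z‖ ^ 2) : ℂ) =
      if a = b then (Real.pi : ℂ) * a.factorial else 0 := by
  split_ifs with h
  · subst h
    have := congrArg (fun x : ℝ => (x : ℂ)) (integral_norm_pow_mul_exp a)
    simp only [← integral_complex_ofReal] at this
    push_cast at this ⊢
    rw [← this]
    refine integral_congr_ae (ae_of_all _ fun z => ?_)
    simp only [pow_mul]
    rw [← mul_pow]
    have : z * star z = (‖z‖ : ℂ) ^ 2 := by
      rw [← Complex.mul_conj']; rfl
    rw [this]
  · set d : ℝ := (a : ℝ) - b with hd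
    have hd0 : d ≠ 0 := by
      rw [hd, sub_ne_zero]; exact_mod_cast h
    -- Rotation by `ω = exp(iπ/(a-b))` preserves the measure and multiplies the integrand by
    -- `ω^(a-b) = -1`, so the integral equals its own negative.
    set ω : Circle := Circle.exp (Real.pi / d) with hω
    have key : (ω : ℂ) ^ a * star (ω : ℂ) ^ b = -1 := by
      have h1 : star (ω : ℂ) = Complex.exp (-(((Real.pi / d : ℝ) : ℂ) * Complex.I)) := by
        rw [hω, Circle.coe_exp]
        change (starRingEnd ℂ) _ = _
        rw [← Complex.exp_conj]; simp
      rw [h1, hω, Circle.coe_exp, ← Complex.exp_nat_mul, ← Complex.exp_nat_mul, ← Complex.exp_add,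
        ← Complex.exp_pi_mul_I]
      congr 1
      have : (d : ℂ) ≠ 0 := by exact_mod_cast hd0
      push_cast
      field_simp
      rw [hd]; push_cast; ring
    have hm : MeasurePreserving (rotation ω) (volume : Measure ℂ) volume :=
      (rotation ω).measurePreserving
    have h2 := hm.integral_comp (rotation ω).toHomeomorph.measurableEmbedding
      (fun z : ℂ => z ^ a * star z ^ b * (Real.exp (-‖z‖ ^ 2) : ℂ))
    simp only [rotation_apply, norm_mul, Circle.norm_coe, one_mul, mul_pow, star_mul'] at h2
    have h3 : ∀ z : ℂ, (ω : ℂ) ^ a * z ^ a * (star (ω : ℂ) ^ b * star z ^ b) *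
        (Real.exp (-‖z‖ ^ 2) : ℂ) =
        (-1) * (z ^ a * star z ^ b * (Real.exp (-‖z‖ ^ 2) : ℂ)) := by
      intro z
      rw [← key]; ring
    simp only [h3] at h2
    rw [integral_const_mul] at h2
    linear_combination -(1 / 2 : ℂ) * h2

variable {V : Type} [Fintype V]

theorem integral_stdGaussian (f : (V → ℂ) → ℂ) :
    ∫ g, f g ∂stdGaussian V =
      ∫ g : V → ℂ, f g * ∏ v, ((Real.pi⁻¹ * Real.exp (-‖g v‖ ^ 2) : ℝ) : ℂ) := by
  rw [stdGaussian, integral_withDensity_eq_integral_toReal_smul (by fun_prop)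
    (ae_of_all _ fun _ => ENNReal.ofReal_lt_top)]
  refine integral_congr_ae (ae_of_all _ fun g => ?_)
  have h0 : 0 ≤ (Real.pi ^ Fintype.card V)⁻¹ * Real.exp (-∑ i, ‖g i‖ ^ 2) := by
    have := Real.pi_pos
    positivity
  simp only [ENNReal.toReal_ofReal h0, Complex.real_smul]
  rw [mul_comm, ← Complex.ofReal_prod, Finset.prod_mul_distrib, ← Real.exp_sum,
    Finset.sum_neg_distrib, Finset.prod_const, inv_pow, Finset.card_univ]

theorem integrable_stdGaussian_iff (f : (V → ℂ) → ℂ) :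
    Integrable f (stdGaussian V) ↔
      Integrable fun g : V → ℂ => f g * ∏ v, ((Real.pi⁻¹ * Real.exp (-‖g v‖ ^ 2) : ℝ) : ℂ) := by
  rw [stdGaussian, integrable_withDensity_iff_integrable_smul' (by fun_prop)
    (ae_of_all _ fun _ => ENNReal.ofReal_lt_top)]
  refine integrable_congr (ae_of_all _ fun g => ?_)
  have h0 : 0 ≤ (Real.pi ^ Fintype.card V)⁻¹ * Real.exp (-∑ i, ‖g i‖ ^ 2) := by
    have := Real.pi_pos
    positivity
  simp only [ENNReal.toReal_ofReal h0, Complex.real_smul]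
  rw [mul_comm, ← Complex.ofReal_prod, Finset.prod_mul_distrib, ← Real.exp_sum,
    Finset.sum_neg_distrib, Finset.prod_const, inv_pow, Finset.card_univ]

theorem integrable_prod_pow_mul_star_pow (a b : V → ℕ) :
    Integrable (fun g : V → ℂ => ∏ v, (g v ^ a v * star (g v) ^ b v)) (stdGaussian V) := by
  rw [integrable_stdGaussian_iff]
  have : Integrable fun g : V → ℂ => ∏ v, ((Real.pi⁻¹ : ℝ) : ℂ) *
      (g v ^ a v * star (g v) ^ b v * (Real.exp (-‖g v‖ ^ 2) : ℂ)) :=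
    Integrable.fintype_prod (f := fun v z => ((Real.pi⁻¹ : ℝ) : ℂ) *
      (z ^ a v * star z ^ b v * (Real.exp (-‖z‖ ^ 2) : ℂ)))
      fun v => (integrable_pow_mul_star_pow (a v) (b v)).const_mul _
  refine this.congr (ae_of_all _ fun g => ?_)
  simp only [← Finset.prod_mul_distrib]
  refine Finset.prod_congr rfl fun v _ => ?_
  push_cast; ring

theorem integral_prod_pow_mul_star_pow (a b : V → ℕ) :
    ∫ g, ∏ v, (g v ^ a v * star (g v) ^ b v) ∂stdGaussian V =
      ∏ v, if a v = b v then ((a v).factorial : ℂ) else 0 := by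
  rw [integral_stdGaussian]
  have h := integral_fintype_prod_volume_eq_prod (fun (v : V) (z : ℂ) => ((Real.pi⁻¹ : ℝ) : ℂ) *
      (z ^ a v * star z ^ b v * (Real.exp (-‖z‖ ^ 2) : ℂ)))
  simp only [integral_const_mul, integral_pow_mul_star_pow] at h
  have hpi : (Real.pi : ℂ) ≠ 0 := by exact_mod_cast Real.pi_ne_zero
  convert! h using 1
  · refine integral_congr_ae (ae_of_all _ fun g => ?_)
    simp only [← Finset.prod_mul_distrib]
    refine Finset.prod_congr rfl fun v _ => ?_
    push_cast; ring
  · refine Finset.prod_congr rfl fun v _ => ?_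
    split_ifs
    · push_cast; field_simp
    · simp

/-! ### Wick's formula -/

variable {V I : Type} [Fintype V] [Fintype I]

/-- If the fibres of `x` and `y` have equal sizes, these permutations form a translate of the
stabilizer of `x`; otherwise there are none. This converts the moments `∏ a_v!` of independent
Gaussians into the sum over pairings in Wick's formula. -/
theorem card_perm_comp_eq [DecidableEq V] [DecidableEq I] (x y : I → V) :
    (Fintype.card {π : Equiv.Perm I // x ∘ π = y}) =
      ∏ v, if Fintype.card {i // x i = v} = Fintype.card {i // y i = v}
        then (Fintype.card {i // x i = v}).factorial else 0 := by
  by_cases h : ∀ v, Fintype.card {i // x i = v} = Fintype.card {i // y i = v}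
  · simp only [h, if_true]
    simp only [← h]
    let e : Equiv.Perm I := Equiv.ofFiberEquiv (f := y) (g := x)
      fun c => Fintype.equivOfCardEq (h c).symm
    have he : x ∘ e = y := funext fun a => Equiv.ofFiberEquiv_map _ a
    rw [← DomMulAct.stabilizer_card]
    refine Fintype.card_congr ((Equiv.mulRight e⁻¹).subtypeEquiv fun π => ?_)
    simp only [Equiv.coe_mulRight]
    constructor
    · intro hp
      funext i
      have := congrFun (hp.trans he.symm) (e⁻¹ i)
      simpa using this
    · intro hp
      funext i
      have := congrFun hp (e i)
      rw [← he]
      simpa using this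
  · push Not at h
    obtain ⟨v, hv⟩ := h
    rw [Finset.prod_eq_zero (Finset.mem_univ v) (by simp [hv]), Fintype.card_eq_zero_iff]
    refine ⟨fun π => hv ?_⟩
    refine (Fintype.card_congr (π.1.subtypeEquiv fun i => ?_)).symm
    exact (congrFun π.2 i ▸ Iff.rfl)

theorem prod_coord_eq_prod_pow [DecidableEq V] (x : I → V) (g : V → ℂ) :
    ∏ i, g (x i) = ∏ v, g v ^ Fintype.card {i // x i = v} := by
  classical
  rw [← Finset.prod_fiberwise' Finset.univ x]
  refine Finset.prod_congr rfl fun v _ => ?_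
  rw [Finset.prod_const, Fintype.card_subtype]

theorem integrable_prod_coord (x y : I → V) :
    Integrable (fun g : V → ℂ => (∏ i, g (x i)) * ∏ i, star (g (y i))) (stdGaussian V) := by
  classical
  have := integrable_prod_pow_mul_star_pow (fun v => Fintype.card {i // x i = v})
    (fun v => Fintype.card {i // y i = v})
  refine this.congr (ae_of_all _ fun g => ?_)
  simp only
  rw [prod_coord_eq_prod_pow x, prod_coord_eq_prod_pow y (fun v => star (g v)),
    Finset.prod_mul_distrib]

theorem integral_prod_coord [DecidableEq V] [DecidableEq I] (x y : I → V) :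
    ∫ g, (∏ i, g (x i)) * ∏ i, star (g (y i)) ∂stdGaussian V =
      ∑ π : Equiv.Perm I, if x ∘ π = y then 1 else 0 := by
  have h := integral_prod_pow_mul_star_pow (fun v => Fintype.card {i // x i = v})
    (fun v => Fintype.card {i // y i = v})
  rw [Finset.sum_boole, ← Fintype.card_subtype, card_perm_comp_eq]
  push_cast
  rw [← h]
  refine integral_congr_ae (ae_of_all _ fun g => ?_)
  simp only
  rw [prod_coord_eq_prod_pow x, prod_coord_eq_prod_pow y (fun v => star (g v)),
    Finset.prod_mul_distrib]

theorem prod_mulVec_mul_prod_mulVec [DecidableEq I] (M N : Matrix I V ℂ) (g h : V → ℂ) :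
    (∏ i, (M *ᵥ g) i) * ∏ i, (N *ᵥ h) i =
      ∑ x : I → V, ∑ y : I → V, ((∏ i, M i (x i)) * ∏ i, N i (y i)) *
        ((∏ i, g (x i)) * ∏ i, h (y i)) := by
  simp only [Matrix.mulVec, dotProduct]
  rw [Finset.prod_univ_sum, Finset.prod_univ_sum, Fintype.piFinset_univ, Finset.sum_mul_sum]
  refine Finset.sum_congr rfl fun x _ => Finset.sum_congr rfl fun y _ => ?_
  simp only [Finset.prod_mul_distrib]
  ring

theorem integrable_prod_mulVec (M N : Matrix I V ℂ) :
    Integrable (fun g : V → ℂ => (∏ i, (M *ᵥ g) i) * ∏ i, (N *ᵥ star g) i) (stdGaussian V) := by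
  classical
  simp only [prod_mulVec_mul_prod_mulVec, Pi.star_apply]
  exact integrable_finsetSum _ fun x _ => integrable_finsetSum _ fun y _ =>
    (integrable_prod_coord x y).const_mul _

/-- **Wick's formula**. -/
theorem integral_prod_mulVec [DecidableEq I] (M N : Matrix I V ℂ) :
    ∫ g, (∏ i, (M *ᵥ g) i) * ∏ i, (N *ᵥ star g) i ∂stdGaussian V = (M * Nᵀ).permanent := by
  classical
  simp only [prod_mulVec_mul_prod_mulVec, Pi.star_apply]
  rw [integral_finsetSum _ fun x _ => integrable_finsetSum _ fun y _ =>
    (integrable_prod_coord x y).const_mul _]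
  simp_rw [fun x : I → V => integral_finsetSum (μ := stdGaussian V) Finset.univ fun y _ =>
    (integrable_prod_coord x y).const_mul ((∏ i, M i (x i)) * ∏ i, N i (y i)),
    integral_const_mul, integral_prod_coord]
  simp only [Matrix.permanent, Matrix.mul_apply,
    Matrix.transpose_apply, Finset.prod_univ_sum, Fintype.piFinset_univ]
  simp only [Finset.mul_sum, mul_ite, mul_one, mul_zero]
  rw [Finset.sum_comm, Finset.sum_congr rfl fun y _ => Finset.sum_comm, Finset.sum_comm]
  refine Finset.sum_congr rfl fun π _ => Finset.sum_congr rfl fun y _ => ?_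
  have : ∀ x : I → V, x ∘ π = y ↔ x = y ∘ π.symm := fun x => (Equiv.eq_comp_symm π x y).symm
  rw [Finset.sum_congr rfl fun x _ => if_congr (this x) rfl rfl, Finset.sum_ite_eq']
  simp only [Finset.mem_univ, if_true, Finset.prod_mul_distrib]
  congr 1
  rw [← Equiv.prod_comp π]
  simp

/-! ### The expected product of Gram determinants -/

variable {ι : Type} [Fintype ι] {k m : ℕ}

/-- The `k × m` matrix of the derivatives at the point `p`. -/
def block (a : ι × Fin k × Fin m → ℂ) (p : ι) : Matrix (Fin k) (Fin m) ℂ :=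
  Matrix.of fun j q => a (p, j, q)

/-- `∏_p det(a^p Γ_p (b^p)ᵀ)`. -/
noncomputable def gramProd (Γ : ι → Matrix (Fin m) (Fin m) ℂ) (a b : ι × Fin k × Fin m → ℂ) : ℂ :=
  ∏ p, (block a p * Γ p * (block b p)ᵀ).det

/-- The Gaussian expectation of `gramProd`, as a polynomial in the covariances `Λ`. -/
noncomputable def wick [DecidableEq ι] (Γ : ι → Matrix (Fin m) (Fin m) ℂ)
    (Λ : Matrix (ι × Fin k × Fin m) (ι × Fin k × Fin m) ℂ) : ℂ :=
  ∑ σ : ι → Equiv.Perm (Fin k), ∑ q : ι × Fin k → Fin m × Fin m,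
    ((∏ p, ((Equiv.Perm.sign (σ p) : ℤ) : ℂ)) * ∏ i, Γ i.1 (q i).1 (q i).2) *
      (Λ.submatrix (fun i : ι × Fin k => (i.1, σ i.1 i.2, (q i).1))
        (fun i : ι × Fin k => (i.1, i.2, (q i).2))).permanent

theorem gramProd_eq [DecidableEq ι] (Γ : ι → Matrix (Fin m) (Fin m) ℂ)
    (a b : ι × Fin k × Fin m → ℂ) :
    gramProd Γ a b = ∑ σ : ι → Equiv.Perm (Fin k), ∑ q : ι × Fin k → Fin m × Fin m,
      ((∏ p, ((Equiv.Perm.sign (σ p) : ℤ) : ℂ)) * ∏ i, Γ i.1 (q i).1 (q i).2) *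
      ((∏ i : ι × Fin k, a (i.1, σ i.1 i.2, (q i).1)) * ∏ i : ι × Fin k, b (i.1, i.2, (q i).2)) := by
  simp only [gramProd, Matrix.det_apply']
  rw [Finset.prod_univ_sum, Fintype.piFinset_univ]
  refine Finset.sum_congr rfl fun σ _ => ?_
  have : ∀ i : ι × Fin k, (block a i.1 * Γ i.1 * (block b i.1)ᵀ) (σ i.1 i.2) i.2 =
      ∑ q : Fin m × Fin m, a (i.1, σ i.1 i.2, q.1) * Γ i.1 q.1 q.2 * b (i.1, i.2, q.2) := by
    intro i
    simp only [Matrix.mul_apply, Fintype.sum_prod_type, block, Matrix.of_apply,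
      Matrix.transpose_apply, Finset.sum_mul]
    rw [Finset.sum_comm]
  rw [Finset.prod_mul_distrib,
    ← Fintype.prod_prod_type' (fun p j => (block a p * Γ p * (block b p)ᵀ) (σ p j) j),
    Finset.prod_congr rfl fun i _ => this i, Finset.prod_univ_sum, Fintype.piFinset_univ,
    Finset.mul_sum]
  refine Finset.sum_congr rfl fun q _ => ?_
  simp only [Finset.prod_mul_distrib]
  ring

theorem gramProd_mulVec_eq [DecidableEq ι] (Γ : ι → Matrix (Fin m) (Fin m) ℂ)
    (M N : Matrix (ι × Fin k × Fin m) V ℂ) (g h : V → ℂ) :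
    gramProd Γ (M *ᵥ g) (N *ᵥ h) =
      ∑ σ : ι → Equiv.Perm (Fin k), ∑ q : ι × Fin k → Fin m × Fin m,
      ((∏ p, ((Equiv.Perm.sign (σ p) : ℤ) : ℂ)) * ∏ i, Γ i.1 (q i).1 (q i).2) *
      ((∏ i, (M.submatrix (fun i : ι × Fin k => (i.1, σ i.1 i.2, (q i).1)) id *ᵥ g) i) *
        ∏ i, (N.submatrix (fun i : ι × Fin k => (i.1, i.2, (q i).2)) id *ᵥ h) i) :=
  gramProd_eq Γ _ _

theorem integral_gramProd [DecidableEq ι] (Γ : ι → Matrix (Fin m) (Fin m) ℂ)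
    (M N : Matrix (ι × Fin k × Fin m) V ℂ) :
    ∫ g, gramProd Γ (M *ᵥ g) (N *ᵥ star g) ∂stdGaussian V = wick Γ (M * Nᵀ) := by
  classical
  simp only [gramProd_mulVec_eq]
  rw [integral_finsetSum _ fun σ _ => integrable_finsetSum _ fun q _ =>
    (integrable_prod_mulVec _ _).const_mul _]
  refine Finset.sum_congr rfl fun σ _ => ?_
  rw [integral_finsetSum _ fun q _ => (integrable_prod_mulVec _ _).const_mul _]
  refine Finset.sum_congr rfl fun q _ => ?_
  rw [integral_const_mul, integral_prod_mulVec]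
  rfl

open scoped ComplexOrder

/-! ### Schur complements -/

section Schur

variable {α β : Type} [Fintype α] [DecidableEq α] [Fintype β] [DecidableEq β]

/-- The Schur complement of the upper left block. -/
noncomputable def schur (X : Matrix (α ⊕ β) (α ⊕ β) ℂ) : Matrix β β ℂ :=
  X.toBlocks₂₂ - X.toBlocks₂₁ * X.toBlocks₁₁⁻¹ * X.toBlocks₁₂

theorem det_eq_mul_det_schur (X : Matrix (α ⊕ β) (α ⊕ β) ℂ) (h : X.toBlocks₁₁.det ≠ 0) :
    X.det = X.toBlocks₁₁.det * (schur X).det := by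
  have := Matrix.invertibleOfIsUnitDet X.toBlocks₁₁ (isUnit_iff_ne_zero.2 h)
  conv_lhs => rw [← Matrix.fromBlocks_toBlocks X, Matrix.det_fromBlocks₁₁]
  rw [Matrix.invOf_eq_nonsing_inv]; rfl

/-- On jets with vanishing values the exponent of the Gaussian density sees only this block, so the
conditioned derivatives have the Schur complement as covariance. -/
theorem inv_toBlocks₂₂ (X : Matrix (α ⊕ β) (α ⊕ β) ℂ) (h : X.toBlocks₁₁.det ≠ 0)
    (hS : (schur X).det ≠ 0) : X⁻¹.toBlocks₂₂ = (schur X)⁻¹ := by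
  have i1 := Matrix.invertibleOfIsUnitDet X.toBlocks₁₁ (isUnit_iff_ne_zero.2 h)
  have i2 : Invertible (X.toBlocks₂₂ - X.toBlocks₂₁ * ⅟X.toBlocks₁₁ * X.toBlocks₁₂) := by
    rw [Matrix.invOf_eq_nonsing_inv]
    exact Matrix.invertibleOfIsUnitDet (schur X) (isUnit_iff_ne_zero.2 hS)
  have hX : X.det ≠ 0 := by rw [det_eq_mul_det_schur X h]; exact mul_ne_zero h hS
  have i3 : Invertible (Matrix.fromBlocks X.toBlocks₁₁ X.toBlocks₁₂ X.toBlocks₂₁ X.toBlocks₂₂) := by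
    rw [Matrix.fromBlocks_toBlocks]
    exact Matrix.invertibleOfIsUnitDet _ (isUnit_iff_ne_zero.2 hX)
  have := Matrix.invOf_fromBlocks₁₁_eq X.toBlocks₁₁ X.toBlocks₁₂ X.toBlocks₂₁ X.toBlocks₂₂
  simp only [Matrix.invOf_eq_nonsing_inv, Matrix.fromBlocks_toBlocks] at this
  rw [this, Matrix.toBlocks_fromBlocks₂₂]
  rfl

theorem det_toBlocks₁₁_gauge (D D' : Matrix α α ℂ) (L : Matrix β α ℂ) (L' : Matrix α β ℂ)
    (T T' : Matrix β β ℂ) (X : Matrix (α ⊕ β) (α ⊕ β) ℂ) :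
    (Matrix.fromBlocks D 0 L T * X * Matrix.fromBlocks D' L' 0 T').toBlocks₁₁ =
      D * X.toBlocks₁₁ * D' := by
  conv_lhs => rw [← Matrix.fromBlocks_toBlocks X]
  simp [Matrix.fromBlocks_multiply]

/-- Adding multiples of the values to the derivatives has no effect once the values are conditioned
to vanish; this is why `L` and `L'` drop out. -/
theorem schur_gauge (D D' : Matrix α α ℂ) (L : Matrix β α ℂ) (L' : Matrix α β ℂ)
    (T T' : Matrix β β ℂ) (X : Matrix (α ⊕ β) (α ⊕ β) ℂ) (h : X.toBlocks₁₁.det ≠ 0)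
    (hD : D.det ≠ 0) (hD' : D'.det ≠ 0) :
    schur (Matrix.fromBlocks D 0 L T * X * Matrix.fromBlocks D' L' 0 T') = T * schur X * T' := by
  rw [schur, det_toBlocks₁₁_gauge, Matrix.mul_inv_rev, Matrix.mul_inv_rev, schur]
  conv_lhs => rw [← Matrix.fromBlocks_toBlocks X]
  simp only [Matrix.fromBlocks_multiply, Matrix.toBlocks_fromBlocks₂₂,
    Matrix.toBlocks_fromBlocks₁₂, Matrix.toBlocks_fromBlocks₂₁, Matrix.toBlocks_fromBlocks₁₁,
    Matrix.zero_mul, Matrix.mul_zero, add_zero]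
  set A := X.toBlocks₁₁
  have hA : IsUnit A.det := isUnit_iff_ne_zero.2 h
  have e1 : (L * A + T * X.toBlocks₂₁) * D' * (D'⁻¹ * (A⁻¹ * D⁻¹)) =
      (L + T * X.toBlocks₂₁ * A⁻¹) * D⁻¹ := by
    rw [Matrix.mul_assoc _ D', ← Matrix.mul_assoc D', Matrix.mul_nonsing_inv _
      (isUnit_iff_ne_zero.2 hD'), Matrix.one_mul, ← Matrix.mul_assoc, Matrix.add_mul,
      Matrix.mul_assoc L, Matrix.mul_nonsing_inv _ hA, Matrix.mul_one]
  have e2 : D⁻¹ * (D * A * L' + D * X.toBlocks₁₂ * T') = A * L' + X.toBlocks₁₂ * T' := by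
    rw [Matrix.mul_assoc, Matrix.mul_assoc, ← Matrix.mul_add, ← Matrix.mul_assoc,
      Matrix.nonsing_inv_mul _ (isUnit_iff_ne_zero.2 hD), Matrix.one_mul]
  rw [e1, Matrix.mul_assoc _ D⁻¹, e2]
  have e3 : X.toBlocks₂₁ * A⁻¹ * (A * L') = X.toBlocks₂₁ * L' := by
    rw [Matrix.mul_assoc, ← Matrix.mul_assoc A⁻¹, Matrix.nonsing_inv_mul _ hA, Matrix.one_mul]
  simp only [Matrix.add_mul, Matrix.mul_add, Matrix.mul_sub, Matrix.sub_mul, Matrix.mul_assoc] at e3 ⊢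
  rw [e3]
  abel

theorem PosDef_toBlocks₁₁ {X : Matrix (α ⊕ β) (α ⊕ β) ℂ} (h : X.PosDef) : X.toBlocks₁₁.PosDef :=
  h.submatrix Sum.inl_injective

theorem PosDef_toBlocks₂₂ {X : Matrix (α ⊕ β) (α ⊕ β) ℂ} (h : X.PosDef) : X.toBlocks₂₂.PosDef :=
  h.submatrix Sum.inr_injective

/-- Its inverse is a principal block of the positive definite matrix `X⁻¹`. -/
theorem PosDef_schur {X : Matrix (α ⊕ β) (α ⊕ β) ℂ} (h : X.PosDef) : (schur X).PosDef := by
  have h1 := (PosDef_toBlocks₁₁ h).det_pos.ne'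
  have h2 : (schur X).det ≠ 0 := by
    have := h.det_pos.ne'
    rw [det_eq_mul_det_schur X h1] at this
    exact right_ne_zero_of_mul this
  have h3 := PosDef_toBlocks₂₂ h.inv
  rw [inv_toBlocks₂₂ X h1 h2] at h3
  have := h3.inv
  rwa [Matrix.nonsing_inv_nonsing_inv _ (isUnit_iff_ne_zero.2 h2)] at this

end Schur

/-! ### The correlation form -/

section CorrForm

variable {ι : Type} [Fintype ι] [DecidableEq ι] {k m : ℕ}

/-- The correlation function of Gaussian zeros whose 1-jets have covariance matrix `X`,
up to a power of `π`. -/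
noncomputable def corrForm (Γ : ι → Matrix (Fin m) (Fin m) ℂ)
    (X : Matrix (JetIdx ι k m) (JetIdx ι k m) ℂ) : ℂ :=
  X.toBlocks₁₁.det⁻¹ * wick Γ (schur X)

theorem wick_diagonal_mul_mul_diagonal (Γ : ι → Matrix (Fin m) (Fin m) ℂ) (t t' : ι → ℂ)
    (Λ : Matrix (ι × Fin k × Fin m) (ι × Fin k × Fin m) ℂ) :
    wick Γ (Matrix.diagonal (fun i => t i.1) * Λ * Matrix.diagonal (fun i => t' i.1)) =
      (∏ p, (t p * t' p)) ^ k * wick Γ Λ := by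
  simp only [wick, Finset.mul_sum]
  refine Finset.sum_congr rfl fun σ _ => Finset.sum_congr rfl fun q _ => ?_
  rw [mul_left_comm]
  congr 1
  simp only [Matrix.permanent, Finset.mul_sum, Matrix.submatrix_apply, Matrix.mul_diagonal,
    Matrix.diagonal_mul, Finset.prod_mul_distrib]
  refine Finset.sum_congr rfl fun π _ => ?_
  rw [Equiv.prod_comp π (fun i : ι × Fin k => t i.1)]
  simp only [Fintype.prod_prod_type, Finset.prod_const, Finset.card_univ, Fintype.card_fin,
    Finset.prod_pow]
  ring

/-- Each monomial of `wick` contains every point `k` times on either side, and so does each monomial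
of the determinant. The identity is used three times: to rescale derivatives by `N^(-1/2)`, to pass
to the normalised kernel, and to obtain torus invariance. The left and right factors are independent
of each other because the torus acts by `t` and `t⁻¹`. -/
theorem corrForm_gauge (Γ : ι → Matrix (Fin m) (Fin m) ℂ) (d d' t t' : ι → ℂ)
    (L : Matrix (ι × Fin k × Fin m) (ι × Fin k) ℂ) (L' : Matrix (ι × Fin k) (ι × Fin k × Fin m) ℂ)
    (hd : ∀ p, d p ≠ 0) (hd' : ∀ p, d' p ≠ 0)
    (X : Matrix (JetIdx ι k m) (JetIdx ι k m) ℂ) (h : X.toBlocks₁₁.det ≠ 0) :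
    corrForm Γ (Matrix.fromBlocks (Matrix.diagonal fun i => d i.1) 0 L
        (Matrix.diagonal fun i => t i.1) * X *
      Matrix.fromBlocks (Matrix.diagonal fun i => d' i.1) L' 0
        (Matrix.diagonal fun i => t' i.1)) =
      ((∏ p, (t p * t' p)) / ∏ p, (d p * d' p)) ^ k * corrForm Γ X := by
  rw [corrForm, det_toBlocks₁₁_gauge, schur_gauge _ _ _ _ _ _ _ h, wick_diagonal_mul_mul_diagonal]
  · rw [Matrix.det_mul, Matrix.det_mul, Matrix.det_diagonal, Matrix.det_diagonal, corrForm]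
    simp only [Fintype.prod_prod_type, Finset.prod_const, Finset.card_univ, Fintype.card_fin,
      Finset.prod_pow, Finset.prod_mul_distrib, div_pow, mul_pow, div_eq_mul_inv, mul_inv]
    ring
  · rw [Matrix.det_diagonal]; exact Finset.prod_ne_zero_iff.2 fun i _ => hd _
  · rw [Matrix.det_diagonal]; exact Finset.prod_ne_zero_iff.2 fun i _ => hd' _

theorem continuous_wick : Continuous fun x : (ι → Matrix (Fin m) (Fin m) ℂ) ×
    Matrix (ι × Fin k × Fin m) (ι × Fin k × Fin m) ℂ => wick x.1 x.2 := by
  unfold wick Matrix.permanent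
  simp only [Matrix.submatrix_apply]
  fun_prop

theorem continuousAt_corrForm (Γ : ι → Matrix (Fin m) (Fin m) ℂ)
    (X : Matrix (JetIdx ι k m) (JetIdx ι k m) ℂ) (h : X.toBlocks₁₁.det ≠ 0) :
    ContinuousAt (fun x : (ι → Matrix (Fin m) (Fin m) ℂ) ×
      Matrix (JetIdx ι k m) (JetIdx ι k m) ℂ => corrForm x.1 x.2) (Γ, X) := by
  have hA : Continuous fun x : (ι → Matrix (Fin m) (Fin m) ℂ) ×
      Matrix (JetIdx ι k m) (JetIdx ι k m) ℂ => x.2.toBlocks₁₁ := by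
    unfold Matrix.toBlocks₁₁; fun_prop
  have hd : ContinuousAt (fun x : (ι → Matrix (Fin m) (Fin m) ℂ) ×
      Matrix (JetIdx ι k m) (JetIdx ι k m) ℂ => (x.2.toBlocks₁₁.det)⁻¹) (Γ, X) :=
    (hA.matrix_det.continuousAt).inv₀ h
  refine hd.mul ?_
  have hs : ContinuousAt (fun x : (ι → Matrix (Fin m) (Fin m) ℂ) ×
      Matrix (JetIdx ι k m) (JetIdx ι k m) ℂ => (x.1, schur x.2)) (Γ, X) := by
    refine continuousAt_fst.prodMk ?_
    simp only [schur, Matrix.inv_def, Ring.inverse_eq_inv', Matrix.mul_smul, Matrix.smul_mul]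
    refine ContinuousAt.sub ?_ (hd.smul ?_)
    · unfold Matrix.toBlocks₂₂; fun_prop
    · have := hA.matrix_adjugate
      have h1 : Continuous fun x : (ι → Matrix (Fin m) (Fin m) ℂ) ×
        Matrix (JetIdx ι k m) (JetIdx ι k m) ℂ => x.2.toBlocks₂₁ := by
        unfold Matrix.toBlocks₂₁; fun_prop
      have h2 : Continuous fun x : (ι → Matrix (Fin m) (Fin m) ℂ) ×
        Matrix (JetIdx ι k m) (JetIdx ι k m) ℂ => x.2.toBlocks₁₂ := by
        unfold Matrix.toBlocks₁₂; fun_prop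
      exact ((h1.matrix_mul this).matrix_mul h2).continuousAt
  exact ContinuousAt.comp (f := fun x : (ι → Matrix (Fin m) (Fin m) ℂ) ×
      Matrix (JetIdx ι k m) (JetIdx ι k m) ℂ => (x.1, schur x.2))
      (continuous_wick.continuousAt) hs

end CorrForm

/-! ### Gaussian integrals conditioned on vanishing values -/

section

variable {α β : Type} [Fintype α] [DecidableEq α] [Fintype β] [DecidableEq β]

/-- The real Jacobian of a complex linear map is `|det|²`. -/
theorem integral_comp_mulVec (M : Matrix β β ℂ) (hM : M.det ≠ 0) (f : (β → ℂ) → ℂ) :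
    ∫ a, f a = (‖M.det‖ ^ 2 : ℝ) * ∫ g, f (M *ᵥ g) := by
  set L : (β → ℂ) →ₗ[ℝ] (β → ℂ) := (Matrix.toLin' M).restrictScalars ℝ with hL
  have hdet : LinearMap.det L = ‖M.det‖ ^ 2 := by
    rw [hL, LinearMap.det_restrictScalars, LinearMap.det_toLin', Algebra.norm_complex_apply,
      Complex.normSq_eq_norm_sq]
  have h0 : LinearMap.det L ≠ 0 := by
    rw [hdet]; exact pow_ne_zero _ (norm_ne_zero_iff.2 hM)
  have hmap := Measure.map_linearMap_addHaar_eq_smul_addHaar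
    (volume : Measure (β → ℂ)) h0
  have he : MeasurableEmbedding L :=
    (LinearEquiv.ofIsUnitDet (f := L) (v := Module.finBasis ℝ _) (v' := Module.finBasis ℝ _)
      (by rw [LinearMap.det_toMatrix]; exact isUnit_iff_ne_zero.2 h0)).toContinuousLinearEquiv.toHomeomorph.measurableEmbedding
  have h1 := he.integral_map (μ := volume) f
  rw [hmap, integral_smul_measure, ENNReal.toReal_ofReal (abs_nonneg _), hdet,
    abs_of_nonneg (by positivity)] at h1
  have h2 : (∫ g, f (M *ᵥ g)) = ∫ g, f (L g) := rfl
  have h3 : (‖M.det‖ ^ 2 : ℝ) ≠ 0 := pow_ne_zero _ (norm_ne_zero_iff.2 hM)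
  rw [h2, ← h1, Complex.real_smul, ← mul_assoc, ← Complex.ofReal_mul, mul_inv_cancel₀ h3]
  simp

open scoped MatrixOrder Matrix.Norms.L2Operator in
theorem exists_eq_mul_conjTranspose {Λ : Matrix β β ℂ} (h : Λ.PosSemidef) :
    ∃ M : Matrix β β ℂ, Λ = M * Mᴴ := by
  obtain ⟨B, hB⟩ := CStarAlgebra.nonneg_iff_eq_star_mul_self.mp h.nonneg
  exact ⟨Bᴴ, by rw [hB, Matrix.conjTranspose_conjTranspose]; rfl⟩

/-- Substitute `a = M g`. The exponent becomes `-|g|²`, and the Jacobian `|det M|²` cancels the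
Schur factor of `det Δ`, leaving the determinant of the value block. -/
theorem integral_gaussianDensity_mul {Δ : Matrix (α ⊕ β) (α ⊕ β) ℂ} (hΔ : Δ.PosDef)
    (M : Matrix β β ℂ) (hM : schur Δ = M * Mᴴ) (F : (β → ℂ) → ℂ) :
    ∫ a : β → ℂ, (gaussianDensity Δ (Sum.elim 0 a) : ℂ) * F a =
      ((Real.pi : ℂ) ^ Fintype.card α * Δ.toBlocks₁₁.det)⁻¹ *
        ∫ g, F (M *ᵥ g) ∂stdGaussian β := by
  have hA := (PosDef_toBlocks₁₁ hΔ).det_pos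
  have hS := (PosDef_schur hΔ).det_pos
  have hdS : (schur Δ).det = ((‖M.det‖ ^ 2 : ℝ) : ℂ) := by
    rw [hM, Matrix.det_mul, Matrix.det_conjTranspose, ← Complex.normSq_eq_norm_sq,
      Complex.normSq_eq_conj_mul_self, mul_comm]; rfl
  have hMd : M.det ≠ 0 := by
    intro h0
    rw [hM, Matrix.det_mul, h0, zero_mul] at hS
    exact lt_irrefl _ hS
  rw [integral_comp_mulVec M hMd, integral_stdGaussian, ← integral_const_mul, ← integral_const_mul]
  refine integral_congr_ae (ae_of_all _ fun g => ?_)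
  have hq : star (Sum.elim (0 : α → ℂ) (M *ᵥ g)) ⬝ᵥ (Δ⁻¹ *ᵥ Sum.elim (0 : α → ℂ) (M *ᵥ g)) =
      ((∑ v, ‖g v‖ ^ 2 : ℝ) : ℂ) := by
    have e1 : star (Sum.elim (0 : α → ℂ) (M *ᵥ g)) = Sum.elim (0 : α → ℂ) (star (M *ᵥ g)) := by
      ext (i | i) <;> simp
    have e2 : Δ⁻¹ *ᵥ Sum.elim (0 : α → ℂ) (M *ᵥ g) = Sum.elim (Δ⁻¹.toBlocks₁₂ *ᵥ (M *ᵥ g))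
        (Δ⁻¹.toBlocks₂₂ *ᵥ (M *ᵥ g)) := by
      conv_lhs => rw [← Matrix.fromBlocks_toBlocks Δ⁻¹, Matrix.fromBlocks_mulVec]
      simp
    rw [e1, e2, sumElim_dotProduct_sumElim, zero_dotProduct, zero_add,
      inv_toBlocks₂₂ Δ hA.ne' hS.ne', hM, Matrix.mul_inv_rev, Matrix.mulVec_mulVec,
      Matrix.mul_assoc, Matrix.nonsing_inv_mul _ (isUnit_iff_ne_zero.2 hMd), Matrix.mul_one,
      Matrix.star_mulVec, Matrix.dotProduct_mulVec, Matrix.vecMul_vecMul,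
      Matrix.mul_nonsing_inv _ (by
        rw [Matrix.det_conjTranspose]; exact (isUnit_iff_ne_zero.2 hMd).star), Matrix.vecMul_one]
    simp only [dotProduct, Pi.star_apply, Complex.ofReal_sum]
    refine Finset.sum_congr rfl fun v _ => ?_
    rw [Complex.ofReal_pow, ← Complex.conj_mul']; rfl
  have hdet : Δ.det.re = Δ.toBlocks₁₁.det.re * ‖M.det‖ ^ 2 := by
    rw [det_eq_mul_det_schur Δ hA.ne', hdS, Complex.re_mul_ofReal]
  have hAre : Δ.toBlocks₁₁.det = (Δ.toBlocks₁₁.det.re : ℂ) :=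
    (Complex.conj_eq_iff_re.1 (by
      have := (PosDef_toBlocks₁₁ hΔ).isHermitian.eq
      have h2 := congrArg Matrix.det this
      rwa [Matrix.det_conjTranspose] at h2)).symm
  simp only [gaussianDensity]
  rw [hq, Complex.ofReal_re, hdet, hAre]
  have hA0 : (Δ.toBlocks₁₁.det.re : ℂ) ≠ 0 := by rw [← hAre]; exact hA.ne'
  have hpi : (Real.pi : ℂ) ≠ 0 := by exact_mod_cast Real.pi_ne_zero
  have hM' : (‖M.det‖ : ℂ) ≠ 0 := by
    rw [Complex.ofReal_ne_zero]; exact norm_ne_zero_iff.2 hMd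
  rw [← Complex.ofReal_prod, Finset.prod_mul_distrib, ← Real.exp_sum,
    Finset.sum_neg_distrib, Finset.prod_const, inv_pow, Finset.card_univ, Fintype.card_sum]
  simp only [Complex.ofReal_re]
  push_cast
  field_simp
  ring

end

/-! ### The zero correlation function as a correlation form -/

section

variable {ι : Type} [Fintype ι] [DecidableEq ι] {k m : ℕ}

theorem fubiniStudy_isHermitian (z : Cn m) : (fubiniStudy z).IsHermitian := by
  ext q q'
  simp only [Matrix.conjTranspose_apply, fubiniStudy, Matrix.of_apply, star_div₀, star_sub,
    star_mul', star_star, star_pow]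
  congr 1
  · congr 1
    · by_cases h : q = q'
      · simp [h]
      · simp [h, Ne.symm h]
    · ring
  · simp

/-- The transposed inverse of the Fubini–Study metric. -/
noncomputable def invMetric (z : Cn m) : Matrix (Fin m) (Fin m) ℂ := ((fubiniStudy z)⁻¹)ᵀ

theorem prod_jacobian (z : ι → Cn m) (a : ι × Fin k × Fin m → ℂ) :
    ((∏ p : ι, jacobian (z p) (Matrix.of fun j q => a (p, j, q)) : ℝ) : ℂ) =
      gramProd (fun p => invMetric (z p)) a (star a) := by
  rw [Complex.ofReal_prod, gramProd]
  refine Finset.prod_congr rfl fun p _ => ?_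
  have hb : (block (star a) p)ᵀ = (block a p)ᴴ := rfl
  rw [hb, jacobian]
  have hh : (block a p * invMetric (z p) * (block a p)ᴴ).IsHermitian :=
    Matrix.isHermitian_mul_mul_conjTranspose _ (fubiniStudy_isHermitian (z p)).inv.transpose
  refine Complex.conj_eq_iff_re.1 ?_
  have h2 := congrArg Matrix.det hh.eq
  rwa [Matrix.det_conjTranspose] at h2

theorem zeroCorr_eq (N : ℕ) (z : ι → Cn m) (h : (jetCov k m N z).PosDef) :
    (zeroCorr k m N z : ℂ) = ((Real.pi : ℂ) ^ (Fintype.card ι * k))⁻¹ *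
      corrForm (fun p => invMetric (z p)) (jetCov k m N z) := by
  obtain ⟨M, hM⟩ := exists_eq_mul_conjTranspose (PosDef_schur h).posSemidef
  rw [zeroCorr, ← integral_complex_ofReal]
  simp only [Complex.ofReal_mul, prod_jacobian]
  rw [integral_gaussianDensity_mul h M hM]
  have : ∀ g : ι × Fin k × Fin m → ℂ, star (M *ᵥ g) = (M.map star) *ᵥ star g := by
    intro g
    ext i
    simp [Matrix.mulVec, dotProduct, mul_comm]
  simp only [this]
  rw [integral_gramProd, corrForm, hM]
  have e : (M.map star)ᵀ = Mᴴ := rfl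
  rw [e, Fintype.card_prod, Fintype.card_fin, mul_inv]
  ring

end

/-! ### The covariance matrix of the 1-jets -/

theorem integral_sum_mul_star_sum {V : Type} [Fintype V] (A B : V → ℂ) :
    ∫ c, (∑ x, A x * c x) * star (∑ x, B x * c x) ∂stdGaussian V = ∑ x, A x * star (B x) := by
  have h := integral_prod_mulVec (I := Unit) (Matrix.of fun _ x => A x)
    (Matrix.of fun _ x => star (B x))
  simp only [Matrix.mulVec, dotProduct, Matrix.permanent_unique, Finset.univ_unique,
    Finset.prod_singleton, Matrix.of_apply, Matrix.mul_apply, Matrix.transpose_apply,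
    Pi.star_apply] at h
  rw [← h]
  simp only [star_sum, star_mul']

variable {m : ℕ}

/-- The Hermitian product `∑_q z_q conj w_q`. -/
noncomputable def herm (z w : Cn m) : ℂ := ∑ q, z q * star (w q)

theorem star_herm (z w : Cn m) : star (herm z w) = herm w z := by
  simp [herm, star_sum, mul_comm]

/-- `herm · w` as a continuous linear map. -/
noncomputable def hermL (w : Cn m) : Cn m →L[ℂ] ℂ := ∑ q, star (w q) • EuclideanSpace.proj q

theorem hermL_apply (w z : Cn m) : hermL w z = herm z w := by
  simp [hermL, herm, sum_apply, mul_comm]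

theorem hermL_single (w : Cn m) (q : Fin m) :
    hermL w (EuclideanSpace.single q 1) = star (w q) := by
  rw [hermL_apply, herm, Finset.sum_eq_single q] <;> simp +contextual

theorem hasFDerivAt_herm (z w : Cn m) : HasFDerivAt (fun z => herm z w) (hermL w) z := by
  simp only [← hermL_apply]
  exact (hermL w).hasFDerivAt

theorem dz_pow_herm (N : ℕ) (z w : Cn m) (q : Fin m) :
    dz (fun z => (1 + herm z w) ^ N) q z = N * (1 + herm z w) ^ (N - 1) * star (w q) := by
  have h := ((hasFDerivAt_herm z w).const_add 1).pow N
  rw [dz, h.fderiv]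
  simp only [smul_apply, hermL_single, smul_eq_mul]
  simp

theorem dz_coord_mul_pow_herm (N : ℕ) (z w : Cn m) (q q' : Fin m) :
    dz (fun z => N * z q' * (1 + herm z w) ^ (N - 1)) q z =
      N * (N - 1 : ℕ) * z q' * star (w q) * (1 + herm z w) ^ (N - 1 - 1) +
        (if q = q' then N * (1 + herm z w) ^ (N - 1) else 0) := by
  have h := ((hasFDerivAt_herm z w).const_add 1).pow (N - 1)
  have h2 : HasFDerivAt (fun z : Cn m => z q') (EuclideanSpace.proj q' : Cn m →L[ℂ] ℂ) z :=
    (EuclideanSpace.proj q' : Cn m →L[ℂ] ℂ).hasFDerivAt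
  have h3 := (h2.const_mul (N : ℂ)).fun_mul h
  rw [dz, h3.fderiv]
  simp only [add_apply, smul_apply, hermL_single, smul_eq_mul,
    PiLp.proj_apply, PiLp.single_apply]
  by_cases hq : q = q'
  · subst hq; simp; ring
  · simp [hq, Ne.symm hq]; ring

/-- The `J`-th basis polynomial of the ensemble. -/
noncomputable def suMon (m N : ℕ) (J : Expo m N) (z : Cn m) : ℂ :=
  (Real.sqrt (Nat.multinomial Finset.univ (fun i => (J.1 i : ℕ)) : ℝ) : ℂ) *
      ∏ q : Fin m, z q ^ (J.1 q.succ : ℕ)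

theorem suPoly_eq (N : ℕ) (c : Expo m N → ℂ) : suPoly m N c = fun z => ∑ J, c J * suMon m N J z := by
  ext z
  simp only [suPoly, suMon, mul_assoc]

theorem differentiable_suMon (N : ℕ) (J : Expo m N) : Differentiable ℂ (suMon m N J) := by
  unfold suMon
  fun_prop

theorem dz_suPoly (N : ℕ) (c : Expo m N → ℂ) (q : Fin m) (z : Cn m) :
    dz (suPoly m N c) q z = ∑ J, c J * dz (suMon m N J) q z := by
  rw [suPoly_eq, dz, fderiv_fun_sum fun J _ => ((differentiable_suMon N J) z).const_mul _]
  rw [sum_apply]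
  refine Finset.sum_congr rfl fun J _ => ?_
  rw [fderiv_const_mul ((differentiable_suMon N J) z)]
  rfl

theorem sum_multinomial_mul_prod (N : ℕ) (x : Fin m → ℂ) :
    ∑ J : Expo m N, (Nat.multinomial Finset.univ (fun i => (J.1 i : ℕ)) : ℂ) *
      ∏ q : Fin m, x q ^ (J.1 q.succ : ℕ) = (1 + ∑ q, x q) ^ N := by
  have h := Finset.sum_pow_eq_sum_piAntidiag (Finset.univ : Finset (Fin (m + 1)))
    (Fin.cons 1 x : Fin (m + 1) → ℂ) N
  rw [Fin.sum_univ_succ] at h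
  simp only [Fin.cons_zero, Fin.cons_succ] at h
  rw [h]
  refine Finset.sum_bij' (i := fun J _ => fun i => (J.1 i : ℕ))
    (j := fun f hf => ⟨fun i => ⟨f i, by
      have := (Finset.mem_piAntidiag.1 hf).1
      have h2 := Finset.single_le_sum (f := f) (fun _ _ => Nat.zero_le _) (Finset.mem_univ i)
      exact Nat.lt_succ_of_le (h2.trans this.le)⟩, by simpa using (Finset.mem_piAntidiag.1 hf).1⟩) ?_ ?_ ?_ ?_ ?_
  · intro J _; simp [Finset.mem_piAntidiag, J.2]
  · intro f hf; exact Finset.mem_univ _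
  · intro J _; rfl
  · intro f hf; rfl
  · intro J _
    simp [Fin.prod_univ_succ]

theorem sum_suMon_mul_star (N : ℕ) (z w : Cn m) :
    ∑ J, suMon m N J z * star (suMon m N J w) = (1 + herm z w) ^ N := by
  rw [herm, ← sum_multinomial_mul_prod]
  refine Finset.sum_congr rfl fun J _ => ?_
  have h : ((Real.sqrt (Nat.multinomial Finset.univ (fun i => (J.1 i : ℕ)) : ℝ) : ℝ) : ℂ) *
      ((Real.sqrt (Nat.multinomial Finset.univ (fun i => (J.1 i : ℕ)) : ℝ) : ℝ) : ℂ) =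
      (Nat.multinomial Finset.univ (fun i => (J.1 i : ℕ)) : ℂ) := by
    rw [← Complex.ofReal_mul, Real.mul_self_sqrt (Nat.cast_nonneg _)]; simp
  simp only [suMon, star_mul', star_prod, star_pow, mul_pow, Finset.prod_mul_distrib, ← h]
  have : ∀ x : ℝ, star (x : ℂ) = x := fun x => Complex.conj_ofReal x
  rw [this]
  ring

/-- For fixed `w` the kernel is itself a polynomial of the ensemble, with coefficients `conj (suMon
w)`, so its derivative can be read off from the closed form `(1 + ⟨z,w⟩)^N`. -/
theorem sum_dz_suMon_mul_star (N : ℕ) (z w : Cn m) (q : Fin m) :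
    ∑ J, dz (suMon m N J) q z * star (suMon m N J w) =
      N * (1 + herm z w) ^ (N - 1) * star (w q) := by
  rw [← dz_pow_herm]
  have h := dz_suPoly N (fun J => star (suMon m N J w)) q z
  have h2 : suPoly m N (fun J => star (suMon m N J w)) = fun z => (1 + herm z w) ^ N := by
    rw [suPoly_eq]; funext z; rw [← sum_suMon_mul_star]; simp only [mul_comm]
  rw [h2] at h
  rw [h]; simp only [mul_comm]

theorem sum_suMon_mul_star_dz (N : ℕ) (z w : Cn m) (q : Fin m) :
    ∑ J, suMon m N J z * star (dz (suMon m N J) q w) =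
      N * z q * (1 + herm z w) ^ (N - 1) := by
  have h := congrArg star (sum_dz_suMon_mul_star N w z q)
  simp only [star_sum, star_mul', star_star, star_pow, star_add, star_one, star_herm,
    star_natCast] at h
  rw [Finset.sum_congr rfl fun J _ => mul_comm _ _, h]
  ring

theorem sum_dz_suMon_mul_star_dz (N : ℕ) (z w : Cn m) (q q' : Fin m) :
    ∑ J, dz (suMon m N J) q z * star (dz (suMon m N J) q' w) =
      N * (N - 1 : ℕ) * z q' * star (w q) * (1 + herm z w) ^ (N - 1 - 1) +
        (if q = q' then N * (1 + herm z w) ^ (N - 1) else 0) := by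
  rw [← dz_coord_mul_pow_herm]
  have h := dz_suPoly N (fun J => star (dz (suMon m N J) q' w)) q z
  have h2 : suPoly m N (fun J => star (dz (suMon m N J) q' w)) =
      fun z => N * z q' * (1 + herm z w) ^ (N - 1) := by
    rw [suPoly_eq]; funext z; rw [← sum_suMon_mul_star_dz]; simp only [mul_comm]
  rw [h2] at h
  rw [h]; simp only [mul_comm]

section

variable {ι : Type} (k N : ℕ) (z : ι → Cn m)

/-- The matrix of the linear map sending coefficients to 1-jets. -/
noncomputable def jetMat : Matrix (JetIdx ι k m) (Fin k × Expo m N) ℂ := Matrix.of fun u x =>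
  Sum.elim (fun u : ι × Fin k => if u.2 = x.1 then suMon m N x.2 (z u.1) else 0)
    (fun u : ι × Fin k × Fin m => if u.2.1 = x.1 then dz (suMon m N x.2) u.2.2 (z u.1) else 0) u

theorem jet_eq (c : Fin k × Expo m N → ℂ) (u : JetIdx ι k m) :
    jet k m N z c u = ∑ x, jetMat k N z u x * c x := by
  rcases u with u | u
  · simp [jet, jetMat, suPoly_eq, Fintype.sum_prod_type, mul_comm]
  · simp [jet, jetMat, dz_suPoly, Fintype.sum_prod_type, mul_comm]

theorem jetCov_eq [Fintype ι] : jetCov k m N z = jetMat k N z * (jetMat k N z)ᴴ := by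
  ext u w
  simp only [jetCov, Matrix.of_apply, jet_eq, integral_sum_mul_star_sum, Matrix.mul_apply,
    Matrix.conjTranspose_apply]

theorem jetCov_inl_inl [Fintype ι] (p p' : ι) (j j' : Fin k) :
    jetCov k m N z (Sum.inl (p, j)) (Sum.inl (p', j')) =
      if j = j' then (1 + herm (z p) (z p')) ^ N else 0 := by
  rw [jetCov_eq, ← sum_suMon_mul_star]
  simp [Matrix.mul_apply, jetMat, Fintype.sum_prod_type, apply_ite star]

theorem jetCov_inr_inl [Fintype ι] (p p' : ι) (j j' : Fin k) (q : Fin m) :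
    jetCov k m N z (Sum.inr (p, j, q)) (Sum.inl (p', j')) =
      if j = j' then N * (1 + herm (z p) (z p')) ^ (N - 1) * star (z p' q) else 0 := by
  rw [jetCov_eq, ← sum_dz_suMon_mul_star]
  simp [Matrix.mul_apply, jetMat, Fintype.sum_prod_type, apply_ite star]

theorem jetCov_inl_inr [Fintype ι] (p p' : ι) (j j' : Fin k) (q : Fin m) :
    jetCov k m N z (Sum.inl (p, j)) (Sum.inr (p', j', q)) =
      if j = j' then N * z p q * (1 + herm (z p) (z p')) ^ (N - 1) else 0 := by
  rw [jetCov_eq, ← sum_suMon_mul_star_dz]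
  simp [Matrix.mul_apply, jetMat, Fintype.sum_prod_type, apply_ite star]

theorem jetCov_inr_inr [Fintype ι] (p p' : ι) (j j' : Fin k) (q q' : Fin m) :
    jetCov k m N z (Sum.inr (p, j, q)) (Sum.inr (p', j', q')) =
      if j = j' then N * (N - 1 : ℕ) * z p q' * star (z p' q) *
        (1 + herm (z p) (z p')) ^ (N - 1 - 1) +
        (if q = q' then N * (1 + herm (z p) (z p')) ^ (N - 1) else 0) else 0 := by
  rw [jetCov_eq, ← sum_dz_suMon_mul_star_dz]
  simp [Matrix.mul_apply, jetMat, Fintype.sum_prod_type, apply_ite star]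

end

/-! ### The scaling limit -/

section

variable {ι : Type} {m : ℕ}

/-- The covariance matrix of the 1-jets of the Bargmann–Fock ensemble. -/
noncomputable def limCov (k : ℕ) (z : ι → Cn m) : Matrix (JetIdx ι k m) (JetIdx ι k m) ℂ :=
  Matrix.fromBlocks
    (Matrix.of fun u w => if u.2 = w.2 then Complex.exp (herm (z u.1) (z w.1)) else 0)
    (Matrix.of fun u w => if u.2 = w.2.1 then
      z u.1 w.2.2 * Complex.exp (herm (z u.1) (z w.1)) else 0)
    (Matrix.of fun u w => if u.2.1 = w.2 then
      Complex.exp (herm (z u.1) (z w.1)) * star (z w.1 u.2.2) else 0)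
    (Matrix.of fun u w => if u.2.1 = w.2.1 then
      z u.1 w.2.2 * star (z w.1 u.2.2) * Complex.exp (herm (z u.1) (z w.1)) +
        (if u.2.2 = w.2.2 then Complex.exp (herm (z u.1) (z w.1)) else 0) else 0)

theorem tendsto_one_add_div_pow_sub (x : ℂ) (r : ℕ) :
    Tendsto (fun N : ℕ => (1 + x / N) ^ (N - r)) atTop (𝓝 (Complex.exp x)) := by
  have h1 : Tendsto (fun N : ℕ => 1 + x / (N : ℂ)) atTop (𝓝 1) := by
    have := (tendsto_const_div_atTop_nhds_zero_nat (𝕜 := ℂ) x).const_add 1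
    simpa using this
  have h2 := (Complex.tendsto_one_add_div_pow_exp x).div (h1.pow r) (by simp)
  rw [one_pow, div_one] at h2
  refine h2.congr' ?_
  filter_upwards [h1.eventually_ne one_ne_zero, eventually_ge_atTop r] with N hN hr
  rw [Pi.div_apply, div_eq_iff (pow_ne_zero _ hN), ← pow_add, Nat.sub_add_cancel hr]

/-- The scaling factor `1 / √N`. -/
noncomputable def invSqrt (N : ℕ) : ℂ := (((Real.sqrt N)⁻¹ : ℝ) : ℂ)

theorem star_invSqrt (N : ℕ) : star (invSqrt N) = invSqrt N := Complex.conj_ofReal _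

theorem invSqrt_mul_self (N : ℕ) : invSqrt N * invSqrt N = (N : ℂ)⁻¹ := by
  rw [invSqrt, ← Complex.ofReal_mul, ← mul_inv, Real.mul_self_sqrt (Nat.cast_nonneg N)]
  simp

theorem tendsto_invSqrt : Tendsto invSqrt atTop (𝓝 0) := by
  have : Tendsto (fun N : ℕ => (Real.sqrt N)⁻¹) atTop (𝓝 0) :=
    (Real.tendsto_sqrt_atTop.comp tendsto_natCast_atTop_atTop).inv_tendsto_atTop
  have h2 : Tendsto invSqrt atTop (𝓝 ((0 : ℝ) : ℂ)) :=
    (Complex.continuous_ofReal.tendsto 0).comp this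
  simpa using h2

theorem herm_smul_smul (N : ℕ) (z w : Cn m) :
    herm (invSqrt N • z) (invSqrt N • w) = herm z w / N := by
  simp only [herm, PiLp.smul_apply, smul_eq_mul, star_mul', star_invSqrt, div_eq_mul_inv,
    Finset.sum_mul, ← invSqrt_mul_self]
  refine Finset.sum_congr rfl fun q _ => ?_
  ring

variable [Fintype ι] [DecidableEq ι]

theorem tendsto_scaled_jetCov (k : ℕ) (z : ι → Cn m) :
    Tendsto (fun N : ℕ => Matrix.fromBlocks (Matrix.diagonal fun _ => 1) 0 0
        (Matrix.diagonal fun _ => invSqrt N) * jetCov k m N (fun p => invSqrt N • z p) *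
      Matrix.fromBlocks (Matrix.diagonal fun _ => 1) 0 0 (Matrix.diagonal fun _ => invSqrt N))
      atTop (𝓝 (limCov k z)) := by
  refine tendsto_pi_nhds.2 fun u => tendsto_pi_nhds.2 fun w => ?_
  simp only [← Matrix.diagonal_zero', Matrix.fromBlocks_diagonal, Matrix.mul_diagonal,
    Matrix.diagonal_mul]
  rcases u with ⟨p, j⟩ | ⟨p, j, q⟩ <;> rcases w with ⟨p', j'⟩ | ⟨p', j', q'⟩ <;>
    simp only [jetCov_inl_inl, jetCov_inl_inr, jetCov_inr_inl, jetCov_inr_inr, limCov,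
      Matrix.fromBlocks_apply₁₁, Matrix.fromBlocks_apply₁₂, Matrix.fromBlocks_apply₂₁,
      Matrix.fromBlocks_apply₂₂, Matrix.of_apply, herm_smul_smul, Sum.elim_inl, Sum.elim_inr,
      one_mul, mul_one, PiLp.smul_apply, smul_eq_mul, star_mul', star_invSqrt]
  · by_cases h : j = j'
    · simpa [h] using tendsto_one_add_div_pow_sub (herm (z p) (z p')) 0
    · simp [h]
  · by_cases h : j = j'
    · simp only [h, if_true]
      refine ((tendsto_one_add_div_pow_sub (herm (z p) (z p')) 1).const_mul (z p q')).congr' ?_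
      filter_upwards [eventually_ne_atTop 0] with N hN
      have hN' : (N : ℂ) ≠ 0 := by exact_mod_cast hN
      have := invSqrt_mul_self N
      field_simp at this
      linear_combination -(z p q' * (1 + herm (z p) (z p') / N) ^ (N - 1)) * this
    · simp [h]
  · by_cases h : j = j'
    · simp only [h, if_true]
      refine ((tendsto_one_add_div_pow_sub (herm (z p) (z p')) 1).mul_const (star (z p' q))).congr' ?_
      filter_upwards [eventually_ne_atTop 0] with N hN
      have hN' : (N : ℂ) ≠ 0 := by exact_mod_cast hN
      have := invSqrt_mul_self N
      field_simp at this
      linear_combination -(star (z p' q) * (1 + herm (z p) (z p') / N) ^ (N - 1)) * this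
    · simp [h]
  · by_cases h : j = j'
    · simp only [h, if_true]
      -- The four factors `N^(-1/2)` (two from the derivatives, two from the coordinates) against
      -- `N(N-1)` leave `1 - 1/N`.
      have h1 : Tendsto (fun N : ℕ => 1 - (1 : ℂ) / N) atTop (𝓝 1) := by
        have := (tendsto_const_div_atTop_nhds_zero_nat (𝕜 := ℂ) 1).const_sub 1
        simpa using this
      have h2 := ((tendsto_one_add_div_pow_sub (herm (z p) (z p')) 2).const_mul
        (z p q' * star (z p' q))).mul h1
      have h3 : Tendsto (fun N : ℕ => if q = q' then (1 + herm (z p) (z p') / N) ^ (N - 1) else 0)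
          atTop (𝓝 (if q = q' then Complex.exp (herm (z p) (z p')) else 0)) := by
        by_cases hq : q = q'
        · simpa [hq] using tendsto_one_add_div_pow_sub (herm (z p) (z p')) 1
        · simp [hq]
      have h4 := h2.add h3
      rw [mul_one] at h4
      refine h4.congr' ?_
      filter_upwards [eventually_ge_atTop 1] with N hN
      have hN' : (N : ℂ) ≠ 0 := by exact_mod_cast (by omega : N ≠ 0)
      have h5 := invSqrt_mul_self N
      have h6 : N * (invSqrt N * invSqrt N) = 1 := by rw [h5]; field_simp
      have h7 : ((N - 1 : ℕ) : ℂ) = N - 1 := by push_cast [hN]; ring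
      have h8 : N - 1 - 1 = N - 2 := by omega
      have h9 : 1 - (1 : ℂ) / N = (N - 1) * (invSqrt N * invSqrt N) := by
        rw [h5]; field_simp
      rw [h7, h8, h9]
      set P := (1 + herm (z p) (z p') / N) ^ (N - 2)
      by_cases hq : q = q'
      · simp only [hq, if_true]
        linear_combination (-(z p q' * star (z p' q') * P * (N - 1) * (invSqrt N * invSqrt N)) -
          (1 + herm (z p) (z p') / N) ^ (N - 1)) * h6
      · simp only [hq, if_false]
        linear_combination (-(z p q' * star (z p' q) * P * (N - 1) * (invSqrt N * invSqrt N))) * h6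
    · simp [h]

theorem tendsto_invMetric (z : Cn m) :
    Tendsto (fun N : ℕ => invMetric (invSqrt N • z)) atTop (𝓝 1) := by
  have h0 : Tendsto (fun N : ℕ => invSqrt N • z) atTop (𝓝 0) := by
    simpa using tendsto_invSqrt.smul_const z
  have hc : Continuous (fubiniStudy : Cn m → Matrix (Fin m) (Fin m) ℂ) := by
    refine continuous_matrix fun q q' => ?_
    simp only [fubiniStudy, Matrix.of_apply]
    have : ∀ z : Cn m, (((1 + ‖z‖ ^ 2 : ℝ) : ℂ)) ^ 2 ≠ 0 := fun z =>
      pow_ne_zero _ (Complex.ofReal_ne_zero.2 (by positivity))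
    refine Continuous.div ?_ (by fun_prop) this
    split_ifs <;> fun_prop
  have hf0 : fubiniStudy (0 : Cn m) = 1 := by
    ext q q'
    simp [fubiniStudy, Matrix.one_apply]
  have h1 : Tendsto (fun N : ℕ => fubiniStudy (invSqrt N • z)) atTop (𝓝 1) := by
    have := (hc.tendsto 0).comp h0
    rwa [hf0] at this
  have hd : Tendsto (fun N : ℕ => (fubiniStudy (invSqrt N • z)).det⁻¹) atTop (𝓝 1) := by
    have := ((continuous_id.matrix_det.tendsto _).comp h1).inv₀ (by simp)
    simpa using this
  have ha : Tendsto (fun N : ℕ => (fubiniStudy (invSqrt N • z)).adjugate) atTop (𝓝 1) := by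
    have := (continuous_id.matrix_adjugate.tendsto _).comp h1
    simpa [Function.comp_def] using this
  have h2 := (continuous_id.matrix_transpose.tendsto _).comp (hd.smul ha)
  simpa [Function.comp_def, invMetric, Matrix.inv_def, Ring.inverse_eq_inv'] using h2

theorem tendsto_scaledCorr (k : ℕ) (z : ι → Cn m)
    (hz : (limCov k z).PosDef) :
    Tendsto (fun N : ℕ => (scaledCorr k m z N : ℂ)) atTop
      (𝓝 ((((m - k).factorial : ℂ) / m.factorial) ^ Fintype.card ι *
        corrForm (fun _ => 1) (limCov k z))) := by
  set E : ℕ → Matrix (JetIdx ι k m) (JetIdx ι k m) ℂ := fun N =>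
    Matrix.fromBlocks (Matrix.diagonal fun _ => 1) 0 0 (Matrix.diagonal fun _ => invSqrt N)
  have hlim := tendsto_scaled_jetCov k z
  have hA := (PosDef_toBlocks₁₁ hz).det_pos.ne'
  have hform := (continuousAt_corrForm (fun _ => 1) (limCov k z) hA).tendsto.comp
    ((tendsto_pi_nhds.2 fun p : ι => tendsto_invMetric (z p)).prodMk_nhds hlim)
  refine (hform.const_mul ((((m - k).factorial : ℂ) / m.factorial) ^ Fintype.card ι)).congr' ?_
  -- The limit is nonsingular, so the finite-`N` covariances are eventually nonsingular; being Gram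
  -- matrices, they are then positive definite.
  have hdet : ∀ᶠ N in atTop, (E N * jetCov k m N (fun p => invSqrt N • z p) * E N).det ≠ 0 :=
    ((continuous_id.matrix_det.tendsto _).comp hlim).eventually_ne hz.det_pos.ne'
  filter_upwards [hdet, eventually_ne_atTop 0] with N hN hN0
  have hpos : (jetCov k m N (fun p => invSqrt N • z p)).PosDef := by
    have hs : (jetCov k m N (fun p => invSqrt N • z p)).PosSemidef := by
      rw [jetCov_eq]; exact Matrix.posSemidef_self_mul_conjTranspose _
    rw [hs.posDef_iff_det_ne_zero]
    rw [Matrix.det_mul, Matrix.det_mul] at hN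
    exact right_ne_zero_of_mul (left_ne_zero_of_mul hN)
  -- Rescaling the derivatives contributes `N^(-k)` per point, which matches the power of `N` in the
  -- normalisation.
  have hg := corrForm_gauge (fun p => invMetric (invSqrt N • z p)) (fun _ : ι => 1) (fun _ => 1)
    (fun _ => invSqrt N) (fun _ => invSqrt N) (0 : Matrix (ι × Fin k × Fin m) (ι × Fin k) ℂ)
    (0 : Matrix (ι × Fin k) (ι × Fin k × Fin m) ℂ)
    (fun _ => one_ne_zero) (fun _ => one_ne_zero) (jetCov k m N (fun p => invSqrt N • z p))
    (PosDef_toBlocks₁₁ hpos).det_pos.ne'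
  have hsc : scaledCorr k m z N = (((m.factorial : ℝ) / (Real.pi ^ k * ((m - k).factorial : ℝ)) *
    (N : ℝ) ^ k) ^ Fintype.card ι)⁻¹ * zeroCorr k m N (fun p => invSqrt N • z p) := rfl
  have hpi : (Real.pi : ℂ) ≠ 0 := by exact_mod_cast Real.pi_ne_zero
  have hN' : (N : ℂ) ≠ 0 := by exact_mod_cast hN0
  have hm : (m.factorial : ℂ) ≠ 0 := by exact_mod_cast m.factorial_ne_zero
  have hmk : ((m - k).factorial : ℂ) ≠ 0 := by exact_mod_cast (m - k).factorial_ne_zero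
  simp only [Function.comp_apply]
  rw [hsc, Complex.ofReal_mul, zeroCorr_eq N _ hpos, hg]
  simp only [invSqrt_mul_self, Finset.prod_const, Finset.card_univ, mul_one, one_pow, div_one]
  push_cast
  rw [mul_comm (Fintype.card ι) k, pow_mul, pow_right_comm, ← mul_assoc, ← mul_assoc]
  congr 1
  rw [← mul_pow, ← mul_inv, ← mul_pow, ← inv_pow]
  congr 1
  field_simp
  rw [← mul_pow, one_div, inv_mul_cancel₀ hN', one_pow]

end

/-! ### Lower bounds for the Bargmann–Fock kernel -/

section

variable {ι : Type} [Fintype ι]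

theorem posSemidef_pow_entries {G : Matrix ι ι ℂ} (hG : G.PosSemidef) (n : ℕ) :
    (Matrix.of fun i j => G i j ^ n).PosSemidef := by
  induction n with
  | zero =>
    have : (Matrix.of fun i j => G i j ^ 0) = Matrix.vecMulVec (fun _ : ι => (1 : ℂ)) (star fun _ => 1) := by
      ext i j; simp [Matrix.vecMulVec]
    rw [this]
    exact Matrix.posSemidef_vecMulVec_self_star _
  | succ n ih =>
    have : (Matrix.of fun i j => G i j ^ (n + 1)) = (Matrix.of fun i j => G i j ^ n).hadamard G := by
      ext i j; simp [pow_succ]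
    rw [this]
    exact ih.hadamard hG

theorem posSemidef_of_hasSum {M : ℕ → Matrix ι ι ℂ} {L : Matrix ι ι ℂ}
    (hM : ∀ n, (M n).PosSemidef) (h : ∀ i j, HasSum (fun n => M n i j) (L i j)) :
    L.PosSemidef := by
  rw [Matrix.posSemidef_iff_dotProduct_mulVec]
  constructor
  · ext i j
    have h1 := (h j i).star
    refine h1.unique ((h i j).congr_fun ?_)
    intro n
    exact ((hM n).isHermitian.apply i j)
  · intro x
    have h1 : HasSum (fun n => star x ⬝ᵥ (M n *ᵥ x)) (star x ⬝ᵥ (L *ᵥ x)) := by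
      simp only [dotProduct, Matrix.mulVec]
      exact hasSum_sum fun i _ => (hasSum_sum fun j _ => (h i j).mul_right (x j)).mul_left _
    exact h1.nonneg fun n => (hM n).dotProduct_mulVec_nonneg x

/-- The tail of the exponential series is a sum of entrywise powers with positive coefficients, and
these are positive semidefinite by the Schur product theorem. -/
theorem posSemidef_exp_sub {G : Matrix ι ι ℂ} (hG : G.PosSemidef) :
    (Matrix.of fun i j => Complex.exp (G i j) - 1 - G i j).PosSemidef := by
  refine posSemidef_of_hasSum (M := fun n => ((((n + 2).factorial : ℝ)⁻¹ : ℝ) : ℂ) •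
    Matrix.of fun i j => G i j ^ (n + 2)) (fun n => ?_) fun i j => ?_
  · refine (posSemidef_pow_entries hG (n + 2)).smul ?_
    exact_mod_cast (by positivity : (0 : ℝ) ≤ ((n + 2).factorial : ℝ)⁻¹)
  · have h := NormedSpace.expSeries_div_hasSum_exp (𝔸 := ℂ) (G i j)
    rw [← Complex.exp_eq_exp_ℂ] at h
    have h2 := (hasSum_nat_add_iff' 2).2 h
    simp only [Finset.sum_range_succ, Finset.sum_range_zero] at h2
    convert! h2 using 1
    · funext n
      simp [div_eq_inv_mul]
    · simp; ring

variable {m : ℕ}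

theorem posSemidef_herm (z : ι → Cn m) : (Matrix.of fun i j => herm (z i) (z j)).PosSemidef := by
  have : (Matrix.of fun i j => herm (z i) (z j)) =
      (Matrix.of fun i q => z i q) * (Matrix.of fun i q => z i q)ᴴ := by
    ext i j; simp [Matrix.mul_apply, herm]
  rw [this]
  exact Matrix.posSemidef_self_mul_conjTranspose _

theorem herm_self (z : Cn m) : herm z z = ((‖z‖ ^ 2 : ℝ) : ℂ) := by
  rw [EuclideanSpace.norm_sq_eq, herm, Complex.ofReal_sum]
  refine Finset.sum_congr rfl fun q _ => ?_
  rw [Complex.ofReal_pow, ← Complex.mul_conj']; rfl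

theorem herm_eq_inner (z w : Cn m) : herm z w = inner ℂ w z := by
  rw [PiLp.inner_apply]
  simp [herm]

theorem norm_herm_le (z w : Cn m) : ‖herm z w‖ ≤ ‖z‖ * ‖w‖ := by
  rw [herm_eq_inner, mul_comm]
  exact norm_inner_le_norm w z

theorem herm_add_left (z z' w : Cn m) : herm (z + z') w = herm z w + herm z' w := by
  simp only [herm_eq_inner, inner_add_right]

theorem herm_sub_left (z z' w : Cn m) : herm (z - z') w = herm z w - herm z' w := by
  simp only [herm_eq_inner, inner_sub_right]

theorem herm_add_right (z w w' : Cn m) : herm z (w + w') = herm z w + herm z w' := by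
  simp only [herm_eq_inner, inner_add_left]

theorem herm_sub_right (z w w' : Cn m) : herm z (w - w') = herm z w - herm z w' := by
  simp only [herm_eq_inner, inner_sub_left]

theorem herm_smul_left (c : ℂ) (z w : Cn m) : herm (c • z) w = c * herm z w := by
  simp only [herm_eq_inner, inner_smul_right]

theorem herm_smul_right (c : ℂ) (z w : Cn m) : herm z (c • w) = star c * herm z w := by
  simp only [herm_eq_inner, inner_smul_left]; rfl

theorem herm_sum_left {T : Type} (s : Finset T) (f : T → Cn m) (w : Cn m) :
    herm (∑ t ∈ s, f t) w = ∑ t ∈ s, herm (f t) w := by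
  simp only [herm_eq_inner, inner_sum]

theorem herm_zero_left (w : Cn m) : herm 0 w = 0 := by simp [herm]

theorem herm_zero_right (w : Cn m) : herm w 0 = 0 := by simp [herm]

theorem quadForm_vecMulVec (x f : ι → ℂ) :
    star x ⬝ᵥ ((Matrix.of fun i j => f i * star (f j)) *ᵥ x) =
      ((‖∑ i, star (x i) * f i‖ ^ 2 : ℝ) : ℂ) := by
  rw [Complex.ofReal_pow, ← Complex.mul_conj']
  simp only [dotProduct, Matrix.mulVec, Matrix.of_apply, Pi.star_apply, map_sum, map_mul]
  rw [Finset.sum_mul_sum]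
  refine Finset.sum_congr rfl fun i _ => ?_
  rw [Finset.mul_sum]
  refine Finset.sum_congr rfl fun j _ => ?_
  have : (starRingEnd ℂ) (star (x j)) = x j := star_star _
  rw [this]
  change _ = star (x i) * f i * (x j * star (f j))
  ring

/-- `1 + ⟨z, w⟩ / M` dominates `δ f(z) conj f(w)` for affine functions `f`. -/
theorem posSemidef_one_add_sub (z : ι → Cn m) (b : ℂ) (a : Cn m) {M δ : ℝ} (hM : 0 < M)
    (hδ : 0 ≤ δ) (h : δ * (‖b‖ ^ 2 + M * ‖a‖ ^ 2) ≤ 1) :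
    (Matrix.of fun i j => 1 + herm (z i) (z j) / M -
      δ * ((b + herm (z i) a) * star (b + herm (z j) a))).PosSemidef := by
  rw [Matrix.posSemidef_iff_dotProduct_mulVec]
  constructor
  · ext i j
    have : ∀ x : ℝ, star (x : ℂ) = x := fun x => Complex.conj_ofReal x
    simp only [Matrix.conjTranspose_apply, Matrix.of_apply, star_sub, star_add, star_one,
      star_div₀, star_herm, star_mul', star_star, this]
    ring
  · intro x
    -- In terms of `s` and `Y` the form is `|s|² + |Y|²/M - δ |s b + ⟨Y,a⟩|²`, which is nonnegative
    -- by Cauchy–Schwarz with weights `1` and `M`.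
    set s : ℂ := ∑ i, star (x i) with hs
    set Y : Cn m := ∑ i, star (x i) • z i with hY
    have e1 : (Matrix.of fun i j => 1 + herm (z i) (z j) / M -
        δ * ((b + herm (z i) a) * star (b + herm (z j) a))) =
        (Matrix.of fun i j : ι => (1 : ℂ) * star (1 : ℂ)) +
        ((M : ℂ)⁻¹ • (∑ q, Matrix.of fun i j => z i q * star (z j q)) -
        (δ : ℂ) • Matrix.of fun i j => (b + herm (z i) a) * star (b + herm (z j) a)) := by
      ext i j
      simp only [Matrix.of_apply, Matrix.add_apply, Matrix.sub_apply, Matrix.smul_apply, herm,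
        Matrix.sum_apply, smul_eq_mul, star_one, mul_one]
      ring
    have e2 : ∑ i, star (x i) * (b + herm (z i) a) = s * b + herm Y a := by
      rw [hY, herm_sum_left, hs, Finset.sum_mul, ← Finset.sum_add_distrib]
      refine Finset.sum_congr rfl fun i _ => ?_
      rw [herm_smul_left]; ring
    have e3 : (∑ q, ‖∑ i, star (x i) * z i q‖ ^ 2) = ‖Y‖ ^ 2 := by
      rw [EuclideanSpace.norm_sq_eq]
      refine Finset.sum_congr rfl fun q _ => ?_
      simp [hY]
    rw [e1, Matrix.add_mulVec, Matrix.sub_mulVec, Matrix.smul_mulVec, Matrix.smul_mulVec,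
      dotProduct_add, dotProduct_sub, dotProduct_smul, dotProduct_smul,
      quadForm_vecMulVec x (fun _ => 1), quadForm_vecMulVec x (fun i => b + herm (z i) a), e2,
      Matrix.sum_mulVec, dotProduct_sum,
      Finset.sum_congr rfl fun q _ => quadForm_vecMulVec x (fun i => z i q), ← Complex.ofReal_sum,
      e3]
    simp only [mul_one, ← hs, smul_eq_mul]
    rw [← Complex.ofReal_inv, ← Complex.ofReal_mul, ← Complex.ofReal_mul, ← Complex.ofReal_sub,
      ← Complex.ofReal_add]
    rw [Complex.zero_le_real]
    have h1 : ‖s * b + herm Y a‖ ≤ ‖s‖ * ‖b‖ + ‖Y‖ * ‖a‖ :=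
      (norm_add_le _ _).trans (add_le_add (norm_mul_le _ _) (norm_herm_le _ _))
    have h2 : ‖s * b + herm Y a‖ ^ 2 ≤ (‖s‖ ^ 2 + M⁻¹ * ‖Y‖ ^ 2) * (‖b‖ ^ 2 + M * ‖a‖ ^ 2) := by
      refine (pow_le_pow_left₀ (norm_nonneg _) h1 2).trans ?_
      have h3 : (‖s‖ ^ 2 + M⁻¹ * ‖Y‖ ^ 2) * (‖b‖ ^ 2 + M * ‖a‖ ^ 2) -
          (‖s‖ * ‖b‖ + ‖Y‖ * ‖a‖) ^ 2 = M⁻¹ * (M * ‖s‖ * ‖a‖ - ‖Y‖ * ‖b‖) ^ 2 := by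
        field_simp; ring
      have h4 : 0 ≤ M⁻¹ * (M * ‖s‖ * ‖a‖ - ‖Y‖ * ‖b‖) ^ 2 := by positivity
      linarith
    have h5 : 0 ≤ ‖s‖ ^ 2 + M⁻¹ * ‖Y‖ ^ 2 := by positivity
    nlinarith [mul_le_mul_of_nonneg_left h2 hδ, mul_le_mul_of_nonneg_left h h5]

theorem posSemidef_exp_sub_affine (z : ι → Cn m) (b : ℂ) (a : Cn m) {M δ : ℝ} (hM : 0 < M)
    (hδ : 0 ≤ δ) (h : δ * (‖b‖ ^ 2 + M * ‖a‖ ^ 2) ≤ 1) :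
    (Matrix.of fun i j => Complex.exp (herm (z i) (z j) / M) -
      δ * ((b + herm (z i) a) * star (b + herm (z j) a))).PosSemidef := by
  have hG : (Matrix.of fun i j => herm (z i) (z j) / (M : ℂ)).PosSemidef := by
    have h1 := (posSemidef_herm z).smul (a := ((M⁻¹ : ℝ) : ℂ))
      (Complex.zero_le_real.2 (inv_nonneg.2 hM.le))
    convert! h1 using 1
    ext i j; simp [div_eq_inv_mul]
  have h2 := (posSemidef_exp_sub hG).add (posSemidef_one_add_sub z b a hM hδ h)
  convert! h2 using 1
  ext i j
  simp only [Matrix.of_apply, Matrix.add_apply]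
  ring

/-- Entrywise products are monotone for the positive semidefinite order: `K K' - F F' = K (K' - F')
+ (K - F) F'`. The first conclusion feeds the second summand in the induction. -/
theorem posSemidef_prod_sub_prod {T : Type} (s : Finset T) (K F : T → Matrix ι ι ℂ)
    (hF : ∀ t, (F t).PosSemidef) (hK : ∀ t, (K t - F t).PosSemidef) :
    (Matrix.of fun i j => ∏ t ∈ s, F t i j).PosSemidef ∧
    (Matrix.of fun i j => ∏ t ∈ s, K t i j - ∏ t ∈ s, F t i j).PosSemidef := by
  classical
  induction s using Finset.induction_on with
  | empty =>
    constructor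
    · simpa using posSemidef_pow_entries (Matrix.PosSemidef.zero (n := ι) (R := ℂ)) 0
    · have : (Matrix.of fun i j : ι => ∏ t ∈ (∅ : Finset T), K t i j - ∏ t ∈ (∅ : Finset T), F t i j)
        = 0 := by ext; simp
      rw [this]
      exact Matrix.PosSemidef.zero
  | insert t s ht ih =>
    simp only [Finset.prod_insert ht]
    have hKt : (K t).PosSemidef := by simpa using (hK t).add (hF t)
    refine ⟨(hF t).hadamard ih.1, ?_⟩
    convert! (hKt.hadamard ih.2).add ((hK t).hadamard ih.1) using 1
    ext i j; simp; ring

/-- The kernel `exp ⟨z, w⟩` dominates `δ F(z) conj F(w)` for products `F` of affine functions. -/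
theorem exp_kernel_lower_bound {T : Type} [Fintype T] [Nonempty T] (z : ι → Cn m) (b : T → ℂ)
    (a : T → Cn m) {δ : ℝ} (hδ : 0 ≤ δ)
    (h : ∀ t, δ * (‖b t‖ ^ 2 + Fintype.card T * ‖a t‖ ^ 2) ≤ 1) (x : ι → ℂ) :
    δ ^ Fintype.card T * ‖∑ i, star (x i) * ∏ t, (b t + herm (z i) (a t))‖ ^ 2 ≤
      (∑ i, ∑ j, star (x i) * x j * Complex.exp (herm (z i) (z j))).re := by
  have hM : (0 : ℝ) < Fintype.card T := by exact_mod_cast Fintype.card_pos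
  have hM' : (Fintype.card T : ℂ) ≠ 0 := by exact_mod_cast Fintype.card_pos.ne'
  -- Write `exp⟨z,w⟩` as a product of `|T|` copies of `exp(⟨z,w⟩/|T|)`; each copy dominates one
  -- affine factor, with `M = |T|`.
  have h1 := (posSemidef_prod_sub_prod Finset.univ
    (fun _ : T => Matrix.of fun i j => Complex.exp (herm (z i) (z j) / (Fintype.card T : ℝ)))
    (fun t => (δ : ℂ) • Matrix.of fun i j => (b t + herm (z i) (a t)) * star (b t + herm (z j) (a t)))
    (fun t => (Matrix.posSemidef_vecMulVec_self_star (fun i => b t + herm (z i) (a t))).smul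
      (Complex.zero_le_real.2 hδ))
    (fun t => posSemidef_exp_sub_affine z (b t) (a t) hM hδ (h t))).2
  have h2 := h1.dotProduct_mulVec_nonneg x
  have e : (Matrix.of fun i j => ∏ t : T, (Matrix.of fun i j =>
        Complex.exp (herm (z i) (z j) / (Fintype.card T : ℝ))) i j - ∏ t, ((δ : ℂ) •
        Matrix.of fun i j => (b t + herm (z i) (a t)) * star (b t + herm (z j) (a t))) i j) =
      (Matrix.of fun i j => Complex.exp (herm (z i) (z j))) - ((δ ^ Fintype.card T : ℝ) : ℂ) •
        Matrix.of fun i j => (∏ t, (b t + herm (z i) (a t))) * star (∏ t, (b t + herm (z j) (a t))) := by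
    ext i j
    simp only [Matrix.of_apply, Matrix.smul_apply, smul_eq_mul, Finset.prod_const, Finset.card_univ,
      Finset.prod_mul_distrib, Matrix.sub_apply, star_prod]
    rw [← Complex.exp_nat_mul]
    congr 2
    · push_cast; field_simp
    · push_cast; rfl
  rw [e, Matrix.sub_mulVec, Matrix.smul_mulVec, dotProduct_sub, dotProduct_smul,
    quadForm_vecMulVec x (fun i => ∏ t, (b t + herm (z i) (a t))), smul_eq_mul,
    ← Complex.ofReal_mul] at h2
  have h3 := (Complex.le_def.1 h2).1
  rw [Complex.zero_re, Complex.sub_re, Complex.ofReal_re, sub_nonneg] at h3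
  refine h3.trans (le_of_eq ?_)
  congr 1
  simp only [dotProduct, Matrix.mulVec, Matrix.of_apply, Finset.mul_sum, Pi.star_apply]
  refine Finset.sum_congr rfl fun i _ => Finset.sum_congr rfl fun j _ => ?_
  ring

end

/-! ### The normalised kernel of separated points -/

section

variable {ι : Type} [Fintype ι] [DecidableEq ι] {m : ℕ}

theorem pow_card_le_det_of_quadForm {A : Matrix ι ι ℂ} (hA : A.IsHermitian) {μ : ℝ} (hμ : 0 ≤ μ)
    (h : ∀ x : ι → ℂ, μ * ∑ i, ‖x i‖ ^ 2 ≤ (star x ⬝ᵥ (A *ᵥ x)).re) :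
    μ ^ Fintype.card ι ≤ ‖A.det‖ := by
  have h1 : ∀ i, μ ≤ hA.eigenvalues i := by
    intro i
    have h2 := h (hA.eigenvectorBasis i)
    rw [hA.eigenvalues_eq i]
    have h3 := hA.eigenvectorBasis.orthonormal.1 i
    have h4 : ∑ j, ‖hA.eigenvectorBasis i j‖ ^ 2 = 1 := by
      rw [← EuclideanSpace.norm_sq_eq, h3, one_pow]
    rw [h4, mul_one] at h2
    exact h2
  rw [hA.det_eq_prod_eigenvalues, norm_prod, ← Finset.card_univ, ← Finset.prod_const]
  refine Finset.prod_le_prod (fun _ _ => hμ) fun i _ => (h1 i).trans ?_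
  simpa using le_abs_self _

/-- The normalised Bargmann–Fock kernel. -/
noncomputable def normKernel (z w : Cn m) : ℂ :=
  Complex.exp (herm z w - ((‖z‖ ^ 2 / 2 : ℝ) : ℂ) - ((‖w‖ ^ 2 / 2 : ℝ) : ℂ))

theorem star_exp (x : ℂ) : star (Complex.exp x) = Complex.exp (star x) :=
  (Complex.exp_conj x).symm

theorem star_normKernel (z w : Cn m) : star (normKernel z w) = normKernel w z := by
  have : ∀ x : ℝ, star (x : ℂ) = x := fun x => Complex.conj_ofReal x
  rw [normKernel, star_exp, star_sub, star_sub, star_herm, this, this, normKernel]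
  congr 1; ring

theorem norm_normKernel (z w : Cn m) : ‖normKernel z w‖ = Real.exp (-‖z - w‖ ^ 2 / 2) := by
  rw [normKernel, Complex.norm_exp]
  congr 1
  have e : (inner ℂ w z).re = RCLike.re (inner ℂ z w) := inner_re_symm (𝕜 := ℂ) w z
  rw [@norm_sub_sq ℂ, herm_eq_inner]
  simp only [Complex.sub_re, Complex.ofReal_re, e]
  ring

theorem normKernel_self (z : Cn m) : normKernel z z = 1 := by
  rw [normKernel, herm_self, ← Complex.exp_zero]
  congr 1
  push_cast; ring

/-- Test against `F(w) = ∏_{q≠p} (1 - ⟨w, z_q - z_p⟩ / |z_q - z_p|²)` at the translated points `w =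
z_i - z_p`: it is 1 at `z_p` and 0 at the other points. After the translation its coefficients are
controlled by the separation alone, so the constant is uniform: with `b = 1` and `‖a‖² ≤ 1/c²`, the
choice `δ = (1 + n/c²)⁻¹` is admissible. -/
theorem normKernel_quadForm_lower_bound {c : ℝ} (hc : 0 < c) (z : ι → Cn m)
    (hz : ∀ p q, p ≠ q → c ≤ ‖z p - z q‖) (x : ι → ℂ) (p : ι) :
    ((1 + Fintype.card ι / c ^ 2)⁻¹) ^ Fintype.card ι * ‖x p‖ ^ 2 ≤
      (∑ i, ∑ j, star (x i) * x j * normKernel (z i) (z j)).re := by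
  have : Nonempty ι := ⟨p⟩
  set δ : ℝ := (1 + Fintype.card ι / c ^ 2)⁻¹ with hδ
  have hδ0 : 0 < δ := by positivity
  set h := z p with hh
  -- The normalised kernel is translation invariant up to phases. The coefficients `y` absorb these
  -- and the Gaussian factors, and the extra factor is 1 at `j = p`.
  set y : ι → ℂ := fun j => x j *
    Complex.exp (herm h (z j) - ((‖h‖ ^ 2 / 2 : ℝ) : ℂ) - ((‖z j‖ ^ 2 / 2 : ℝ) : ℂ)) with hy
  have key := exp_kernel_lower_bound (T := ι) (fun i => z i - h) (fun _ => 1)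
    (fun q => if q = p then 0 else (((-(‖z q - h‖ ^ 2)⁻¹ : ℝ)) : ℂ) • (z q - h)) hδ0.le
    (fun q => by
      by_cases hq : q = p
      · simp only [hq, if_true, norm_one, norm_zero]
        rw [hδ]
        have : (0 : ℝ) ≤ Fintype.card ι / c ^ 2 := by positivity
        simpa using inv_le_one_of_one_le₀ (by linarith : 1 ≤ 1 + Fintype.card ι / c ^ 2)
      · have h1 := hz q p hq
        have h2 : 0 < ‖z q - h‖ := hc.trans_le h1
        have h3 : ‖(((-(‖z q - h‖ ^ 2)⁻¹ : ℝ)) : ℂ) • (z q - h)‖ ^ 2 ≤ 1 / c ^ 2 := by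
          rw [norm_smul, Complex.norm_real, norm_neg, Real.norm_of_nonneg (by positivity)]
          have : (‖z q - h‖ ^ 2)⁻¹ * ‖z q - h‖ = ‖z q - h‖⁻¹ := by field_simp
          rw [this, inv_pow, one_div]
          gcongr
        simp only [hq, if_false, norm_one, one_pow]
        rw [hδ, inv_mul_le_iff₀ (by positivity), mul_one]
        gcongr 1 + ?_
        calc _ ≤ (Fintype.card ι : ℝ) * (1 / c ^ 2) := by gcongr
          _ = _ := by ring) y
  have hprod : ∀ i, ∏ t, ((1 : ℂ) + herm (z i - h)
      (if t = p then 0 else (((-(‖z t - h‖ ^ 2)⁻¹ : ℝ)) : ℂ) • (z t - h))) =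
      if i = p then 1 else 0 := by
    intro i
    by_cases hi : i = p
    · simp [hi, hh, herm_zero_left]
    · rw [if_neg hi, Finset.prod_eq_zero (Finset.mem_univ i)]
      have h0 : (‖z i - h‖ : ℂ) ≠ 0 := by
        rw [Complex.ofReal_ne_zero]; exact (hc.trans_le (hz i p hi)).ne'
      rw [if_neg hi, herm_smul_right, herm_self, ← starRingEnd_apply, Complex.conj_ofReal]
      push_cast
      field_simp
      ring
  simp only [hprod, mul_ite, mul_one, mul_zero, Finset.sum_ite_eq', Finset.mem_univ, if_true,
    norm_star] at key
  have hyp : ‖y p‖ = ‖x p‖ := by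
    rw [hy]
    simp only [← hh]
    have : Complex.exp (herm h h - ((‖h‖ ^ 2 / 2 : ℝ) : ℂ) - ((‖h‖ ^ 2 / 2 : ℝ) : ℂ)) = 1 :=
      normKernel_self h
    rw [this, mul_one]
  rw [hyp] at key
  refine key.trans (le_of_eq ?_)
  congr 1
  refine Finset.sum_congr rfl fun i _ => Finset.sum_congr rfl fun j _ => ?_
  have hr : ∀ x : ℝ, star (x : ℂ) = x := fun x => Complex.conj_ofReal x
  simp only [hy, star_mul', star_exp, star_sub, hr, star_herm, normKernel, herm_sub_left,
    herm_sub_right, herm_self h]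
  have e : ∀ a b u v w : ℂ, a * Complex.exp u * (b * Complex.exp v) * Complex.exp w =
      a * b * Complex.exp (u + v + w) := by
    intro a b u v w
    rw [Complex.exp_add, Complex.exp_add]; ring
  rw [e]
  congr 2
  push_cast
  ring

/-- The determinant of the normalised kernel is bounded below for separated points. -/
theorem exists_le_norm_det_normKernel (m : ℕ) {c : ℝ} (hc : 0 < c) :
    ∃ μ : ℝ, 0 < μ ∧ ∀ z : ι → Cn m, (∀ p q, p ≠ q → c ≤ ‖z p - z q‖) →
      μ ≤ ‖(Matrix.of fun i j => normKernel (z i) (z j)).det‖ := by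
  set δ : ℝ := ((1 + Fintype.card ι / c ^ 2)⁻¹) ^ Fintype.card ι with hδ
  have hδ0 : 0 < δ := by positivity
  -- Summing the bounds for the individual coordinates gives `δ ∑ |x p|² ≤ n Q`; dividing by `n + 1`
  -- instead of `n` also covers an empty index type.
  refine ⟨(δ / (Fintype.card ι + 1)) ^ Fintype.card ι, by positivity, fun z hz => ?_⟩
  refine pow_card_le_det_of_quadForm ?_ (by positivity) fun x => ?_
  · ext i j; simp only [Matrix.conjTranspose_apply, Matrix.of_apply, star_normKernel]
  · have e : star x ⬝ᵥ ((Matrix.of fun i j => normKernel (z i) (z j)) *ᵥ x) =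
        ∑ i, ∑ j, star (x i) * x j * normKernel (z i) (z j) := by
      simp only [dotProduct, Matrix.mulVec, Matrix.of_apply, Finset.mul_sum, Pi.star_apply]
      refine Finset.sum_congr rfl fun i _ => Finset.sum_congr rfl fun j _ => ?_
      ring
    rw [e]
    set Q := (∑ i, ∑ j, star (x i) * x j * normKernel (z i) (z j)).re with hQ
    have h1 := Finset.sum_le_sum fun p (_ : p ∈ Finset.univ) =>
      normKernel_quadForm_lower_bound hc z hz x p
    rw [← Finset.mul_sum, Finset.sum_const, Finset.card_univ, ← hQ, nsmul_eq_mul, ← hδ] at h1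
    have hQ0 : 0 ≤ Q := by
      by_cases hι : Nonempty ι
      · obtain ⟨p⟩ := hι
        exact le_trans (by positivity) (normKernel_quadForm_lower_bound hc z hz x p)
      · rw [not_nonempty_iff] at hι
        simp [hQ]
    rw [div_mul_eq_mul_div, div_le_iff₀ (by positivity)]
    linarith

end

/-! ### Positivity of the limiting covariance -/

section

variable {ι : Type} [Fintype ι] {m : ℕ}

/-- The quadratic form of the Bargmann–Fock 1-jets, at coefficients `x` of the values and
directions `ξ` of the derivatives. -/
noncomputable def jetQuad (z : ι → Cn m) (x : ι → ℂ) (ξ : ι → Cn m) : ℂ :=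
  ∑ p, ∑ p', Complex.exp (herm (z p) (z p')) *
    ((star (x p) + herm (ξ p) (z p')) * (x p' + herm (z p) (ξ p')) + herm (ξ p) (ξ p'))

theorem tendsto_exp_mul_sub_one_div (β : ℂ) :
    Tendsto (fun h : ℝ => (Complex.exp (h * β) - 1) / h) (𝓝[>] 0) (𝓝 β) := by
  have h1 : HasDerivAt (fun h : ℝ => Complex.exp (h * β)) β 0 := by
    have := ((Complex.ofRealCLM.hasDerivAt (x := (0 : ℝ))).mul_const β).cexp
    simpa using this
  have h2 := (hasDerivAt_iff_tendsto_slope.1 h1).mono_left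
    (nhdsWithin_mono 0 fun h (hh : 0 < h) => hh.ne')
  refine h2.congr fun h => ?_
  simp [slope_def_module, div_eq_inv_mul]

/-- One 2×2 block of the kernel form at `z_p, z_p + hξ_p` against `z_p', z_p' + hξ_p'`, with
`exp⟨z_p,z_p'⟩` factored out: the singular terms in `1/h` and `1/h²` cancel. -/
theorem tendsto_second_difference (β γ d u v : ℂ) :
    Tendsto (fun h : ℝ => (u - (h : ℂ)⁻¹) * (v - (h : ℂ)⁻¹) +
      (u - (h : ℂ)⁻¹) * (h : ℂ)⁻¹ * Complex.exp (h * γ) +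
      (h : ℂ)⁻¹ * (v - (h : ℂ)⁻¹) * Complex.exp (h * β) +
      (h : ℂ)⁻¹ * (h : ℂ)⁻¹ * Complex.exp (h * β + h * γ + h * h * d)) (𝓝[>] 0)
      (𝓝 ((u + β) * (v + γ) + d)) := by
  have hβ := tendsto_exp_mul_sub_one_div β
  have hγ := tendsto_exp_mul_sub_one_div γ
  have hd : Tendsto (fun h : ℝ => (Complex.exp ((h * h : ℝ) * d) - 1) / (h * h : ℝ)) (𝓝[>] 0) (𝓝 d) := by
    refine (tendsto_exp_mul_sub_one_div d).comp (f := fun h : ℝ => h * h) ?_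
    refine tendsto_nhdsWithin_iff.2 ⟨?_, ?_⟩
    · have : Tendsto (fun h : ℝ => h * h) (𝓝 0) (𝓝 (0 * 0)) :=
        (continuous_id.mul continuous_id).tendsto 0
      rw [mul_zero] at this
      exact this.mono_left nhdsWithin_le_nhds
    · filter_upwards [self_mem_nhdsWithin] with h hh
      exact Set.mem_Ioi.2 (mul_pos (Set.mem_Ioi.1 hh) (Set.mem_Ioi.1 hh))
  have he : Tendsto (fun h : ℝ => Complex.exp (h * (β + γ))) (𝓝[>] 0) (𝓝 1) := by
    have : Continuous fun h : ℝ => Complex.exp (h * (β + γ)) := by fun_prop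
    have h2 := this.tendsto 0
    simp only [Complex.ofReal_zero, zero_mul, Complex.exp_zero] at h2
    exact h2.mono_left nhdsWithin_le_nhds
  have h := (((hγ.const_mul u).add (hβ.const_mul v)).add (hβ.mul hγ)).add (he.mul hd)
  have h' := h.const_add (u * v)
  have e : u * v + (u * γ + v * β + β * γ + 1 * d) = (u + β) * (v + γ) + d := by ring
  rw [e] at h'
  refine h'.congr' ?_
  filter_upwards [self_mem_nhdsWithin] with h hh
  have hh0 : (h : ℂ) ≠ 0 := Complex.ofReal_ne_zero.2 (ne_of_gt hh)
  have e1 : Complex.exp (h * (β + γ)) = Complex.exp (h * β) * Complex.exp (h * γ) := by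
    rw [← Complex.exp_add]; congr 1; ring
  have e2 : Complex.exp (h * β + h * γ + h * h * d) =
    Complex.exp (h * β) * Complex.exp (h * γ) * Complex.exp (h * h * d) := by
    rw [← Complex.exp_add, ← Complex.exp_add]
  rw [e1, e2]
  push_cast
  field_simp
  ring

/-- Derivatives are limits of difference quotients. The value bound is applied to the doubled
configuration `z_p, z_p + hξ_p` with coefficients `x_p - 1/h` and `1/h`; its constant depends only
on `a` and `b`, hence survives `h → 0`. -/
theorem jetQuad_lower_bound {T : Type} [Fintype T] [Nonempty T] (z : ι → Cn m) (x : ι → ℂ)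
    (ξ : ι → Cn m) (b : T → ℂ) (a : T → Cn m) (D : ι → ℂ)
    (hD : ∀ p, HasDerivAt (fun h : ℝ => ∏ t, (b t + herm (z p + (h : ℂ) • ξ p) (a t))) (D p) 0) :
    ∃ δ : ℝ, 0 < δ ∧
      δ * ‖∑ p, (star (x p) * ∏ t, (b t + herm (z p) (a t)) + D p)‖ ^ 2 ≤ (jetQuad z x ξ).re := by
  set S : ℝ := 1 + ∑ t, (‖b t‖ ^ 2 + Fintype.card T * ‖a t‖ ^ 2) with hS
  have hS0 : 0 < S := by positivity
  refine ⟨S⁻¹ ^ Fintype.card T, by positivity, ?_⟩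
  have hSt : ∀ t, S⁻¹ * (‖b t‖ ^ 2 + Fintype.card T * ‖a t‖ ^ 2) ≤ 1 := by
    intro t
    rw [inv_mul_le_iff₀ hS0, mul_one, hS]
    have := Finset.single_le_sum (f := fun t => ‖b t‖ ^ 2 + Fintype.card T * ‖a t‖ ^ 2)
      (fun t _ => by positivity) (Finset.mem_univ t)
    linarith
  set F : Cn m → ℂ := fun z => ∏ t, (b t + herm z (a t)) with hF
  have key := fun h : ℝ => exp_kernel_lower_bound (ι := ι ⊕ ι)
    (Sum.elim z fun p => z p + (h : ℂ) • ξ p) b a (inv_nonneg.2 hS0.le) hSt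
    (Sum.elim (fun p => x p - (h : ℂ)⁻¹) fun _ => (h : ℂ)⁻¹)
  simp only [Fintype.sum_sum_type, Sum.elim_inl, Sum.elim_inr] at key
  have hr : ∀ x : ℝ, star (x : ℂ) = x := fun x => Complex.conj_ofReal x
  have hri : ∀ x : ℝ, star (x : ℂ)⁻¹ = (x : ℂ)⁻¹ := fun x => by rw [star_inv₀, hr]
  refine le_of_tendsto_of_tendsto (b := 𝓝[>] (0 : ℝ)) ?_ ?_
    (Eventually.of_forall key)
  · refine Tendsto.const_mul _ ((Tendsto.norm ?_).pow 2)
    have h1 : ∀ p, Tendsto (fun h : ℝ => (star (x p - (h : ℂ)⁻¹)) * F (z p) +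
        star (h : ℂ)⁻¹ * F (z p + (h : ℂ) • ξ p)) (𝓝[>] 0) (𝓝 (star (x p) * F (z p) + D p)) := by
      intro p
      have h2 := ((hasDerivAt_iff_tendsto_slope.1 (hD p)).mono_left
        (nhdsWithin_mono 0 fun h (hh : 0 < h) => hh.ne')).const_add (star (x p) * F (z p))
      refine h2.congr fun h => ?_
      simp only [slope_def_module, star_sub, hri, sub_zero, Complex.ofReal_zero, zero_smul, add_zero,
        Complex.real_smul, Complex.ofReal_inv]
      ring
    have h3 := tendsto_finsetSum Finset.univ fun p _ => h1 p
    simpa only [Finset.sum_add_distrib] using h3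
  · refine (Complex.continuous_re.tendsto _).comp ?_
    have h1 : ∀ p p', Tendsto (fun h : ℝ => Complex.exp (herm (z p) (z p')) *
      ((star (x p) - (h : ℂ)⁻¹) * (x p' - (h : ℂ)⁻¹) +
      (star (x p) - (h : ℂ)⁻¹) * (h : ℂ)⁻¹ * Complex.exp (h * herm (z p) (ξ p')) +
      (h : ℂ)⁻¹ * (x p' - (h : ℂ)⁻¹) * Complex.exp (h * herm (ξ p) (z p')) +
      (h : ℂ)⁻¹ * (h : ℂ)⁻¹ * Complex.exp (h * herm (ξ p) (z p') + h * herm (z p) (ξ p') +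
        h * h * herm (ξ p) (ξ p')))) (𝓝[>] 0) (𝓝 _) := fun p p' =>
      (tendsto_second_difference (herm (ξ p) (z p')) (herm (z p) (ξ p')) (herm (ξ p) (ξ p'))
        (star (x p)) (x p')).const_mul _
    have h2 := tendsto_finsetSum Finset.univ fun p _ => tendsto_finsetSum Finset.univ fun p' _ => h1 p p'
    refine h2.congr fun h => ?_
    simp only [← Finset.sum_add_distrib]
    refine Finset.sum_congr rfl fun p _ => Finset.sum_congr rfl fun p' _ => ?_
    simp only [star_sub, hri, herm_add_left, herm_add_right, herm_smul_left, herm_smul_right, hr,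
      Complex.exp_add]
    have e : ∀ x : ℂ, Complex.exp (h * (h * x)) = Complex.exp (h * h * x) := fun x => by
      rw [mul_assoc]
    simp only [mul_add, Complex.exp_add, e]
    ring

end

/-! ### Nondegeneracy of the Bargmann–Fock 1-jets at distinct points -/

section

variable {ι : Type} [Fintype ι] {m : ℕ}

/-- The test function is `(b + ⟨w,a⟩) P(w)²`. Squaring `P` kills both values and first derivatives
at the points other than `z p`, which isolates the jet at `p`. -/
theorem jetQuad_lower_bound_single [DecidableEq ι] (z : ι → Cn m) (x : ι → ℂ) (ξ : ι → Cn m)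
    (b : ℂ) (a : Cn m) (p : ι) {P : Cn m → ℂ}
    (hP : P = fun w => ∏ q, if q = p then 1 else herm (w - z q) (z p - z q)) :
    ∃ δ : ℝ, 0 < δ ∧
      δ * ‖star (x p) * ((b + herm (z p) a) * P (z p) ^ 2) + (herm (ξ p) a * P (z p) ^ 2 +
        (b + herm (z p) a) * (2 * P (z p) * deriv (fun h : ℝ => P (z p + (h : ℂ) • ξ p)) 0))‖ ^ 2 ≤
        (jetQuad z x ξ).re := by
  -- `none` indexes the factor `b + ⟨w,a⟩`, and `Bool` doubles each factor of `P`.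
  have hF : ∀ w : Cn m, ∏ t : Option (ι × Bool),
      (t.elim b (fun t => if t.1 = p then 1 else -herm (z t.1) (z p - z t.1)) +
        herm w (t.elim a (fun t => if t.1 = p then 0 else z p - z t.1))) =
        (b + herm w a) * P w ^ 2 := by
    intro w
    rw [Fintype.prod_option, Fintype.prod_prod_type, hP]
    simp only [Option.elim, Fintype.prod_bool]
    rw [← Finset.prod_pow]
    congr 1
    refine Finset.prod_congr rfl fun q _ => ?_
    by_cases hq : q = p
    · simp [hq, herm_zero_right]
    · simp only [hq, if_false, herm_sub_left]; ring
  have hd : ∀ q, DifferentiableAt ℝ (fun h : ℝ => P (z q + (h : ℂ) • ξ q)) 0 := by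
    intro q
    simp only [hP, herm_sub_left, herm_add_left, herm_smul_left]
    refine DifferentiableAt.fun_finsetProd fun i _ => ?_
    split_ifs
    · fun_prop
    · have : DifferentiableAt ℝ (fun h : ℝ => (h : ℂ)) 0 := Complex.ofRealCLM.differentiableAt
      fun_prop
  have hD : ∀ q, HasDerivAt (fun h : ℝ => (b + herm (z q + (h : ℂ) • ξ q) a) *
      P (z q + (h : ℂ) • ξ q) ^ 2) (herm (ξ q) a * P (z q) ^ 2 +
        (b + herm (z q) a) * (2 * P (z q) * deriv (fun h : ℝ => P (z q + (h : ℂ) • ξ q)) 0)) 0 := by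
    intro q
    have h1 : HasDerivAt (fun h : ℝ => b + herm (z q + (h : ℂ) • ξ q) a) (herm (ξ q) a) 0 := by
      have := (((Complex.ofRealCLM.hasDerivAt (x := (0 : ℝ))).mul_const
        (herm (ξ q) a)).const_add (herm (z q) a)).const_add b
      simp only [herm_add_left, herm_smul_left]
      simpa using this
    have h2 := h1.fun_mul ((hd q).hasDerivAt.fun_pow 2)
    simpa using h2
  obtain ⟨δ, hδ, h⟩ := jetQuad_lower_bound z x ξ
    (fun t : Option (ι × Bool) => t.elim b (fun t => if t.1 = p then 1 else -herm (z t.1) (z p - z t.1)))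
    (fun t => t.elim a (fun t => if t.1 = p then 0 else z p - z t.1)) _
    (fun q => by simp only [hF]; exact hD q)
  refine ⟨δ, hδ, ?_⟩
  simp only [hF] at h
  rwa [Finset.sum_eq_single p] at h
  · intro q _ hq
    have hPq : P (z q) = 0 := by
      rw [hP]
      exact Finset.prod_eq_zero (Finset.mem_univ q) (by simp [hq, herm_zero_left])
    rw [hPq]; ring
  · simp

theorem eq_zero_of_jetQuad_nonpos [DecidableEq ι] {z : ι → Cn m} (hz : Function.Injective z)
    (x : ι → ℂ) (ξ : ι → Cn m) (h : (jetQuad z x ξ).re ≤ 0) (p : ι) : ξ p = 0 ∧ x p = 0 := by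
  set P : Cn m → ℂ := fun w => ∏ q, if q = p then 1 else herm (w - z q) (z p - z q) with hP
  have hPp : P (z p) ≠ 0 := by
    rw [hP]
    refine Finset.prod_ne_zero_iff.2 fun q _ => ?_
    split_ifs with hq
    · exact one_ne_zero
    · rw [herm_self, Complex.ofReal_ne_zero]
      exact pow_ne_zero _ (norm_ne_zero_iff.2 (sub_ne_zero.2 fun h => hq (hz h).symm))
  have aux : ∀ {δ : ℝ} {y : ℂ}, 0 < δ → δ * ‖y‖ ^ 2 ≤ (jetQuad z x ξ).re → y = 0 := by
    intro δ y hδ hy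
    have : δ * ‖y‖ ^ 2 ≤ 0 := hy.trans h
    have h2 : ‖y‖ ^ 2 ≤ 0 := nonpos_of_mul_nonpos_right this hδ
    exact norm_eq_zero.1 (pow_eq_zero_iff two_ne_zero |>.1 (le_antisymm h2 (by positivity)))
  have hξ : ξ p = 0 := by
    -- This affine factor vanishes at `z p` and has derivative `|ξ p|²` along `ξ p`, so the value
    -- coefficient disappears. Once `ξ p = 0` is known, the constant factor 1 detects `x p`.
    obtain ⟨δ, hδ, h1⟩ := jetQuad_lower_bound_single z x ξ (-herm (z p) (ξ p)) (ξ p) p hP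
    have h2 := aux hδ h1
    simp only [neg_add_cancel, zero_mul, mul_zero, zero_add, add_zero] at h2
    have h3 := (mul_eq_zero.1 h2).resolve_right (pow_ne_zero _ hPp)
    rw [herm_self, Complex.ofReal_eq_zero] at h3
    exact norm_eq_zero.1 (pow_eq_zero_iff two_ne_zero |>.1 h3)
  refine ⟨hξ, ?_⟩
  obtain ⟨δ, hδ, h1⟩ := jetQuad_lower_bound_single z x ξ 1 0 p hP
  have h2 := aux hδ h1
  simp only [hξ, herm_zero_right, smul_zero, add_zero, deriv_const, mul_zero, zero_mul, one_mul] at h2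
  have h3 := (mul_eq_zero.1 h2).resolve_right (pow_ne_zero _ hPp)
  exact star_eq_zero.1 h3

/-- A negative value would force all coefficients to vanish, and then the form is zero. -/
theorem jetQuad_re_nonneg {z : ι → Cn m} (hz : Function.Injective z)
    (x : ι → ℂ) (ξ : ι → Cn m) : 0 ≤ (jetQuad z x ξ).re := by
  classical
  by_contra hneg
  have h0 := eq_zero_of_jetQuad_nonpos hz x ξ (not_le.1 hneg).le
  have : jetQuad z x ξ = 0 := by
    simp only [jetQuad, (h0 _).1, (h0 _).2]
    simp [herm_zero_left, herm_zero_right]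
  rw [this] at hneg
  simp at hneg

theorem limCov_isHermitian (k : ℕ) (z : ι → Cn m) : (limCov k z).IsHermitian := by
  ext u w
  rw [Matrix.conjTranspose_apply]
  rcases u with ⟨p, j⟩ | ⟨p, j, q⟩ <;> rcases w with ⟨p', j'⟩ | ⟨p', j', q'⟩ <;>
    simp only [limCov, Matrix.fromBlocks_apply₁₁, Matrix.fromBlocks_apply₁₂,
      Matrix.fromBlocks_apply₂₁, Matrix.fromBlocks_apply₂₂, Matrix.of_apply] <;>
    by_cases h : j = j'
  all_goals first
    | (subst h
       simp only [if_true, star_mul', star_exp, star_herm, star_add, star_star, mul_comm])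
    | simp only [h, Ne.symm h, if_false, star_zero]
  by_cases hq : q = q'
  · simp only [hq, if_true, star_exp, star_herm]
  · simp only [hq, Ne.symm hq, if_false, star_zero]

theorem sum_sum_jetIdx (k : ℕ) (f : JetIdx ι k m → JetIdx ι k m → ℂ) :
    ∑ u, ∑ w, f u w = ∑ p, ∑ j, ∑ p', ∑ j', (f (Sum.inl (p, j)) (Sum.inl (p', j')) +
      ∑ q', f (Sum.inl (p, j)) (Sum.inr (p', j', q')) +
      (∑ q, f (Sum.inr (p, j, q)) (Sum.inl (p', j')) +
        ∑ q, ∑ q', f (Sum.inr (p, j, q)) (Sum.inr (p', j', q')))) := by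
  have h : ∀ g : ι → Fin k → Fin m → ι → Fin k → ℂ,
      ∑ p, ∑ j, ∑ q, ∑ p', ∑ j', g p j q p' j' = ∑ p, ∑ j, ∑ p', ∑ j', ∑ q, g p j q p' j' := by
    intro g
    refine Finset.sum_congr rfl fun p _ => Finset.sum_congr rfl fun j _ => ?_
    rw [Finset.sum_comm]
    exact Finset.sum_congr rfl fun p' _ => Finset.sum_comm
  have h1 := h fun p j q p' j' => f (Sum.inr (p, j, q)) (Sum.inl (p', j'))
  have h2 := h fun p j q p' j' => ∑ q', f (Sum.inr (p, j, q)) (Sum.inr (p', j', q'))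
  simp only [Fintype.sum_sum_type, Fintype.sum_prod_type, Finset.sum_add_distrib]
  rw [h1, h2]
  ring

theorem limCov_quadForm (k : ℕ) (z : ι → Cn m) (v : JetIdx ι k m → ℂ) :
    star v ⬝ᵥ (limCov k z *ᵥ v) = ∑ j, jetQuad z (fun p => v (Sum.inl (p, j)))
      (fun p => WithLp.toLp 2 fun q => star (v (Sum.inr (p, j, q)))) := by
  have key : ∀ (p p' : ι) (j : Fin k),
      Complex.exp (herm (z p) (z p')) * ((star (v (Sum.inl (p, j))) +
        herm (WithLp.toLp 2 fun q => star (v (Sum.inr (p, j, q)))) (z p')) *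
        (v (Sum.inl (p', j)) + herm (z p) (WithLp.toLp 2 fun q => star (v (Sum.inr (p', j, q))))) +
        herm (WithLp.toLp 2 fun q => star (v (Sum.inr (p, j, q))))
          (WithLp.toLp 2 fun q => star (v (Sum.inr (p', j, q))))) =
      star (v (Sum.inl (p, j))) * (Complex.exp (herm (z p) (z p')) * v (Sum.inl (p', j))) +
      ∑ q', star (v (Sum.inl (p, j))) *
        (z p q' * Complex.exp (herm (z p) (z p')) * v (Sum.inr (p', j, q'))) +
      (∑ q, star (v (Sum.inr (p, j, q))) *
        (Complex.exp (herm (z p) (z p')) * star (z p' q) * v (Sum.inl (p', j))) +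
      ∑ q, ∑ q', star (v (Sum.inr (p, j, q))) *
        ((z p q' * star (z p' q) * Complex.exp (herm (z p) (z p')) +
        (if q = q' then Complex.exp (herm (z p) (z p')) else 0)) * v (Sum.inr (p', j, q')))) := by
    intro p p' j
    set E := Complex.exp (herm (z p) (z p'))
    simp only [herm, star_star, add_mul, mul_add, Finset.sum_add_distrib, ite_mul, zero_mul, mul_ite,
      mul_zero, Finset.sum_ite_eq, Finset.mem_univ, if_true]
    rw [Finset.sum_mul_sum]
    simp only [Finset.mul_sum, Finset.sum_mul]
    have e1 : ∀ q, E * (star (v (Sum.inr (p, j, q))) * star (z p' q) * v (Sum.inl (p', j))) =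
      star (v (Sum.inr (p, j, q))) * (E * star (z p' q) * v (Sum.inl (p', j))) := fun q => by ring
    have e2 : ∀ q, E * (star (v (Sum.inl (p, j))) * (z p q * v (Sum.inr (p', j, q)))) =
      star (v (Sum.inl (p, j))) * (z p q * E * v (Sum.inr (p', j, q))) := fun q => by ring
    have e3 : ∀ q q', E * (star (v (Sum.inr (p, j, q))) * star (z p' q) *
      (z p q' * v (Sum.inr (p', j, q')))) =
      star (v (Sum.inr (p, j, q))) * (z p q' * star (z p' q) * E * v (Sum.inr (p', j, q'))) :=
      fun q q' => by ring
    have e4 : ∀ q, E * (star (v (Sum.inr (p, j, q))) * v (Sum.inr (p', j, q))) =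
      star (v (Sum.inr (p, j, q))) * (E * v (Sum.inr (p', j, q))) := fun q => by ring
    simp only [e1, e2, e3, e4]
    ring
  simp only [jetQuad, key]
  have e0 : star v ⬝ᵥ (limCov k z *ᵥ v) = ∑ u, ∑ w, star (v u) * (limCov k z u w * v w) := by
    simp only [dotProduct, Matrix.mulVec, Finset.mul_sum, Pi.star_apply]
  rw [e0, sum_sum_jetIdx, Finset.sum_comm]
  refine Finset.sum_congr rfl fun j _ => Finset.sum_congr rfl fun p _ =>
    Finset.sum_congr rfl fun p' _ => ?_
  simp only [limCov, Matrix.fromBlocks_apply₁₁, Matrix.fromBlocks_apply₁₂,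
    Matrix.fromBlocks_apply₂₁, Matrix.fromBlocks_apply₂₂, Matrix.of_apply]
  rw [Finset.sum_eq_single j]
  · simp only [if_true]
  · intro j' _ hj
    simp [hj.symm]
  · simp

theorem limCov_posDef (k : ℕ) {z : ι → Cn m} (hz : Function.Injective z) :
    (limCov k z).PosDef := by
  classical
  refine Matrix.PosDef.of_dotProduct_mulVec_pos (limCov_isHermitian k z) fun v hv => ?_
  have him : (star v ⬝ᵥ (limCov k z *ᵥ v)).im = 0 :=
    (limCov_isHermitian k z).im_star_dotProduct_mulVec_self v
  rw [Complex.pos_iff]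
  refine ⟨?_, him.symm⟩
  rw [limCov_quadForm, Complex.re_sum]
  by_contra hneg
  have h0 := (Finset.sum_eq_zero_iff_of_nonneg
    (fun j (_ : j ∈ (Finset.univ : Finset (Fin k))) => jetQuad_re_nonneg hz _ _)).1
    (le_antisymm (not_lt.1 hneg) (Finset.sum_nonneg fun j _ => jetQuad_re_nonneg hz _ _))
  refine hv (funext fun u => ?_)
  rcases u with ⟨p, j⟩ | ⟨p, j, q⟩
  · exact (eq_zero_of_jetQuad_nonpos hz _ _ (h0 j (Finset.mem_univ j)).le p).2
  · have h1 := (eq_zero_of_jetQuad_nonpos hz _ _ (h0 j (Finset.mem_univ j)).le p).1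
    have h2 := congrArg (fun y : Cn m => y q) h1
    exact star_eq_zero.1 h2

end

/-! ### The normalised covariance matrix -/

section

variable {ι : Type} {m : ℕ}

/-- The covariance matrix of the values and covariant derivatives of the normalised
Bargmann–Fock ensemble. -/
noncomputable def normCov (k : ℕ) (z : ι → Cn m) : Matrix (JetIdx ι k m) (JetIdx ι k m) ℂ :=
  Matrix.fromBlocks
    (Matrix.of fun u w => if u.2 = w.2 then normKernel (z u.1) (z w.1) else 0)
    (Matrix.of fun u w => if u.2 = w.2.1 then
      (z u.1 - z w.1) w.2.2 * normKernel (z u.1) (z w.1) else 0)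
    (Matrix.of fun u w => if u.2.1 = w.2 then
      star ((z w.1 - z u.1) u.2.2) * normKernel (z u.1) (z w.1) else 0)
    (Matrix.of fun u w => if u.2.1 = w.2.1 then
      ((z u.1 - z w.1) w.2.2 * star ((z w.1 - z u.1) u.2.2) + (if u.2.2 = w.2.2 then 1 else 0)) *
        normKernel (z u.1) (z w.1) else 0)

/-- The normalising factor `exp(-|z|²/2)`. -/
noncomputable def expHalf (z : Cn m) : ℂ := Complex.exp (-((‖z‖ ^ 2 / 2 : ℝ) : ℂ))

theorem normKernel_eq (z w : Cn m) :
    normKernel z w = expHalf z * Complex.exp (herm z w) * expHalf w := by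
  rw [expHalf, expHalf, ← Complex.exp_add, ← Complex.exp_add, normKernel]
  congr 1; ring

variable [Fintype ι] [DecidableEq ι]

theorem mul_of_ite {α β γ : Type} [Fintype β] [DecidableEq β] (M : Matrix α β ℂ) (f : γ → β)
    (a : γ → ℂ) (i : α) (u : γ) :
    (M * Matrix.of fun w u => if w = f u then a u else 0) i u = M i (f u) * a u := by
  simp [Matrix.mul_apply]

theorem of_ite_mul {α β γ : Type} [Fintype β] [DecidableEq β] (M : Matrix β α ℂ) (f : γ → β)
    (a : γ → ℂ) (i : α) (u : γ) :
    ((Matrix.of fun u w => if w = f u then a u else 0) * M) u i = a u * M (f u) i := by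
  simp [Matrix.mul_apply]

/-- The gauge multiplies jets by `exp(-|z|²/2)` and replaces `∂_q` by `∂_q - conj z_q`. The kernel
`exp⟨z,w⟩` satisfies `∂_q = conj w_q`, so apart from `normKernel` only differences of points remain
in the entries. -/
theorem normCov_eq (k : ℕ) (z : ι → Cn m) :
    normCov k z = Matrix.fromBlocks (Matrix.diagonal fun i => expHalf (z i.1)) 0
      (Matrix.of fun u w => if w = (u.1, u.2.1) then -(expHalf (z u.1) * star (z u.1 u.2.2)) else 0)
        (Matrix.diagonal fun i => expHalf (z i.1)) * limCov k z *
      Matrix.fromBlocks (Matrix.diagonal fun i => expHalf (z i.1))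
        (Matrix.of fun w u => if w = (u.1, u.2.1) then -(expHalf (z u.1) * z u.1 u.2.2) else 0) 0
        (Matrix.diagonal fun i => expHalf (z i.1)) := by
  rw [limCov, Matrix.fromBlocks_multiply, Matrix.fromBlocks_multiply, normCov]
  simp only [Matrix.zero_mul, Matrix.mul_zero, add_zero]
  congr 1
  · ext ⟨p, j⟩ ⟨p', j'⟩
    simp only [Matrix.mul_diagonal, Matrix.diagonal_mul, Matrix.of_apply, normKernel_eq]
    split_ifs <;> ring
  · ext ⟨p, j⟩ ⟨p', j', q'⟩
    simp only [Matrix.add_apply, Matrix.mul_diagonal, mul_of_ite _ (fun u : ι × Fin k × Fin m =>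
      (u.1, u.2.1)), of_ite_mul _ (fun u : ι × Fin k × Fin m => (u.1, u.2.1)),
      Matrix.diagonal_mul, Matrix.of_apply, normKernel_eq, PiLp.sub_apply, star_sub]
    split_ifs <;> ring
  · ext ⟨p, j, q⟩ ⟨p', j'⟩
    simp only [Matrix.add_apply, Matrix.mul_diagonal, mul_of_ite _ (fun u : ι × Fin k × Fin m =>
      (u.1, u.2.1)), of_ite_mul _ (fun u : ι × Fin k × Fin m => (u.1, u.2.1)),
      Matrix.diagonal_mul, Matrix.of_apply, normKernel_eq, PiLp.sub_apply, star_sub]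
    split_ifs <;> ring
  · ext ⟨p, j, q⟩ ⟨p', j', q'⟩
    simp only [Matrix.add_apply, Matrix.mul_diagonal, mul_of_ite _ (fun u : ι × Fin k × Fin m =>
      (u.1, u.2.1)), of_ite_mul _ (fun u : ι × Fin k × Fin m => (u.1, u.2.1)),
      Matrix.diagonal_mul, Matrix.of_apply, normKernel_eq, PiLp.sub_apply, star_sub]
    split_ifs <;> ring

theorem corrForm_normCov (k : ℕ) {z : ι → Cn m} (hz : Function.Injective z)
    (Γ : ι → Matrix (Fin m) (Fin m) ℂ) :
    corrForm Γ (normCov k z) = corrForm Γ (limCov k z) := by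
  have h0 : ∀ p, expHalf (z p) ≠ 0 := fun p => Complex.exp_ne_zero _
  rw [normCov_eq, corrForm_gauge Γ (fun p => expHalf (z p)) (fun p => expHalf (z p))
    (fun p => expHalf (z p)) (fun p => expHalf (z p)) _ _ h0 h0 _
    (PosDef_toBlocks₁₁ (limCov_posDef k hz)).det_pos.ne', div_self, one_pow, one_mul]
  exact Finset.prod_ne_zero_iff.2 fun p _ => mul_ne_zero (h0 p) (h0 p)

open scoped Kronecker in
theorem det_normCov_toBlocks₁₁ (k : ℕ) (z : ι → Cn m) :
    (normCov k z).toBlocks₁₁.det = (Matrix.of fun p q => normKernel (z p) (z q)).det ^ k := by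
  have : (normCov k z).toBlocks₁₁ =
      (Matrix.of fun p q => normKernel (z p) (z q)) ⊗ₖ (1 : Matrix (Fin k) (Fin k) ℂ) := by
    ext ⟨p, j⟩ ⟨p', j'⟩
    simp [normCov, Matrix.one_apply]
  rw [this, Matrix.det_kronecker]
  simp

theorem exists_le_norm_det_normCov (ι : Type) [Fintype ι] [DecidableEq ι] (k m : ℕ) {c : ℝ}
    (hc : 0 < c) : ∃ μ : ℝ, 0 < μ ∧ ∀ z : ι → Cn m, (∀ p q, p ≠ q → c ≤ ‖z p - z q‖) →
      μ ≤ ‖(normCov k z).toBlocks₁₁.det‖ := by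
  obtain ⟨μ, hμ, h⟩ := exists_le_norm_det_normKernel (ι := ι) m hc
  refine ⟨μ ^ k, by positivity, fun z hz => ?_⟩
  rw [det_normCov_toBlocks₁₁, norm_pow]
  exact pow_le_pow_left₀ hμ.le (h z hz) k

/-- The normalised scaling limit correlation function. -/
theorem tendsto_scaledCorr_limitCorr (k : ℕ) {z : ι → Cn m} (hz : Function.Injective z) :
    Tendsto (scaledCorr k m z) atTop (𝓝 (limitCorr k m z)) ∧
    (limitCorr k m z : ℂ) = (((m - k).factorial : ℂ) / m.factorial) ^ Fintype.card ι *
      corrForm (fun _ => 1) (normCov k z) := by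
  have h := tendsto_scaledCorr k z (limCov_posDef k hz)
  rw [← corrForm_normCov k hz] at h
  set w := (((m - k).factorial : ℂ) / m.factorial) ^ Fintype.card ι *
      corrForm (fun _ => 1) (normCov k z)
  have hre : Tendsto (scaledCorr k m z) atTop (𝓝 w.re) := by
    simpa [Function.comp_def] using (Complex.continuous_re.tendsto w).comp h
  have him : Tendsto (fun _ : ℕ => (0 : ℝ)) atTop (𝓝 w.im) := by
    simpa [Function.comp_def] using (Complex.continuous_im.tendsto w).comp h
  have him0 : w.im = 0 := tendsto_nhds_unique him tendsto_const_nhds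
  have hl : limitCorr k m z = w.re := hre.limUnder_eq
  rw [hl]
  exact ⟨hre, Complex.ext rfl him0.symm⟩

end

/-! ### Entries of the normalised covariance matrix -/

section

variable {ι : Type} {k m : ℕ}

/-- The point to which a jet variable belongs. -/
def pt : JetIdx ι k m → ι := Sum.elim Prod.fst Prod.fst

theorem norm_coord_le (z : Cn m) (q : Fin m) : ‖z q‖ ≤ ‖z‖ := PiLp.norm_apply_le z q

/-- Each nonzero entry is `normKernel` times a factor of size at most `r² + r + 1`, and for `r ≥ c`
this is at most `(1 + 1/c + 1/c²) r²`. -/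
theorem norm_normCov_le {c : ℝ} (hc : 0 < c) (z : ι → Cn m) (u w : JetIdx ι k m)
    (h : c ≤ ‖z (pt u) - z (pt w)‖) :
    ‖normCov k z u w‖ ≤ (1 + c⁻¹ + (c ^ 2)⁻¹) *
      (‖z (pt u) - z (pt w)‖ ^ 2 * Real.exp (-‖z (pt u) - z (pt w)‖ ^ 2 / 2)) := by
  set r := ‖z (pt u) - z (pt w)‖ with hr
  have hr0 : 0 ≤ r := norm_nonneg _
  have h1 : 1 ≤ (c ^ 2)⁻¹ * r ^ 2 := by
    rw [← div_eq_inv_mul, one_le_div (by positivity)]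
    exact pow_le_pow_left₀ hc.le h 2
  have h2 : r ≤ c⁻¹ * r ^ 2 := by
    rw [← div_eq_inv_mul, le_div_iff₀ hc]; nlinarith
  have hc1 : 0 < c⁻¹ := inv_pos.2 hc
  have hc2 : 0 ≤ (c ^ 2)⁻¹ := by positivity
  have e : 0 ≤ Real.exp (-r ^ 2 / 2) := (Real.exp_pos _).le
  have main : ∀ x : ℂ, ‖x‖ ≤ r ^ 2 + r + 1 → ‖x * normKernel (z (pt u)) (z (pt w))‖ ≤
      (1 + c⁻¹ + (c ^ 2)⁻¹) * (r ^ 2 * Real.exp (-r ^ 2 / 2)) := by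
    intro x hx
    rw [norm_mul, norm_normKernel, ← hr, ← mul_assoc]
    refine mul_le_mul_of_nonneg_right (hx.trans ?_) e
    nlinarith
  have hz : (0 : ℝ) ≤ (1 + c⁻¹ + (c ^ 2)⁻¹) * (r ^ 2 * Real.exp (-r ^ 2 / 2)) := by positivity
  rcases u with ⟨p, j⟩ | ⟨p, j, q⟩ <;> rcases w with ⟨p', j'⟩ | ⟨p', j', q'⟩ <;>
    simp only [pt, Sum.elim_inl, Sum.elim_inr] at hr main ⊢ <;>
    simp only [normCov, Matrix.fromBlocks_apply₁₁, Matrix.fromBlocks_apply₁₂,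
      Matrix.fromBlocks_apply₂₁, Matrix.fromBlocks_apply₂₂, Matrix.of_apply] <;>
    split_ifs
  all_goals first
    | (rw [norm_zero]; exact hz)
    | skip
  · have := main 1 (by rw [norm_one]; nlinarith [sq_nonneg r])
    rwa [one_mul] at this
  · refine main _ ((norm_coord_le _ _).trans ?_)
    rw [← hr]; nlinarith [sq_nonneg r]
  · refine main _ ?_
    rw [norm_star]
    refine (norm_coord_le _ _).trans ?_
    rw [norm_sub_rev, ← hr]; nlinarith [sq_nonneg r]
  all_goals
    refine main _ ((norm_add_le _ _).trans ?_)
    have h3 : ‖(z p - z p') q' * star ((z p' - z p) q)‖ ≤ r ^ 2 := by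
      rw [norm_mul, norm_star, sq]
      have h4 := norm_coord_le (z p' - z p) q
      rw [norm_sub_rev, ← hr] at h4
      have h5 := norm_coord_le (z p - z p') q'
      rw [← hr] at h5
      exact mul_le_mul h5 h4 (norm_nonneg _) hr0
    simp only [norm_one, norm_zero]
    linarith

theorem norm_normCov_le_one (z : ι → Cn m) (u w : JetIdx ι k m) (h : pt u = pt w) :
    ‖normCov k z u w‖ ≤ 1 := by
  rcases u with ⟨p, j⟩ | ⟨p, j, q⟩ <;> rcases w with ⟨p', j'⟩ | ⟨p', j', q'⟩ <;>
    simp only [pt, Sum.elim_inl, Sum.elim_inr] at h <;> subst h <;>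
    simp only [normCov, Matrix.fromBlocks_apply₁₁, Matrix.fromBlocks_apply₁₂,
      Matrix.fromBlocks_apply₂₁, Matrix.fromBlocks_apply₂₂, Matrix.of_apply, normKernel_self,
      sub_self] <;>
    split_ifs <;> simp

end

/-! ### Factorisation of the correlation form -/

theorem integral_stdGaussian_mul {V₁ V₂ V : Type} [Fintype V₁] [Fintype V₂] [Fintype V]
    (e : V₁ ⊕ V₂ ≃ V) (f : (V₁ → ℂ) → ℂ) (h : (V₂ → ℂ) → ℂ) :
    ∫ g, f (fun i => g (e (Sum.inl i))) * h (fun i => g (e (Sum.inr i))) ∂stdGaussian V =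
      (∫ g, f g ∂stdGaussian V₁) * ∫ g, h g ∂stdGaussian V₂ := by
  rw [integral_stdGaussian, integral_stdGaussian, integral_stdGaussian,
    ← (volume_measurePreserving_piCongrLeft (fun _ => ℂ) e).integral_comp',
    ← (volume_measurePreserving_sumPiEquivProdPi_symm (fun _ : V₁ ⊕ V₂ => ℂ)).integral_comp',
    ← integral_prod_mul, ← Measure.volume_eq_prod]
  refine integral_congr_ae (ae_of_all _ fun g => ?_)
  simp only [MeasurableEquiv.coe_piCongrLeft]
  rw [← e.prod_comp, Fintype.prod_sum_type]
  simp only [Equiv.piCongrLeft_apply_apply]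
  have h1 : ∀ i, ((MeasurableEquiv.sumPiEquivProdPi fun _ : V₁ ⊕ V₂ => ℂ).symm g) (Sum.inl i) = g.1 i :=
    fun _ => rfl
  have h2 : ∀ i, ((MeasurableEquiv.sumPiEquivProdPi fun _ : V₁ ⊕ V₂ => ℂ).symm g) (Sum.inr i) = g.2 i :=
    fun _ => rfl
  simp only [h1, h2]
  ring

section

variable {ι ι₁ ι₂ : Type} [Fintype ι] [Fintype ι₁] [Fintype ι₂] [DecidableEq ι] [DecidableEq ι₁]
  [DecidableEq ι₂] {k m : ℕ}

/-- Wick's formula is bilinear in the pair `M, N`, so `N = 1` represents an arbitrary matrix `Λ`,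
not only a covariance. The factorisation over independent blocks then follows from Fubini, with no
manipulation of permanents. -/
theorem wick_eq_integral (Γ : ι → Matrix (Fin m) (Fin m) ℂ)
    (Λ : Matrix (ι × Fin k × Fin m) (ι × Fin k × Fin m) ℂ) :
    wick Γ Λ = ∫ g, gramProd Γ (Λ *ᵥ g) (star g) ∂stdGaussian (ι × Fin k × Fin m) := by
  have h := integral_gramProd Γ Λ 1
  simp only [Matrix.one_mulVec, Matrix.transpose_one, Matrix.mul_one] at h
  exact h.symm

/-- The product with `F` of an equivalence splitting a type into two parts. -/
def splitProd (e : ι₁ ⊕ ι₂ ≃ ι) (F : Type) : (ι₁ × F) ⊕ (ι₂ × F) ≃ ι × F :=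
  (Equiv.sumProdDistrib ι₁ ι₂ F).symm.trans (e.prodCongr (Equiv.refl F))

theorem wick_split (e : ι₁ ⊕ ι₂ ≃ ι)
    (Λ : Matrix (ι × Fin k × Fin m) (ι × Fin k × Fin m) ℂ)
    (Λ₁ : Matrix (ι₁ × Fin k × Fin m) (ι₁ × Fin k × Fin m) ℂ)
    (Λ₂ : Matrix (ι₂ × Fin k × Fin m) (ι₂ × Fin k × Fin m) ℂ)
    (h : Λ.submatrix (splitProd e _) (splitProd e _) = Matrix.fromBlocks Λ₁ 0 0 Λ₂) :
    wick (fun _ => 1) Λ = wick (fun _ => 1) Λ₁ * wick (fun _ => 1) Λ₂ := by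
  simp only [wick_eq_integral]
  rw [← integral_stdGaussian_mul (splitProd e (Fin k × Fin m))]
  refine integral_congr_ae (ae_of_all _ fun g => ?_)
  set g₁ : ι₁ × Fin k × Fin m → ℂ := fun i => g (splitProd e (Fin k × Fin m) (Sum.inl i)) with hg₁
  set g₂ : ι₂ × Fin k × Fin m → ℂ := fun i => g (splitProd e (Fin k × Fin m) (Sum.inr i)) with hg₂
  have hg : g ∘ splitProd e (Fin k × Fin m) = Sum.elim g₁ g₂ := by
    ext (i | i) <;> rfl
  have hm : ∀ i, (Λ *ᵥ g) (splitProd e (Fin k × Fin m) i) = Sum.elim (Λ₁ *ᵥ g₁) (Λ₂ *ᵥ g₂) i := by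
    intro i
    have h1 := congrFun (Matrix.submatrix_mulVec_equiv Λ (Sum.elim g₁ g₂) (splitProd e (Fin k × Fin m))
      (splitProd e (Fin k × Fin m))) i
    rw [h, Matrix.fromBlocks_mulVec] at h1
    have h2 : Sum.elim g₁ g₂ ∘ (splitProd e (Fin k × Fin m)).symm = g := by
      rw [← hg, Function.comp_assoc, Equiv.self_comp_symm, Function.comp_id]
    rw [h2] at h1
    simp only [Matrix.zero_mulVec, add_zero, zero_add, Sum.elim_comp_inl, Sum.elim_comp_inr] at h1
    exact h1.symm
  have hb1 : ∀ p, block (Λ *ᵥ g) (e (Sum.inl p)) = block (Λ₁ *ᵥ g₁) p := fun p => by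
    ext j q; exact hm (Sum.inl (p, j, q))
  have hb2 : ∀ p, block (Λ *ᵥ g) (e (Sum.inr p)) = block (Λ₂ *ᵥ g₂) p := fun p => by
    ext j q; exact hm (Sum.inr (p, j, q))
  simp only [gramProd]
  rw [← e.prod_comp, Fintype.prod_sum_type]
  simp only [hb1, hb2]
  rfl

/-- The map of jet indices induced by a map of points. -/
def jetMap (k m : ℕ) {ι' : Type} (f : ι' → ι) : JetIdx ι' k m → JetIdx ι k m :=
  Sum.map (Prod.map f id) (Prod.map f id)

theorem corrForm_split (e : ι₁ ⊕ ι₂ ≃ ι) (X : Matrix (JetIdx ι k m) (JetIdx ι k m) ℂ)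
    (h₁₂ : ∀ u w, X (jetMap k m (fun i => e (Sum.inl i)) u) (jetMap k m (fun i => e (Sum.inr i)) w) = 0)
    (h₂₁ : ∀ u w, X (jetMap k m (fun i => e (Sum.inr i)) u) (jetMap k m (fun i => e (Sum.inl i)) w) = 0)
    (X₁ : Matrix (JetIdx ι₁ k m) (JetIdx ι₁ k m) ℂ)
    (hX₁ : X₁ = X.submatrix (jetMap k m fun i => e (Sum.inl i)) (jetMap k m fun i => e (Sum.inl i)))
    (X₂ : Matrix (JetIdx ι₂ k m) (JetIdx ι₂ k m) ℂ)
    (hX₂ : X₂ = X.submatrix (jetMap k m fun i => e (Sum.inr i)) (jetMap k m fun i => e (Sum.inr i)))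
    (hd₁ : X₁.toBlocks₁₁.det ≠ 0) (hd₂ : X₂.toBlocks₁₁.det ≠ 0) :
    corrForm (fun _ => 1) X = corrForm (fun _ => 1) X₁ * corrForm (fun _ => 1) X₂ := by
  have hA : X.toBlocks₁₁.submatrix (splitProd e _) (splitProd e _) =
      Matrix.fromBlocks X₁.toBlocks₁₁ 0 0 X₂.toBlocks₁₁ := by
    rw [hX₁, hX₂]
    ext (i | i) (j | j)
    · rfl
    · exact h₁₂ (Sum.inl i) (Sum.inl j)
    · exact h₂₁ (Sum.inl i) (Sum.inl j)
    · rfl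
  have hB : X.toBlocks₁₂.submatrix (splitProd e _) (splitProd e _) =
      Matrix.fromBlocks X₁.toBlocks₁₂ 0 0 X₂.toBlocks₁₂ := by
    rw [hX₁, hX₂]
    ext (i | i) (j | j)
    · rfl
    · exact h₁₂ (Sum.inl i) (Sum.inr j)
    · exact h₂₁ (Sum.inl i) (Sum.inr j)
    · rfl
  have hB' : X.toBlocks₂₁.submatrix (splitProd e _) (splitProd e _) =
      Matrix.fromBlocks X₁.toBlocks₂₁ 0 0 X₂.toBlocks₂₁ := by
    rw [hX₁, hX₂]
    ext (i | i) (j | j)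
    · rfl
    · exact h₁₂ (Sum.inr i) (Sum.inl j)
    · exact h₂₁ (Sum.inr i) (Sum.inl j)
    · rfl
  have hC : X.toBlocks₂₂.submatrix (splitProd e _) (splitProd e _) =
      Matrix.fromBlocks X₁.toBlocks₂₂ 0 0 X₂.toBlocks₂₂ := by
    rw [hX₁, hX₂]
    ext (i | i) (j | j)
    · rfl
    · exact h₁₂ (Sum.inr i) (Sum.inr j)
    · exact h₂₁ (Sum.inr i) (Sum.inr j)
    · rfl
  have hdet : X.toBlocks₁₁.det = X₁.toBlocks₁₁.det * X₂.toBlocks₁₁.det := by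
    rw [← Matrix.det_submatrix_equiv_self (splitProd e (Fin k)) X.toBlocks₁₁, hA,
      Matrix.det_fromBlocks_zero₂₁]
  have hinv : X.toBlocks₁₁⁻¹.submatrix (splitProd e _) (splitProd e _) =
      Matrix.fromBlocks X₁.toBlocks₁₁⁻¹ 0 0 X₂.toBlocks₁₁⁻¹ := by
    rw [← Matrix.inv_submatrix_equiv, hA]
    refine Matrix.inv_eq_right_inv ?_
    rw [Matrix.fromBlocks_multiply, Matrix.mul_nonsing_inv _ (isUnit_iff_ne_zero.2 hd₁),
      Matrix.mul_nonsing_inv _ (isUnit_iff_ne_zero.2 hd₂)]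
    simp
  have hS : (schur X).submatrix (splitProd e _) (splitProd e _) =
      Matrix.fromBlocks (schur X₁) 0 0 (schur X₂) := by
    rw [schur, Matrix.submatrix_sub, Pi.sub_apply, Pi.sub_apply,
      ← Matrix.submatrix_mul_equiv _ _ _ (splitProd e (Fin k)) _,
      ← Matrix.submatrix_mul_equiv _ _ _ (splitProd e (Fin k)) _, hB, hB', hC, hinv,
      Matrix.fromBlocks_multiply, Matrix.fromBlocks_multiply]
    ext (i | i) (j | j) <;> simp [schur]
  rw [corrForm, wick_split e _ _ _ hS, hdet, corrForm, corrForm, mul_inv]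
  ring

theorem corrForm_of_isEmpty [IsEmpty ι] (X : Matrix (JetIdx ι k m) (JetIdx ι k m) ℂ) :
    corrForm (fun _ => 1) X = 1 := by
  rw [corrForm, Matrix.det_isEmpty, wick]
  simp [Matrix.permanent]

end

/-! ### The correlation form of a subset of the points -/

section

variable {n k m : ℕ}

/-- The restriction of a covariance matrix to the points of `S`. -/
def restr (S : Finset (Fin n)) (X : Matrix (JetIdx (Fin n) k m) (JetIdx (Fin n) k m) ℂ) :
    Matrix (JetIdx {x // x ∈ S} k m) (JetIdx {x // x ∈ S} k m) ℂ :=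
  X.submatrix (jetMap k m Subtype.val) (jetMap k m Subtype.val)

/-- The correlation form of the points of `S`, normalised by a factor `κ` for each point. -/
noncomputable def subForm (κ : ℂ) (X : Matrix (JetIdx (Fin n) k m) (JetIdx (Fin n) k m) ℂ)
    (S : Finset (Fin n)) : ℂ :=
  κ ^ S.card * corrForm (fun _ => 1) (restr S X)

theorem subForm_empty (κ : ℂ) (X : Matrix (JetIdx (Fin n) k m) (JetIdx (Fin n) k m) ℂ) :
    subForm κ X ∅ = 1 := by
  have : IsEmpty {x : Fin n // x ∈ (∅ : Finset (Fin n))} := ⟨fun x => Finset.notMem_empty _ x.2⟩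
  rw [subForm, corrForm_of_isEmpty]
  simp

/-- The splitting of `B` into its parts inside and outside `S`. -/
def splitInter (B S : Finset (Fin n)) :
    {x // x ∈ B ∩ S} ⊕ {x // x ∈ B \ S} ≃ {x // x ∈ B} where
  toFun := Sum.elim (fun x => ⟨x.1, (Finset.mem_inter.1 x.2).1⟩)
    (fun x => ⟨x.1, (Finset.mem_sdiff.1 x.2).1⟩)
  invFun x := if h : x.1 ∈ S then Sum.inl ⟨x.1, Finset.mem_inter.2 ⟨x.2, h⟩⟩
    else Sum.inr ⟨x.1, Finset.mem_sdiff.2 ⟨x.2, h⟩⟩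
  left_inv x := by
    rcases x with ⟨x, hx⟩ | ⟨x, hx⟩
    · simp [(Finset.mem_inter.1 hx).2]
    · simp [(Finset.mem_sdiff.1 hx).2]
  right_inv x := by
    by_cases h : x.1 ∈ S <;> simp [h]

theorem pt_jetMap {ι ι' : Type} (f : ι' → ι) (u : JetIdx ι' k m) :
    pt (jetMap k m f u) = f (pt u) := by
  rcases u with u | u <;> rfl

theorem subForm_split (κ : ℂ) (X : Matrix (JetIdx (Fin n) k m) (JetIdx (Fin n) k m) ℂ)
    (S : Finset (Fin n)) (hX : ∀ u w, ¬(pt u ∈ S ↔ pt w ∈ S) → X u w = 0)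
    (hd : ∀ B, (restr B X).toBlocks₁₁.det ≠ 0) (B : Finset (Fin n)) :
    subForm κ X B = subForm κ X (B ∩ S) * subForm κ X (B \ S) := by
  have h := corrForm_split (splitInter B S) (restr B X) (fun u w => ?_) (fun u w => ?_)
    (restr (B ∩ S) X) ?_ (restr (B \ S) X) ?_ (hd _) (hd _)
  · rw [subForm, subForm, subForm, h, ← Finset.card_inter_add_card_sdiff B S, pow_add]
    ring
  · refine hX _ _ ?_
    simp only [pt_jetMap]
    have h1 := (Finset.mem_inter.1 (pt u).2).2
    have h2 := (Finset.mem_sdiff.1 (pt w).2).2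
    exact fun h => h2 (h.1 h1)
  · refine hX _ _ ?_
    simp only [pt_jetMap]
    have h1 := (Finset.mem_inter.1 (pt w).2).2
    have h2 := (Finset.mem_sdiff.1 (pt u).2).2
    exact fun h => h2 (h.2 h1)
  · ext u w
    rcases u with u | u <;> rcases w with w | w <;> rfl
  · ext u w
    rcases u with u | u <;> rcases w with w | w <;> rfl

/-- Conjugation of a covariance matrix by the torus of phases of the points. -/
noncomputable def torusConj (t : Fin n → ℂ) (X : Matrix (JetIdx (Fin n) k m) (JetIdx (Fin n) k m) ℂ) :
    Matrix (JetIdx (Fin n) k m) (JetIdx (Fin n) k m) ℂ :=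
  Matrix.of fun u w => t (pt u) * X u w * (t (pt w))⁻¹

theorem restr_torusConj (t : Fin n → ℂ) (X : Matrix (JetIdx (Fin n) k m) (JetIdx (Fin n) k m) ℂ)
    (S : Finset (Fin n)) :
    restr S (torusConj t X) = Matrix.fromBlocks (Matrix.diagonal fun i => t i.1) 0 0
        (Matrix.diagonal fun i => t i.1) * restr S X *
      Matrix.fromBlocks (Matrix.diagonal fun i => (t i.1)⁻¹) 0 0
        (Matrix.diagonal fun i => (t i.1)⁻¹) := by
  simp only [← Matrix.diagonal_zero', Matrix.fromBlocks_diagonal]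
  ext u w
  rw [Matrix.mul_diagonal, Matrix.diagonal_mul]
  rcases u with u | u <;> rcases w with w | w <;> rfl

theorem det_restr_torusConj {t : Fin n → ℂ} (ht : ∀ p, t p ≠ 0)
    (X : Matrix (JetIdx (Fin n) k m) (JetIdx (Fin n) k m) ℂ) (S : Finset (Fin n)) :
    (restr S (torusConj t X)).toBlocks₁₁.det = (restr S X).toBlocks₁₁.det := by
  rw [restr_torusConj, det_toBlocks₁₁_gauge, Matrix.det_mul, Matrix.det_mul, Matrix.det_diagonal,
    Matrix.det_diagonal, Finset.prod_inv_distrib]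
  have : ∏ i : {x // x ∈ S} × Fin k, t i.1 ≠ 0 := Finset.prod_ne_zero_iff.2 fun i _ => ht _
  field_simp

theorem subForm_torusConj (κ : ℂ) {t : Fin n → ℂ} (ht : ∀ p, t p ≠ 0)
    (X : Matrix (JetIdx (Fin n) k m) (JetIdx (Fin n) k m) ℂ) (S : Finset (Fin n))
    (hd : (restr S X).toBlocks₁₁.det ≠ 0) :
    subForm κ (torusConj t X) S = subForm κ X S := by
  rw [subForm, restr_torusConj, corrForm_gauge (fun _ => 1) (fun p : {x // x ∈ S} => t p)
    (fun p => (t p)⁻¹) (fun p => t p) (fun p => (t p)⁻¹) _ _ (fun p => ht p)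
    (fun p => inv_ne_zero (ht p)) _ hd, div_self, one_pow, one_mul, subForm]
  exact Finset.prod_ne_zero_iff.2 fun p _ => mul_ne_zero (ht p) (inv_ne_zero (ht p))

end

/-! ### Vanishing of cumulants of a multiplicative set function -/

section

variable {α : Type} [Fintype α] [DecidableEq α]

/-- The partition of `α` into the colour classes of a colouring. -/
noncomputable def colorPartition {x : ℕ} (f : α → Fin x) :
    Finpartition (Finset.univ : Finset α) :=
  letI : DecidableRel (Setoid.ker f).r := Classical.decRel _
  Finpartition.ofSetoid (Setoid.ker f)

theorem mem_part_colorPartition {x : ℕ} (f : α → Fin x) (a b : α) :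
    b ∈ (colorPartition f).part a ↔ f a = f b := by
  let : DecidableRel (Setoid.ker f).r := Classical.decRel _
  exact Finpartition.mem_part_ofSetoid_iff_rel (s := Setoid.ker f)

theorem colorPartition_part {x : ℕ} (f : α → Fin x) (a : α) :
    (colorPartition f).part a = Finset.univ.filter fun b => f b = f a := by
  ext b
  rw [mem_part_colorPartition, Finset.mem_filter, eq_comm]
  simp

theorem finpartition_eq_of_part_eq {s : Finset α} {P Q : Finpartition s}
    (h : ∀ a ∈ s, P.part a = Q.part a) : P = Q := by
  have key : ∀ {P Q : Finpartition s}, (∀ a ∈ s, P.part a = Q.part a) → P.parts ⊆ Q.parts := by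
    intro P Q h B hB
    obtain ⟨a, ha⟩ := P.nonempty_of_mem_parts hB
    have has := P.subset hB ha
    rw [← P.part_eq_of_mem hB ha, h a has]
    exact Q.part_mem.2 has
  exact Finpartition.ext (Finset.Subset.antisymm (key h) (key fun a ha => (h a ha).symm))

/-- Colourings with a given partition into colour classes are injective colourings of the
classes. -/
noncomputable def coloringEquiv (x : ℕ) (G : Finpartition (Finset.univ : Finset α)) :
    {f : α → Fin x // colorPartition f = G} ≃ ({B // B ∈ G.parts} ↪ Fin x) where
  toFun f := ⟨fun B => f.1 (G.nonempty_of_mem_parts B.2).choose, fun B B' h => by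
    have h1 := (G.nonempty_of_mem_parts B.2).choose_spec
    have h2 := (G.nonempty_of_mem_parts B'.2).choose_spec
    have h3 := (mem_part_colorPartition f.1 _ _).2 h
    rw [f.2, G.part_eq_of_mem B.2 h1] at h3
    exact Subtype.ext (G.eq_of_mem_parts B.2 B'.2 h3 h2)⟩
  invFun φ := ⟨fun a => φ ⟨G.part a, G.part_mem.2 (Finset.mem_univ a)⟩, by
    refine finpartition_eq_of_part_eq fun a _ => ?_
    ext b
    rw [mem_part_colorPartition, φ.injective.eq_iff, Subtype.mk.injEq,
      ← G.mem_part_iff_part_eq_part (Finset.mem_univ a) (Finset.mem_univ b),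
      G.mem_part_iff_part_eq_part (Finset.mem_univ a) (Finset.mem_univ b),
      G.mem_part_iff_part_eq_part (Finset.mem_univ b) (Finset.mem_univ a), eq_comm]⟩
  left_inv f := by
    refine Subtype.ext (funext fun a => ?_)
    have h := (G.nonempty_of_mem_parts (G.part_mem.2 (Finset.mem_univ a))).choose_spec
    have h' : f.1 a = f.1 _ := (mem_part_colorPartition f.1 a _).1 (by rw [f.2]; exact h)
    exact h'.symm
  right_inv φ := by
    ext B
    have h := (G.nonempty_of_mem_parts B.2).choose_spec
    have h' : (⟨G.part (G.nonempty_of_mem_parts B.2).choose, G.part_mem.2 (Finset.mem_univ _)⟩ :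
        {B // B ∈ G.parts}) = B := Subtype.ext (G.part_eq_of_mem B.2 h)
    exact congrArg (fun B => (φ B : ℕ)) h'

/-- The sum over colourings with `x` colours of the product of a set function over the colour
classes. -/
noncomputable def coloringSum (K : Finset α → ℂ) (x : ℕ) : ℂ :=
  ∑ f : α → Fin x, ∏ c, K (Finset.univ.filter fun a => f a = c)

theorem prod_colorClass {K : Finset α → ℂ} (hK : K ∅ = 1) {x : ℕ} (f : α → Fin x) :
    ∏ c, K (Finset.univ.filter fun a => f a = c) = ∏ B ∈ (colorPartition f).parts, K B := by
  have hp : (colorPartition f).parts =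
      (Finset.univ.image f).image fun c => Finset.univ.filter fun a => f a = c := by
    ext B
    simp only [Finset.mem_image, Finset.mem_univ, true_and, exists_exists_eq_and]
    constructor
    · intro hB
      obtain ⟨a, ha⟩ := (colorPartition f).nonempty_of_mem_parts hB
      exact ⟨a, by rw [← colorPartition_part, (colorPartition f).part_eq_of_mem hB ha]⟩
    · rintro ⟨a, rfl⟩
      rw [← colorPartition_part]
      exact (colorPartition f).part_mem.2 (Finset.mem_univ a)
  rw [hp, Finset.prod_image]
  · symm
    refine Finset.prod_subset (Finset.subset_univ _) fun c _ hc => ?_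
    rw [Finset.filter_eq_empty_iff.2, hK]
    exact fun a _ h => hc (Finset.mem_image.2 ⟨a, Finset.mem_univ a, h⟩)
  · intro c hc c' _ h
    obtain ⟨a, _, rfl⟩ := Finset.mem_image.1 hc
    have : a ∈ Finset.univ.filter fun b => f b = f a := by simp
    exact (Finset.mem_filter.1 ((Finset.ext_iff.1 h a).1 this)).2

/-- Group colourings by their partition: a partition with `l` parts arises from `x(x-1)⋯(x-l+1)` of
them, and `K ∅ = 1` makes unused colours harmless. -/
theorem coloringSum_eq {K : Finset α → ℂ} (hK : K ∅ = 1) (x : ℕ) :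
    coloringSum K x = ∑ G : Finpartition (Finset.univ : Finset α),
      (x.descFactorial G.parts.card : ℂ) * ∏ B ∈ G.parts, K B := by
  classical
  simp only [coloringSum, prod_colorClass hK]
  rw [← Finset.sum_fiberwise Finset.univ (fun f => colorPartition f)]
  refine Finset.sum_congr rfl fun G _ => ?_
  rw [Finset.sum_congr rfl (g := fun _ => ∏ B ∈ G.parts, K B)
    (fun f hf => by rw [(Finset.mem_filter.1 hf).2]), Finset.sum_const, nsmul_eq_mul]
  congr 2
  rw [← Fintype.card_subtype, Fintype.card_congr (coloringEquiv x G), Fintype.card_embedding_eq]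
  simp

/-- The polynomial interpolating `coloringSum`. -/
noncomputable def coloringPoly (K : Finset α → ℂ) : Polynomial ℂ :=
  ∑ G : Finpartition (Finset.univ : Finset α),
    Polynomial.C (∏ B ∈ G.parts, K B) * descPochhammer ℂ G.parts.card

theorem eval_coloringPoly {K : Finset α → ℂ} (hK : K ∅ = 1) (x : ℕ) :
    (coloringPoly K).eval (x : ℂ) = coloringSum K x := by
  rw [coloringSum_eq hK, coloringPoly, Polynomial.eval_finsetSum]
  refine Finset.sum_congr rfl fun G _ => ?_
  rw [Polynomial.eval_mul, Polynomial.eval_C, descPochhammer_eval_eq_descFactorial, mul_comm]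

theorem coeff_one_descPochhammer_succ (l : ℕ) :
    (descPochhammer ℂ (l + 1)).coeff 1 = (-1) ^ l * (l.factorial : ℂ) := by
  rw [descPochhammer_succ_left, Polynomial.coeff_X_mul, Polynomial.coeff_zero_eq_eval_zero,
    Polynomial.eval_comp, descPochhammer_eval_eq_prod_range, ← Finset.prod_range_add_one_eq_factorial]
  push_cast
  have h : (-1 : ℂ) ^ l = ∏ _i ∈ Finset.range l, (-1 : ℂ) := by simp
  rw [h, ← Finset.prod_mul_distrib]
  refine Finset.prod_congr rfl fun i _ => ?_
  simp
  ring

theorem parts_card_ne_zero [Nonempty α] (G : Finpartition (Finset.univ : Finset α)) :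
    G.parts.card ≠ 0 :=
  Finset.card_ne_zero.2 (G.parts_nonempty Finset.univ_nonempty.ne_empty)

theorem coeff_zero_coloringPoly [Nonempty α] (K : Finset α → ℂ) :
    (coloringPoly K).coeff 0 = 0 := by
  rw [coloringPoly, Polynomial.finsetSum_coeff]
  refine Finset.sum_eq_zero fun G _ => ?_
  rw [Polynomial.coeff_C_mul, Polynomial.coeff_zero_eq_eval_zero,
    descPochhammer_ne_zero_eval_zero ℂ (parts_card_ne_zero G), mul_zero]

/-- The top joint cumulant of a set function. -/
noncomputable def cumulant (K : Finset α → ℂ) : ℂ :=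
  ∑ G : Finpartition (Finset.univ : Finset α),
    (-1 : ℂ) ^ (G.parts.card + 1) * ((G.parts.card - 1).factorial : ℂ) * ∏ B ∈ G.parts, K B

theorem coeff_one_coloringPoly [Nonempty α] (K : Finset α → ℂ) :
    (coloringPoly K).coeff 1 = cumulant K := by
  rw [coloringPoly, Polynomial.finsetSum_coeff, cumulant]
  refine Finset.sum_congr rfl fun G _ => ?_
  obtain ⟨l, hl⟩ := Nat.exists_eq_succ_of_ne_zero (parts_card_ne_zero G)
  rw [Polynomial.coeff_C_mul, hl, Nat.succ_eq_add_one, coeff_one_descPochhammer_succ,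
    Nat.add_sub_cancel, add_assoc, pow_add]
  norm_num
  ring

theorem coloringSum_split {K : Finset α → ℂ} (S : Finset α)
    (h : ∀ B, K B = K (B ∩ S) * K (B \ S)) (x : ℕ) :
    coloringSum K x =
      coloringSum (fun B : Finset {a // a ∈ S} => K (B.map (Function.Embedding.subtype _))) x *
      coloringSum (fun B : Finset {a // a ∉ S} => K (B.map (Function.Embedding.subtype _))) x := by
  rw [coloringSum, coloringSum, coloringSum, Finset.sum_mul_sum, ← Finset.sum_product',
    Finset.univ_product_univ,
    ← (Equiv.piEquivPiSubtypeProd (fun a => a ∈ S) fun _ => Fin x).sum_comp]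
  refine Finset.sum_congr rfl fun f _ => ?_
  rw [← Finset.prod_mul_distrib]
  refine Finset.prod_congr rfl fun c _ => ?_
  rw [h]
  congr 2 <;> · ext a; simp [and_comm]

/-- The linear coefficient of `x(x-1)⋯(x-l+1)` is `(-1)^(l-1) (l-1)!`, so the cumulant is the linear
coefficient of the colouring polynomial. A multiplicative `K` makes this polynomial a product of two
factors; both vanish at 0, since `S` and its complement are nonempty, so the product has no linear
term. -/
theorem cumulant_eq_zero_of_split {K : Finset α → ℂ} (hK : K ∅ = 1) {S : Finset α}
    (h₁ : S.Nonempty) (h₂ : S ≠ Finset.univ) (h : ∀ B, K B = K (B ∩ S) * K (B \ S)) :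
    cumulant K = 0 := by
  obtain ⟨a, ha⟩ := h₁
  obtain ⟨b, hb⟩ : ∃ b, b ∉ S := by
    by_contra hc
    push Not at hc
    exact h₂ (Finset.eq_univ_of_forall hc)
  have : Nonempty α := ⟨a⟩
  have : Nonempty {a // a ∈ S} := ⟨⟨a, ha⟩⟩
  have : Nonempty {a // a ∉ S} := ⟨⟨b, hb⟩⟩
  have hpoly : coloringPoly K =
      coloringPoly (fun B : Finset {a // a ∈ S} => K (B.map (Function.Embedding.subtype _))) *
      coloringPoly (fun B : Finset {a // a ∉ S} => K (B.map (Function.Embedding.subtype _))) := by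
    refine Polynomial.eq_of_infinite_eval_eq _ _ (Set.Infinite.mono ?_
      (Set.infinite_range_of_injective (Nat.cast_injective (R := ℂ))))
    rintro _ ⟨x, rfl⟩
    rw [Set.mem_ofPred_eq, Polynomial.eval_mul, eval_coloringPoly hK, eval_coloringPoly (by simpa using hK),
      eval_coloringPoly (by simpa using hK), coloringSum_split S h]
  rw [← coeff_one_coloringPoly, hpoly, Polynomial.mul_coeff_one]
  simp [coeff_zero_coloringPoly]

end

/-! ### Rational functions with a given denominator -/

section

variable {σ : Type}

/-- The function `f` agrees with a polynomial divided by a power of `δ` where `δ` does not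
vanish. -/
def IsRatFun (δ : MvPolynomial σ ℂ) (f : (σ → ℂ) → ℂ) : Prop :=
  ∃ (P : MvPolynomial σ ℂ) (M : ℕ), ∀ x, MvPolynomial.eval x δ ≠ 0 →
    MvPolynomial.eval x P = MvPolynomial.eval x δ ^ M * f x

namespace IsRatFun

variable {δ : MvPolynomial σ ℂ} {f g : (σ → ℂ) → ℂ}

theorem eval (P : MvPolynomial σ ℂ) : IsRatFun δ fun x => MvPolynomial.eval x P :=
  ⟨P, 0, fun x _ => by simp⟩

theorem const (a : ℂ) : IsRatFun δ fun _ => a := by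
  simpa using eval (δ := δ) (MvPolynomial.C a)

theorem coord (e : σ) : IsRatFun δ fun x => x e := by
  simpa using eval (δ := δ) (MvPolynomial.X e)

theorem inv_eval {Q : MvPolynomial σ ℂ} (hQ : Q ∣ δ) :
    IsRatFun δ fun x => (MvPolynomial.eval x Q)⁻¹ := by
  obtain ⟨R, rfl⟩ := hQ
  refine ⟨R, 1, fun x hx => ?_⟩
  rw [map_mul] at hx ⊢
  have := left_ne_zero_of_mul hx
  field_simp

theorem add (hf : IsRatFun δ f) (hg : IsRatFun δ g) : IsRatFun δ fun x => f x + g x := by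
  obtain ⟨P, M, hP⟩ := hf
  obtain ⟨Q, L, hQ⟩ := hg
  refine ⟨δ ^ L * P + δ ^ M * Q, M + L, fun x hx => ?_⟩
  simp only [map_add, map_mul, map_pow, hP x hx, hQ x hx]
  ring

theorem mul (hf : IsRatFun δ f) (hg : IsRatFun δ g) : IsRatFun δ fun x => f x * g x := by
  obtain ⟨P, M, hP⟩ := hf
  obtain ⟨Q, L, hQ⟩ := hg
  refine ⟨P * Q, M + L, fun x hx => ?_⟩
  simp only [map_mul, hP x hx, hQ x hx]
  ring

theorem sub (hf : IsRatFun δ f) (hg : IsRatFun δ g) : IsRatFun δ fun x => f x - g x := by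
  simpa [sub_eq_add_neg] using hf.add ((const (-1)).mul hg)

theorem sum {ι : Type*} (s : Finset ι) {F : ι → (σ → ℂ) → ℂ} (h : ∀ i ∈ s, IsRatFun δ (F i)) :
    IsRatFun δ fun x => ∑ i ∈ s, F i x := by
  classical
  induction s using Finset.induction_on with
  | empty => simpa using const 0
  | insert i s hi ih =>
    simp only [Finset.sum_insert hi]
    exact (h i (Finset.mem_insert_self i s)).add
      (ih fun j hj => h j (Finset.mem_insert_of_mem hj))

theorem prod {ι : Type*} (s : Finset ι) {F : ι → (σ → ℂ) → ℂ} (h : ∀ i ∈ s, IsRatFun δ (F i)) :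
    IsRatFun δ fun x => ∏ i ∈ s, F i x := by
  classical
  induction s using Finset.induction_on with
  | empty => simpa using const 1
  | insert i s hi ih =>
    simp only [Finset.prod_insert hi]
    exact (h i (Finset.mem_insert_self i s)).mul
      (ih fun j hj => h j (Finset.mem_insert_of_mem hj))

theorem det {I : Type} [Fintype I] [DecidableEq I] {A : (σ → ℂ) → Matrix I I ℂ}
    (h : ∀ i j, IsRatFun δ fun x => A x i j) : IsRatFun δ fun x => (A x).det := by
  simp only [Matrix.det_apply']
  exact sum _ fun s _ => (const _).mul (prod _ fun i _ => h _ _)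

theorem permanent {I : Type} [Fintype I] [DecidableEq I] {A : (σ → ℂ) → Matrix I I ℂ}
    (h : ∀ i j, IsRatFun δ fun x => A x i j) : IsRatFun δ fun x => (A x).permanent := by
  simp only [Matrix.permanent]
  exact sum _ fun s _ => prod _ fun i _ => h _ _

theorem matrix_mul {I J L : Type} [Fintype J] {A : (σ → ℂ) → Matrix I J ℂ}
    {B : (σ → ℂ) → Matrix J L ℂ} (hA : ∀ i j, IsRatFun δ fun x => A x i j)
    (hB : ∀ i j, IsRatFun δ fun x => B x i j) (i : I) (j : L) :
    IsRatFun δ fun x => (A x * B x) i j := by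
  simp only [Matrix.mul_apply]
  exact sum _ fun s _ => (hA _ _).mul (hB _ _)

theorem matrix_inv {I : Type} [Fintype I] [DecidableEq I] {A : (σ → ℂ) → Matrix I I ℂ}
    (hA : ∀ i j, IsRatFun δ fun x => A x i j) (hd : IsRatFun δ fun x => (A x).det⁻¹) (i j : I) :
    IsRatFun δ fun x => (A x)⁻¹ i j := by
  simp only [Matrix.inv_def, Ring.inverse_eq_inv', Matrix.smul_apply, smul_eq_mul,
    Matrix.adjugate_apply]
  refine hd.mul (det fun a b => ?_)
  by_cases h : a = j
  · subst h
    simpa using const _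
  · simpa [Matrix.updateRow_ne h] using hA a b

theorem wick {ι : Type} [Fintype ι] [DecidableEq ι] {k m : ℕ}
    (Γ : ι → Matrix (Fin m) (Fin m) ℂ)
    {Λ : (σ → ℂ) → Matrix (ι × Fin k × Fin m) (ι × Fin k × Fin m) ℂ}
    (h : ∀ i j, IsRatFun δ fun x => Λ x i j) : IsRatFun δ fun x => wick Γ (Λ x) := by
  simp only [RandomZeros.wick]
  exact sum _ fun s _ => sum _ fun q _ => (const _).mul (permanent fun i j => h _ _)

theorem corrForm {ι : Type} [Fintype ι] [DecidableEq ι] {k m : ℕ}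
    (Γ : ι → Matrix (Fin m) (Fin m) ℂ)
    {X : (σ → ℂ) → Matrix (JetIdx ι k m) (JetIdx ι k m) ℂ}
    (h : ∀ i j, IsRatFun δ fun x => X x i j)
    (hd : IsRatFun δ fun x => (X x).toBlocks₁₁.det⁻¹) :
    IsRatFun δ fun x => corrForm Γ (X x) := by
  refine hd.mul (wick Γ fun i j => ?_)
  simp only [schur, Matrix.sub_apply]
  exact (h (Sum.inr i) (Sum.inr j)).sub (matrix_mul (matrix_mul (fun a b => h (Sum.inr a) (Sum.inl b))
    (matrix_inv (fun a b => h (Sum.inl a) (Sum.inl b)) hd)) (fun a b => h (Sum.inl a) (Sum.inr b)) i j)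

end IsRatFun

/-! ### Rescaling the variables of a polynomial -/

/-- The substitution `x_e ↦ c_e x_e`. -/
noncomputable def rescaleVars (c : σ → ℂ) : MvPolynomial σ ℂ →ₐ[ℂ] MvPolynomial σ ℂ :=
  MvPolynomial.aeval fun e => MvPolynomial.C (c e) * MvPolynomial.X e

theorem eval_rescaleVars (c x : σ → ℂ) (P : MvPolynomial σ ℂ) :
    MvPolynomial.eval x (rescaleVars c P) = MvPolynomial.eval (fun e => c e * x e) P := by
  induction P using MvPolynomial.induction_on with
  | C a => simp [rescaleVars]
  | add p q hp hq => rw [map_add, map_add, hp, hq, map_add]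
  | mul_X p e hp =>
    rw [map_mul, map_mul, hp, map_mul]
    simp [rescaleVars]

theorem coeff_rescaleVars (c : σ → ℂ) (P : MvPolynomial σ ℂ) (α : σ →₀ ℕ) :
    (rescaleVars c P).coeff α = P.coeff α * ∏ e ∈ α.support, c e ^ α e := by
  classical
  induction P using MvPolynomial.induction_on' with
  | monomial β a =>
    have h : rescaleVars c (MvPolynomial.monomial β a) =
        MvPolynomial.monomial β (a * ∏ e ∈ β.support, c e ^ β e) := by
      rw [rescaleVars, MvPolynomial.aeval_monomial, MvPolynomial.monomial_eq, Finsupp.prod,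
        Finsupp.prod]
      simp only [mul_pow, Finset.prod_mul_distrib, map_mul, map_prod, map_pow,
        MvPolynomial.algebraMap_eq]
      ring
    rw [h, MvPolynomial.coeff_monomial, MvPolynomial.coeff_monomial]
    split_ifs with hb
    · rw [hb]
    · rw [zero_mul]
  | add p q hp hq => rw [map_add, MvPolynomial.coeff_add, hp, hq, MvPolynomial.coeff_add, add_mul]

/-- Invariance is known only off the zero set of `δ`. Multiplying by `δ` makes it an identity of
functions, hence of polynomials, and `δ` cancels in the integral domain; coefficients can then be
compared. -/
theorem prod_pow_eq_one_of_invariant {δ P : MvPolynomial σ ℂ} (hδ : δ ≠ 0) (c : σ → ℂ)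
    (h : ∀ x, MvPolynomial.eval x δ ≠ 0 →
      MvPolynomial.eval (fun e => c e * x e) P = MvPolynomial.eval x P)
    {α : σ →₀ ℕ} (hα : α ∈ P.support) : ∏ e ∈ α.support, c e ^ α e = 1 := by
  have h1 : (rescaleVars c P - P) * δ = 0 := by
    refine MvPolynomial.funext fun x => ?_
    rw [map_mul, map_sub, eval_rescaleVars, map_zero]
    by_cases hx : MvPolynomial.eval x δ = 0
    · rw [hx, mul_zero]
    · rw [h x hx, sub_self, zero_mul]
  have h2 : rescaleVars c P = P := sub_eq_zero.1 ((mul_eq_zero.1 h1).resolve_right hδ)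
  have h3 := coeff_rescaleVars c P α
  rw [h2] at h3
  exact (mul_eq_left₀ (MvPolynomial.mem_support_iff.1 hα)).1 h3.symm

/-- Here `c` may have zeros. In the application it is the projection onto matrices that split along
a cut, so a surviving monomial must contain a variable killed by `c`. -/
theorem prod_pow_eq_zero_of_vanishing {δ P : MvPolynomial σ ℂ} (c : σ → ℂ)
    (hδ : ∃ x : σ → ℂ, MvPolynomial.eval (fun e => c e * x e) δ ≠ 0)
    (h : ∀ x : σ → ℂ, MvPolynomial.eval (fun e => c e * x e) δ ≠ 0 →
      MvPolynomial.eval (fun e => c e * x e) P = 0)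
    {α : σ →₀ ℕ} (hα : α ∈ P.support) : ∏ e ∈ α.support, c e ^ α e = 0 := by
  have h1 : rescaleVars c P * rescaleVars c δ = 0 := by
    refine MvPolynomial.funext fun x => ?_
    rw [map_mul, eval_rescaleVars, eval_rescaleVars, map_zero]
    by_cases hx : MvPolynomial.eval (fun e => c e * x e) δ = 0
    · rw [hx, mul_zero]
    · rw [h x hx, zero_mul]
  have h2 : rescaleVars c P = 0 := by
    refine (mul_eq_zero.1 h1).resolve_right fun h0 => ?_
    obtain ⟨x, hx⟩ := hδ
    exact hx (by rw [← eval_rescaleVars, h0, map_zero])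
  have h3 := coeff_rescaleVars c P α
  rw [h2, MvPolynomial.coeff_zero] at h3
  exact (mul_eq_zero.1 h3.symm).resolve_left (MvPolynomial.mem_support_iff.1 hα)

end

/-! ### The graph of a balanced connected monomial -/

section

variable {σ : Type} [Fintype σ] {n : ℕ}

/-- The edges, with multiplicities `α`, which are not loops. -/
abbrev ProperEdge (a b : σ → Fin n) (α : σ → ℕ) : Type :=
  Σ e : {e : σ // a e ≠ b e}, Fin (α e)

/-- Take `α e` copies of each edge that is not a loop. The cut condition gives connectedness, and
for `{v}` it gives an edge between `v` and another vertex. Balance then provides both an outgoing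
and an incoming edge at `v`. -/
theorem exists_connGraph (hn : 2 ≤ n) (a b : σ → Fin n) (α : σ → ℕ)
    (hbal : ∀ p, ∑ e with a e = p, α e = ∑ e with b e = p, α e)
    (hconn : ∀ S : Finset (Fin n), S.Nonempty → S ≠ Finset.univ →
      ∃ e, α e ≠ 0 ∧ ¬(a e ∈ S ↔ b e ∈ S)) :
    ∃ G : ConnGraph n, ∀ w : Fin n → Fin n → ℝ,
      ∏ l, w (G.ini l) (G.ter l) = ∏ e with a e ≠ b e, w (a e) (b e) ^ α e := by
  classical
  let φ := Fintype.equivFin (ProperEdge a b α)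
  have hedge : ∀ e, α e ≠ 0 → a e ≠ b e → ∃ l, a (φ.symm l).1 = a e ∧ b (φ.symm l).1 = b e :=
    fun e he hab => ⟨φ ⟨⟨e, hab⟩, ⟨0, Nat.pos_of_ne_zero he⟩⟩, by simp, by simp⟩
  have : Nonempty (Fin n) := ⟨⟨0, by omega⟩⟩
  have hconnected : (SimpleGraph.fromRel fun v w => ∃ l, a (φ.symm l).1 = v ∧
      b (φ.symm l).1 = w).Connected := by
    refine ⟨fun v w => ?_⟩
    by_contra hvw
    set H := SimpleGraph.fromRel fun v w => ∃ l, a (φ.symm l).1 = v ∧ b (φ.symm l).1 = w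
    -- No edge can cross the boundary of the component of `v`.
    obtain ⟨e, he, hS⟩ := hconn (Finset.univ.filter fun u => H.Reachable v u)
      ⟨v, by simp⟩ (fun h => hvw (by simpa using (Finset.ext_iff.1 h w).2 (Finset.mem_univ w)))
    have hab : a e ≠ b e := fun h => hS (by rw [h])
    have hadj : H.Adj (a e) (b e) := by
      rw [SimpleGraph.fromRel_adj]
      exact ⟨hab, Or.inl (hedge e he hab)⟩
    refine hS ?_
    simp only [Finset.mem_filter, Finset.mem_univ, true_and]
    exact ⟨fun h => h.trans hadj.reachable, fun h => h.trans hadj.symm.reachable⟩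
  have htwo : ∀ v, 2 ≤ (Finset.univ.filter fun l => a (φ.symm l).1 = v ∨
      b (φ.symm l).1 = v).card := by
    intro v
    have hv := hbal v
    -- Loops at `v` contribute equally to both sides of the balance equation and are cancelled.
    rw [← Finset.sum_filter_add_sum_filter_not (Finset.univ.filter fun e => a e = v)
        (fun e => b e = v),
      ← Finset.sum_filter_add_sum_filter_not (Finset.univ.filter fun e => b e = v)
        (fun e => a e = v), Finset.filter_filter, Finset.filter_filter, Finset.filter_filter,
      Finset.filter_filter] at hv
    simp only [and_comm (b := b _ = v), add_right_inj] at hv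
    obtain ⟨e, he, hS⟩ := hconn {v} ⟨v, by simp⟩ (fun h => by
      have := congrArg Finset.card h
      simp at this
      omega)
    simp only [Finset.mem_singleton] at hS
    have hout : ∃ e, α e ≠ 0 ∧ a e = v ∧ b e ≠ v := by
      by_contra hno
      push Not at hno
      rw [Finset.sum_eq_zero] at hv
      · have h0 := (Finset.sum_eq_zero_iff.1 hv.symm) e
        by_cases h1 : a e = v
        · exact hS ⟨fun _ => hno e he h1, fun _ => h1⟩
        · have h2 : b e = v := by tauto
          exact he (h0 (by simp [h1, h2]))
      · intro e he
        by_contra h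
        simp only [Finset.mem_filter, Finset.mem_univ, true_and] at he
        have := hno e h
        tauto
    have hin : ∃ e, α e ≠ 0 ∧ b e = v ∧ a e ≠ v := by
      by_contra hno
      push Not at hno
      symm at hv
      rw [Finset.sum_eq_zero] at hv
      · have h0 := (Finset.sum_eq_zero_iff.1 hv.symm) e
        by_cases h1 : b e = v
        · exact hS ⟨fun _ => h1, fun _ => hno e he h1⟩
        · have h2 : a e = v := by tauto
          exact he (h0 (by simp [h1, h2]))
      · intro e he
        by_contra h
        simp only [Finset.mem_filter, Finset.mem_univ, true_and] at he
        have := hno e h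
        tauto
    obtain ⟨e₁, h₁, ha₁, hb₁⟩ := hout
    obtain ⟨e₂, h₂, hb₂, ha₂⟩ := hin
    obtain ⟨l₁, hl₁, -⟩ := hedge e₁ h₁ (fun h => hb₁ (h ▸ ha₁))
    obtain ⟨l₂, hl₂, hl₂'⟩ := hedge e₂ h₂ (fun h => ha₂ (h ▸ hb₂))
    refine Finset.one_lt_card.2 ⟨l₁, by simp [hl₁, ha₁], l₂, by simp [hl₂', hb₂], fun h => ?_⟩
    rw [h, hl₂, ha₁] at hl₁
    exact ha₂ hl₁
  refine ⟨⟨_, fun l => a (φ.symm l).1, fun l => b (φ.symm l).1, hconnected, htwo⟩, fun w => ?_⟩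
  simp only
  rw [φ.symm.prod_comp fun i => w (a i.1) (b i.1), Fintype.prod_sigma]
  simp only [Finset.prod_const, Finset.card_univ, Fintype.card_fin]
  exact (Finset.prod_subtype _ (by simp) fun e => w (a e) (b e) ^ α e).symm

/-- All edge weights are at most 1, so the supremum in `decay` is over a bounded family; an
unbounded one would have the default value 0. -/
theorem sq_mul_exp_le_one (x : ℝ) : x ^ 2 * Real.exp (-x ^ 2 / 2) ≤ 1 := by
  have h1 : 1 + x ^ 2 / 4 ≤ Real.exp (x ^ 2 / 4) := by linarith [Real.add_one_le_exp (x ^ 2 / 4)]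
  have h2 : x ^ 2 ≤ Real.exp (x ^ 2 / 2) := by
    have h3 : Real.exp (x ^ 2 / 2) = Real.exp (x ^ 2 / 4) ^ 2 := by
      rw [← Real.exp_nat_mul]; congr 1; push_cast; ring
    rw [h3]
    nlinarith [sq_nonneg (1 - x ^ 2 / 4), sq_nonneg x]
  rw [neg_div, Real.exp_neg, ← div_eq_mul_inv]
  exact (div_le_one (Real.exp_pos _)).2 h2

theorem prod_le_decay {m : ℕ} (z : Fin n → Cn m) (G : ConnGraph n) :
    ∏ l : Fin G.numEdges,
      ‖z (G.ini l) - z (G.ter l)‖ ^ 2 * Real.exp (-‖z (G.ini l) - z (G.ter l)‖ ^ 2 / 2) ≤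
        decay z := by
  refine le_ciSup (f := fun G : ConnGraph n => ∏ l : Fin G.numEdges,
    ‖z (G.ini l) - z (G.ter l)‖ ^ 2 * Real.exp (-‖z (G.ini l) - z (G.ter l)‖ ^ 2 / 2))
    ⟨1, ?_⟩ G
  rintro _ ⟨G, rfl⟩
  exact Finset.prod_le_one (fun l _ => by positivity) fun l _ => sq_mul_exp_le_one _

end

/-! ### The connected correlation form as a rational function of the covariances -/

section

variable {n k m : ℕ}

/-- The matrix with a given family of entries. -/
def entryMatrix (x : JetIdx (Fin n) k m × JetIdx (Fin n) k m → ℂ) :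
    Matrix (JetIdx (Fin n) k m) (JetIdx (Fin n) k m) ℂ :=
  Matrix.of fun u w => x (u, w)

/-- The determinant of the covariance of the values at the points of `S`, as a polynomial. -/
noncomputable def detPoly (k m : ℕ) (S : Finset (Fin n)) :
    MvPolynomial (JetIdx (Fin n) k m × JetIdx (Fin n) k m) ℂ :=
  (Matrix.of fun i j : {x // x ∈ S} × Fin k =>
    MvPolynomial.X (Sum.inl (i.1.1, i.2), Sum.inl (j.1.1, j.2))).det

theorem eval_detPoly (S : Finset (Fin n)) (x : JetIdx (Fin n) k m × JetIdx (Fin n) k m → ℂ) :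
    MvPolynomial.eval x (detPoly k m S) = (restr S (entryMatrix x)).toBlocks₁₁.det := by
  rw [detPoly, RingHom.map_det]
  congr 1
  ext i j
  simp only [RingHom.mapMatrix_apply, Matrix.map_apply, Matrix.of_apply, MvPolynomial.eval_X]
  rfl

/-- The product of the determinants of the covariances of the values at all sets of points. -/
noncomputable def discPoly (n k m : ℕ) :
    MvPolynomial (JetIdx (Fin n) k m × JetIdx (Fin n) k m) ℂ :=
  ∏ S : Finset (Fin n), detPoly k m S

theorem eval_discPoly (x : JetIdx (Fin n) k m × JetIdx (Fin n) k m → ℂ) :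
    MvPolynomial.eval x (discPoly n k m) =
      ∏ S : Finset (Fin n), (restr S (entryMatrix x)).toBlocks₁₁.det := by
  rw [discPoly, map_prod]
  exact Finset.prod_congr rfl fun S _ => eval_detPoly S x

theorem det_restr_ne_zero {x : JetIdx (Fin n) k m × JetIdx (Fin n) k m → ℂ}
    (hx : MvPolynomial.eval x (discPoly n k m) ≠ 0) (S : Finset (Fin n)) :
    (restr S (entryMatrix x)).toBlocks₁₁.det ≠ 0 := by
  rw [eval_discPoly] at hx
  exact Finset.prod_ne_zero_iff.1 hx S (Finset.mem_univ S)

theorem isRatFun_subForm (κ : ℂ) (S : Finset (Fin n)) :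
    IsRatFun (discPoly n k m) fun x => subForm κ (entryMatrix x) S := by
  refine (IsRatFun.const _).mul (IsRatFun.corrForm _ (fun i j => IsRatFun.coord _) ?_)
  simp only [← eval_detPoly]
  exact IsRatFun.inv_eval (Finset.dvd_prod_of_mem _ (Finset.mem_univ S))

theorem isRatFun_cumulant (κ : ℂ) :
    IsRatFun (discPoly n k m) fun x => cumulant (subForm κ (entryMatrix x)) := by
  simp only [cumulant]
  exact IsRatFun.sum _ fun G _ => (IsRatFun.const _).mul
    (IsRatFun.prod _ fun B _ => isRatFun_subForm κ B)

theorem eval_one_discPoly :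
    MvPolynomial.eval (fun e => if e.1 = e.2 then 1 else 0) (discPoly n k m) = 1 := by
  rw [eval_discPoly]
  refine Finset.prod_eq_one fun S _ => ?_
  convert Matrix.det_one (n := {x // x ∈ S} × Fin k) (R := ℂ)
  ext i j
  have h : (Sum.inl (i.1.1, i.2) : JetIdx (Fin n) k m) = Sum.inl (j.1.1, j.2) ↔ i = j := by
    rw [Sum.inl.injEq, Prod.mk.injEq, Prod.ext_iff, Subtype.ext_iff]
  exact (if_congr h rfl rfl).trans Matrix.one_apply.symm

theorem exists_rational_cumulant (n k m : ℕ) (κ : ℂ) :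
    ∃ (P : MvPolynomial (JetIdx (Fin n) k m × JetIdx (Fin n) k m) ℂ) (M : ℕ),
      (∀ x, MvPolynomial.eval x (discPoly n k m) ≠ 0 → MvPolynomial.eval x P =
        MvPolynomial.eval x (discPoly n k m) ^ M * cumulant (subForm κ (entryMatrix x))) ∧
      (∀ α ∈ P.support, ∀ p, ∑ e with pt e.1 = p, α e = ∑ e with pt e.2 = p, α e) ∧
      ∀ α ∈ P.support, ∀ S : Finset (Fin n), S.Nonempty → S ≠ Finset.univ →
        ∃ e, α e ≠ 0 ∧ ¬(pt e.1 ∈ S ↔ pt e.2 ∈ S) := by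
  obtain ⟨P, M, hP⟩ := isRatFun_cumulant (n := n) (k := k) (m := m) κ
  dsimp only at hP
  have hne : discPoly n k m ≠ 0 := fun h => by
    have := eval_one_discPoly (n := n) (k := k) (m := m)
    rw [h, map_zero] at this
    exact zero_ne_one this
  refine ⟨P, M, hP, fun α hα p => ?_, fun α hα S hS hS' => ?_⟩
  -- Torus invariance for this `t` reads `2^out = 2^in`, with `out` and `in` the degrees of the
  -- monomial at `p`.
  · set t : Fin n → ℂ := fun q => if q = p then 2 else 1 with ht
    have ht0 : ∀ q, t q ≠ 0 := fun q => by simp only [ht]; split_ifs <;> norm_num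
    have h := prod_pow_eq_one_of_invariant hne (fun e => t (pt e.1) * (t (pt e.2))⁻¹)
      (fun x hx => ?_) hα
    · have h1 : ∀ f : JetIdx (Fin n) k m × JetIdx (Fin n) k m → Fin n,
          ∏ e ∈ α.support, t (f e) ^ α e = (2 : ℂ) ^ ∑ e with f e = p, α e := by
        intro f
        rw [← Finset.prod_pow_eq_pow_sum, Finset.prod_filter,
          Finset.prod_subset (Finset.subset_univ α.support)
            (fun e _ he => by rw [Finsupp.notMem_support_iff.1 he, pow_zero])]
        refine Finset.prod_congr rfl fun e _ => ?_
        simp only [ht]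
        split_ifs <;> simp
      simp only [mul_pow, inv_pow, Finset.prod_mul_distrib, Finset.prod_inv_distrib] at h
      rw [h1 fun e => pt e.1, h1 fun e => pt e.2, mul_inv_eq_one₀ (by positivity)] at h
      exact Nat.pow_right_injective le_rfl (by exact_mod_cast h)
    · have hX : entryMatrix (fun e => t (pt e.1) * (t (pt e.2))⁻¹ * x e) =
          torusConj t (entryMatrix x) := by
        ext u w
        simp only [entryMatrix, torusConj, Matrix.of_apply]
        ring
      have hd : MvPolynomial.eval (fun e => t (pt e.1) * (t (pt e.2))⁻¹ * x e) (discPoly n k m) =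
          MvPolynomial.eval x (discPoly n k m) := by
        rw [eval_discPoly, eval_discPoly, hX]
        exact Finset.prod_congr rfl fun S _ => det_restr_torusConj ht0 _ S
      rw [hP _ (by rwa [hd]), hP x hx, hd, hX]
      congr 2
      ext S
      exact subForm_torusConj κ ht0 _ S (det_restr_ne_zero hx S)
  -- The substitution deletes all entries across the cut, after which the cumulant vanishes. The
  -- identity matrix shows that `discPoly` remains nonzero under it.
  · have h := prod_pow_eq_zero_of_vanishing (δ := discPoly n k m)
      (c := fun e => if (pt e.1 ∈ S ↔ pt e.2 ∈ S) then 1 else 0)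
      ⟨fun e => if e.1 = e.2 then 1 else 0, ?_⟩ (fun x hx => ?_) hα
    · obtain ⟨e, he, h0⟩ := Finset.prod_eq_zero_iff.1 h
      refine ⟨e, Finsupp.mem_support_iff.1 he, fun hS => ?_⟩
      rw [if_pos hS, one_pow] at h0
      exact one_ne_zero h0
    · have : (fun e : JetIdx (Fin n) k m × JetIdx (Fin n) k m =>
          (if (pt e.1 ∈ S ↔ pt e.2 ∈ S) then (1 : ℂ) else 0) * if e.1 = e.2 then 1 else 0) =
          fun e => if e.1 = e.2 then 1 else 0 := by
        ext e
        by_cases he : e.1 = e.2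
        · simp [he]
        · simp [he]
      rw [this, eval_one_discPoly]
      exact one_ne_zero
    · rw [hP _ hx, cumulant_eq_zero_of_split (subForm_empty _ _) hS hS'
        (subForm_split κ _ S (fun u w huw => ?_) (det_restr_ne_zero hx)), mul_zero]
      simp only [entryMatrix, Matrix.of_apply]
      rw [if_neg huw, zero_mul]

/-! ### Decay of the connected correlation form -/

/-- Entries at a single point are the loops discarded from the graph and cost at most a factor 1;
every other entry supplies its edge weight, up to the constant. -/
theorem norm_monomial_le_decay (hn : 2 ≤ n) {c : ℝ} (hc : 0 < c)
    {α : JetIdx (Fin n) k m × JetIdx (Fin n) k m →₀ ℕ}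
    (hbal : ∀ p, ∑ e with pt e.1 = p, α e = ∑ e with pt e.2 = p, α e)
    (hconn : ∀ S : Finset (Fin n), S.Nonempty → S ≠ Finset.univ →
      ∃ e, α e ≠ 0 ∧ ¬(pt e.1 ∈ S ↔ pt e.2 ∈ S))
    {z : Fin n → Cn m} (hz : ∀ p q, p ≠ q → c ≤ ‖z p - z q‖) :
    ‖∏ e, normCov k z e.1 e.2 ^ α e‖ ≤ (1 + c⁻¹ + (c ^ 2)⁻¹) ^ (∑ e, α e) * decay z := by
  obtain ⟨G, hG⟩ := exists_connGraph hn (fun e => pt e.1) (fun e => pt e.2) α hbal hconn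
  have hdec := prod_le_decay z G
  rw [hG fun p q => ‖z p - z q‖ ^ 2 * Real.exp (-‖z p - z q‖ ^ 2 / 2)] at hdec
  have hC : 1 ≤ 1 + c⁻¹ + (c ^ 2)⁻¹ := by
    have : 0 ≤ c⁻¹ + (c ^ 2)⁻¹ := by positivity
    linarith
  refine le_trans ?_ (mul_le_mul_of_nonneg_left hdec (by positivity))
  rw [← Finset.prod_pow_eq_pow_sum, norm_prod, Finset.prod_filter, ← Finset.prod_mul_distrib]
  refine Finset.prod_le_prod (fun e _ => norm_nonneg _) fun e _ => ?_
  rw [norm_pow]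
  split_ifs with he
  · rw [← mul_pow]
    exact pow_le_pow_left₀ (norm_nonneg _) (norm_normCov_le hc z _ _ (hz _ _ he)) _
  · rw [mul_one]
    exact pow_le_pow_left₀ (norm_nonneg _)
      ((norm_normCov_le_one z _ _ (not_not.1 he)).trans hC) _

theorem exists_norm_cumulant_le_decay (hn : 2 ≤ n) (k m : ℕ) (κ : ℂ) {c : ℝ} (hc : 0 < c) :
    ∃ C : ℝ, ∀ z : Fin n → Cn m, (∀ p q, p ≠ q → c ≤ ‖z p - z q‖) →
      ‖cumulant (subForm κ (normCov k z))‖ ≤ C * decay z := by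
  obtain ⟨P, M, hP, hbal, hconn⟩ := exists_rational_cumulant n k m κ
  choose μ hμ hμd using fun S : Finset (Fin n) =>
    exists_le_norm_det_normCov {x // x ∈ S} k m hc
  set δ₀ : ℝ := ∏ S, μ S with hδ₀
  have hδpos : 0 < δ₀ := Finset.prod_pos fun S _ => hμ S
  refine ⟨(δ₀ ^ M)⁻¹ * ∑ α ∈ P.support, ‖P.coeff α‖ * (1 + c⁻¹ + (c ^ 2)⁻¹) ^ (∑ e, α e),
    fun z hz => ?_⟩
  set x : JetIdx (Fin n) k m × JetIdx (Fin n) k m → ℂ := fun e => normCov k z e.1 e.2 with hx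
  have hX : entryMatrix x = normCov k z := rfl
  have hδ : δ₀ ≤ ‖MvPolynomial.eval x (discPoly n k m)‖ := by
    rw [eval_discPoly, norm_prod]
    refine Finset.prod_le_prod (fun S _ => (hμ S).le) fun S _ => ?_
    have hr : restr S (entryMatrix x) = normCov k fun p : {x // x ∈ S} => z p := by
      ext u w
      rcases u with u | u <;> rcases w with w | w <;> rfl
    rw [hr]
    exact hμd S _ fun p q hpq => hz _ _ fun h => hpq (Subtype.ext h)
  have hne : MvPolynomial.eval x (discPoly n k m) ≠ 0 := norm_pos_iff.1 (hδpos.trans_le hδ)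
  have h := hP x hne
  rw [hX] at h
  have hle : δ₀ ^ M * ‖cumulant (subForm κ (normCov k z))‖ ≤ ‖MvPolynomial.eval x P‖ := by
    rw [h, norm_mul, norm_pow]
    gcongr
  have hev : ‖MvPolynomial.eval x P‖ ≤
      (∑ α ∈ P.support, ‖P.coeff α‖ * (1 + c⁻¹ + (c ^ 2)⁻¹) ^ (∑ e, α e)) * decay z := by
    rw [MvPolynomial.eval_eq', Finset.sum_mul]
    refine (norm_sum_le _ _).trans (Finset.sum_le_sum fun α hα => ?_)
    rw [norm_mul, mul_assoc]
    exact mul_le_mul_of_nonneg_left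
      (norm_monomial_le_decay hn hc (hbal α hα) (hconn α hα) hz) (norm_nonneg _)
  rw [mul_assoc, ← div_eq_inv_mul, le_div_iff₀ (by positivity), mul_comm]
  exact hle.trans hev

theorem ofReal_connectedCorr {z : Fin n → Cn m} (hz : Function.Injective z) :
    (connectedCorr k m z : ℂ) =
      cumulant (subForm (((m - k).factorial : ℂ) / m.factorial) (normCov k z)) := by
  rw [connectedCorr, cumulant]
  push_cast
  refine Finset.sum_congr rfl fun G _ => ?_
  congr 1
  refine Finset.prod_congr rfl fun B _ => ?_
  rw [(tendsto_scaledCorr_limitCorr k (z := fun p : {x // x ∈ B} => z p)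
    (hz.comp Subtype.val_injective)).2, subForm, Fintype.card_coe]
  congr 2
  ext u w
  rcases u with u | u <;> rcases w with w | w <;> rfl

end

end RandomZeros

theorem theorem4p2 (n k m : ℕ) (hn : 1 ≤ n) (hk : 1 ≤ k) (hkm : k ≤ m) :
    (∀ z : Fin n → RandomZeros.Cn m, Function.Injective z →
      Tendsto (RandomZeros.scaledCorr k m z) atTop (𝓝 (RandomZeros.limitCorr k m z))) ∧
    ∀ c : ℝ, 0 < c → ∃ C R : ℝ, ∀ z : Fin n → RandomZeros.Cn m,
      (∀ p q, p ≠ q → c ≤ ‖z p - z q‖) →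
      (∃ p q, R ≤ ‖z p - z q‖) →
      |RandomZeros.connectedCorr k m z| ≤ C * RandomZeros.decay z := by
  refine ⟨fun z hz => (RandomZeros.tendsto_scaledCorr_limitCorr k hz).1, fun c hc => ?_⟩
  rcases hn.eq_or_lt with rfl | hn
  -- For a single point all edges are loops of weight 0, so `decay` vanishes; any positive `R`
  -- excludes this case.
  · refine ⟨0, 1, fun z _ ⟨p, q, hpq⟩ => ?_⟩
    rw [Subsingleton.elim p q, sub_self, norm_zero] at hpq
    exact absurd hpq (by norm_num)
  · obtain ⟨C, hC⟩ := RandomZeros.exists_norm_cumulant_le_decay hn k m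
      (((m - k).factorial : ℂ) / m.factorial) hc
    refine ⟨C, 0, fun z hz _ => ?_⟩
    have hinj : Function.Injective z := fun p q hpq => by
      by_contra h
      have := hz p q h
      rw [hpq, sub_self, norm_zero] at this
      linarith
    rw [← Real.norm_eq_abs, ← Complex.norm_real, RandomZeros.ofReal_connectedCorr hinj]
    exact hC z hz
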